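/- Let $\mathbb S^2\subset\mathbb R^3$ be the unit sphere with its surface measure $\mu$, geodesic distance $d$, and spherical harmonics $Y_{\ell m}$; write $\hat f_{\ell m}=\langle f,Y_{\ell m}\rangle$. For $\alpha>1$ put $s_\alpha(t)=s\bigl(\tfrac{2\alpha}{\alpha-1}(t-\alpha^{-1})-1\bigr)$, where $s(t)=e^{-1/(1-t^2)}$ for $|t|<1$ and $s(t)=0$ otherwise, and $$k_\alpha(t)=\frac{\int_t^1 s_\alpha^2(u)\,du/u}{\int_{\alpha^{-1}}^1 s_\alpha^2(u)\,du/u},\qquad \kappa_\alpha(t)=\sqrt{k_\alpha(\alpha^{-1}t)-k_\alpha(t)}.$$ For integers $L\ge 1$, $D\ge 0$ and $0\le J_0\le J:=\lceil\log_\alpha L\rceil$, let the wavelets $\psi_j$ ($J_0\le j\le J$) and the scaling function $\Phi$ be the axisymmetric functions on $\mathbb S^2$ with harmonic coefficients $$(\hat\psi_j)_{\ell m}=\sqrt{\tfrac{2\ell+1}{4\pi}}\,\kappa_\alpha(\alpha^{-j}\ell)\,\delta_{m0},\qquad \hat\Phi_{\ell m}=\sqrt{\tfrac{2\ell+1}{4\pi}}\,\sqrt{k_\alpha(\alpha^{-J_0}\ell)}\,\delta_{m0},$$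 and let $(f\star\psi)(\omega)=\langle f,R_\omega\psi\rangle$, where $R_\omega$ is the rotation with Euler angles $(\varphi,\theta,0)$ for $\omega=(\theta,\varphi)$. For a path $p=(j_1,\dots,j_d)$ put $U[j]f=|f\star\psi_j|$, $U[p]f=U[j_d]\cdots U[j_1]f$ and $S[p]f=(U[p]f)\star\Phi$. Let $\mathbb P_D$ be the set of all paths with $0\le d\le D$ and $J_0\le j_i\le J$, let $\mathcal S_{\mathbb P_D}f=\{S[p]f\}_{p\in\mathbb P_D}$, and let $\|\{F_p\}_{p\in\mathbb P_D}\|_2=\bigl(\sum_{p\in\mathbb P_D}\|F_p\|_2^2\bigr)^{1/2}$. For a bijection $\zeta$ of $\mathbb S^2$ let $V_\zeta f(\omega)=f(\zeta^{-1}\omega)$ and $\|\zeta\|_\infty=\sup_\omega d(\omega,\zeta(\omega))$. A diffeomorphism is a differentiable bijection with differentiable inverse. **Theorem (Stability to diffeomorphisms).** There is an absolute constant $C>0$ such that the following holds for all $\alpha>1$, $L$, $D$ and $J_0$ as above. Let $\zeta$ be a diffeomorphism of $\mathbb S^2$ with $\zeta=\zeta_1\circ\zeta_2$, where $\zeta_1$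 is an isometry and $\zeta_2$ a diffeomorphism of $\mathbb S^2$. Then for all $f\in L^2(\mathbb S^2)$ that are bandlimited at $L$ (that is, $\hat f_{\ell m}=0$ for all $\ell\ge L$ and $|m|\le\ell$), $V_\zeta f\in L^2(\mathbb S^2)$ and $$\bigl\|\mathcal S_{\mathbb P_D}f-\mathcal S_{\mathbb P_D}V_\zeta f\bigr\|_2\le C L^2\Bigl[L^{1/2}(D+1)^{1/2}\alpha^{J_0}\|\zeta_1\|_\infty+L^2\|\zeta_2\|_\infty\Bigr]\|f\|_2 .$$ -/

import Mathlib

noncomputable section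

namespace SphereScattering

open MeasureTheory Polynomial

/-! ### The sphere, its measure, signals -/

/-- The unit sphere in three-dimensional Euclidean space. -/
abbrev S2 : Type := Metric.sphere (0 : EuclideanSpace ℝ (Fin 3)) 1

instance instFactFinrankS2 : Fact (Module.finrank ℝ (EuclideanSpace ℝ (Fin 3)) = 2 + 1) :=
  ⟨by simp⟩

/-- The rotation invariant surface measure `sin θ dθ dφ` on the sphere (total mass `4π`). -/
def surfaceMeasure : Measure S2 := (volume : Measure (EuclideanSpace ℝ (Fin 3))).toSphere

/-- `⟨f, g⟩ = ∫ f(ω) g(ω)^* dμ(ω)`. -/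
def l2Inner (f g : S2 → ℂ) : ℂ := ∫ ω, f ω * (starRingEnd ℂ) (g ω) ∂surfaceMeasure

/-- The norm of `L²(S²)`. -/
def l2Norm (f : S2 → ℂ) : ℝ := (eLpNorm f 2 surfaceMeasure).toReal

/-! ### Spherical harmonics -/

/-- The Legendre polynomial `P_ℓ` (Rodrigues' formula). -/
def legendre (l : ℕ) : ℝ[X] :=
  C (1 / (2 ^ l * (Nat.factorial l : ℝ))) * derivative^[l] ((X ^ 2 - 1) ^ l)

/-- The spherical harmonic `Y_{ℓm}` of order `m ≥ 0` in Cartesian coordinates, i.e.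
`√((2ℓ+1)/(4π) · (ℓ-m)!/(ℓ+m)!) P_ℓ^m(cos θ) e^{imφ}` with the associated Legendre function
`P_ℓ^m(t) = (-1)^m (1-t²)^{m/2} (d/dt)^m P_ℓ(t)`;
note `cos θ = ω₂` and `(sin θ)^m e^{imφ} = (ω₀ + i ω₁)^m`. -/
def sphericalHarmonicNat (l m : ℕ) (ω : S2) : ℂ :=
  (-1) ^ m *
    ((Real.sqrt ((2 * l + 1) / (4 * Real.pi) *
      ((Nat.factorial (l - m) : ℝ) / (Nat.factorial (l + m) : ℝ))) : ℝ) : ℂ) *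
    (((derivative^[m] (legendre l)).eval (ω.1 2) : ℝ) : ℂ) *
    ((ω.1 0 : ℂ) + (ω.1 1 : ℂ) * Complex.I) ^ m

/-- The spherical harmonic `Y_{ℓm}`, with `Y_{ℓ,-m} = (-1)^m Y_{ℓm}^*`. -/
def sphericalHarmonic (l : ℕ) (m : ℤ) (ω : S2) : ℂ :=
  if 0 ≤ m then sphericalHarmonicNat l m.natAbs ω
  else (-1) ^ m.natAbs * (starRingEnd ℂ) (sphericalHarmonicNat l m.natAbs ω)

/-- `f̂_{ℓm} = ⟨f, Y_{ℓm}⟩`. -/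
def harmonicCoeff (f : S2 → ℂ) (l : ℕ) (m : ℤ) : ℂ := l2Inner f (sphericalHarmonic l m)

/-- `f` is bandlimited at `L`: `f̂_{ℓm} = 0` for all `ℓ ≥ L` and `|m| ≤ ℓ`. -/
def IsBandlimited (L : ℕ) (f : S2 → ℂ) : Prop :=
  ∀ l : ℕ, L ≤ l → ∀ m : ℤ, |m| ≤ (l : ℤ) → harmonicCoeff f l m = 0

/-- The function with spherical harmonic coefficients `c` (only used for `c ℓ m` vanishing for
all but finitely many `ℓ`). -/
def harmonicSynthesis (c : ℕ → ℤ → ℂ) (ω : S2) : ℂ :=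
  ∑' l : ℕ, ∑ m ∈ Finset.Icc (-(l : ℤ)) (l : ℤ), c l m * sphericalHarmonic l m ω

/-! ### Rotations and spherical convolution -/

/-- Rotation by the angle `t` about the third axis. -/
def rotZMatrix (t : ℝ) : Matrix (Fin 3) (Fin 3) ℝ :=
  !![Real.cos t, -Real.sin t, 0; Real.sin t, Real.cos t, 0; 0, 0, 1]

/-- Rotation by the angle `t` about the second axis. -/
def rotYMatrix (t : ℝ) : Matrix (Fin 3) (Fin 3) ℝ :=
  !![Real.cos t, 0, Real.sin t; 0, 1, 0; -Real.sin t, 0, Real.cos t]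

theorem rotZMatrix_mem (t : ℝ) : rotZMatrix t ∈ Matrix.specialOrthogonalGroup (Fin 3) ℝ := by
  have h := Real.sin_sq_add_cos_sq t
  rw [Matrix.mem_specialOrthogonalGroup_iff, Matrix.mem_orthogonalGroup_iff]
  constructor
  · ext i j
    fin_cases i <;> fin_cases j <;>
      simp [rotZMatrix, Matrix.mul_apply, Fin.sum_univ_three] <;> nlinarith
  · simp [rotZMatrix, Matrix.det_fin_three]; nlinarith

theorem rotYMatrix_mem (t : ℝ) : rotYMatrix t ∈ Matrix.specialOrthogonalGroup (Fin 3) ℝ := by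
  have h := Real.sin_sq_add_cos_sq t
  rw [Matrix.mem_specialOrthogonalGroup_iff, Matrix.mem_orthogonalGroup_iff]
  constructor
  · ext i j
    fin_cases i <;> fin_cases j <;>
      simp [rotYMatrix, Matrix.mul_apply, Fin.sum_univ_three] <;> nlinarith
  · simp [rotYMatrix, Matrix.det_fin_three]; nlinarith

/-- The rotation group `SO(3)`. -/
abbrev SO3 : Type := Matrix.specialOrthogonalGroup (Fin 3) ℝ

/-- The rotation `R_ω = R_{(φ, θ, 0)}` in `zyz` Euler angles, where `ω` has colatitude `θ` and
longitude `φ`; it carries the north pole to `ω`. -/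
def rotTo (ω : S2) : SO3 :=
  ⟨rotZMatrix (Complex.arg ((ω.1 0 : ℂ) + (ω.1 1 : ℂ) * Complex.I)), rotZMatrix_mem _⟩ *
    ⟨rotYMatrix (Real.arccos (ω.1 2)), rotYMatrix_mem _⟩

theorem SO3.norm_toLp_mulVec (R : SO3) (v : EuclideanSpace ℝ (Fin 3)) :
    ‖WithLp.toLp 2 (R.1.mulVec v.ofLp)‖ = ‖v‖ := by
  have hR : R.1.transpose * R.1 = 1 :=
    (Matrix.mem_orthogonalGroup_iff' _ _).1 (Matrix.mem_specialOrthogonalGroup_iff.1 R.2).1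
  have h2 : ‖WithLp.toLp 2 (R.1.mulVec v.ofLp)‖ ^ 2 = ‖v‖ ^ 2 := by
    rw [← real_inner_self_eq_norm_sq, ← real_inner_self_eq_norm_sq,
      EuclideanSpace.inner_eq_star_dotProduct, EuclideanSpace.inner_eq_star_dotProduct]
    simp only [star_trivial]
    rw [Matrix.dotProduct_mulVec, Matrix.vecMul_mulVec, ← Matrix.mulVec_transpose]
    simp [hR]
  exact (sq_eq_sq₀ (norm_nonneg _) (norm_nonneg _)).1 h2

/-- The action of a rotation on points of the sphere. -/
def SO3.act (R : SO3) (ω : S2) : S2 :=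
  ⟨WithLp.toLp 2 (R.1.mulVec ω.1.ofLp), by
    rw [mem_sphere_zero_iff_norm, SO3.norm_toLp_mulVec]
    exact mem_sphere_zero_iff_norm.1 ω.2⟩

/-- The action of a rotation on signals: `(R ψ)(ω) = ψ(R⁻¹ ω)`. -/
def SO3.rotate (R : SO3) (ψ : S2 → ℂ) : S2 → ℂ := fun ω => ψ (SO3.act R⁻¹ ω)

/-- `(f ⋆ ψ)(ω) = ⟨f, R_ω ψ⟩`. -/
def sphConv (f ψ : S2 → ℂ) : S2 → ℂ := fun ω => l2Inner f (SO3.rotate (rotTo ω) ψ)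

/-! ### Scale-discretized wavelets -/

/-- `s(t) = exp(-(1-t²)⁻¹)` on `(-1,1)`, zero elsewhere. -/
def bump (t : ℝ) : ℝ :=
  if -1 < t ∧ t < 1 then Real.exp (-(1 - t ^ 2)⁻¹) else 0

/-- `s_α(t) = s(2α/(α-1) (t - α⁻¹) - 1)`, supported in `[α⁻¹, 1]`. -/
def bumpScaled (α t : ℝ) : ℝ := bump (2 * α / (α - 1) * (t - α⁻¹) - 1)

/-- `k_α(t) = ∫_t^1 s_α(u)² du/u / ∫_{α⁻¹}^1 s_α(u)² du/u`. -/
def kFun (α t : ℝ) : ℝ :=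
  (∫ u in t..1, bumpScaled α u ^ 2 / u) / (∫ u in α⁻¹..1, bumpScaled α u ^ 2 / u)

/-- `κ_α(t) = √(k_α(α⁻¹ t) - k_α(t))`. -/
def kappa (α t : ℝ) : ℝ := Real.sqrt (kFun α (α⁻¹ * t) - kFun α t)

/-- Harmonic coefficients `(ψ̂_j)_{ℓm}` of the wavelet at scale `j`. -/
def waveletCoeff (α : ℝ) (j : ℕ) (l : ℕ) (m : ℤ) : ℂ :=
  if m = 0 then
    ((Real.sqrt ((2 * l + 1) / (4 * Real.pi)) * kappa α ((α ^ j)⁻¹ * l) : ℝ) : ℂ) else 0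

/-- Harmonic coefficients `Φ̂_{ℓm}` of the scaling function for the minimum scale `J₀`. -/
def scalingCoeff (α : ℝ) (J₀ : ℕ) (l : ℕ) (m : ℤ) : ℂ :=
  if m = 0 then
    ((Real.sqrt ((2 * l + 1) / (4 * Real.pi)) * Real.sqrt (kFun α ((α ^ J₀)⁻¹ * l)) : ℝ) : ℂ)
  else 0

/-- The wavelet `ψ_j`. -/
def wavelet (α : ℝ) (j : ℕ) : S2 → ℂ := harmonicSynthesis (waveletCoeff α j)

/-- The scaling function `Φ`. -/
def scalingFunction (α : ℝ) (J₀ : ℕ) : S2 → ℂ := harmonicSynthesis (scalingCoeff α J₀)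

/-- The maximum wavelet scale `J = ⌈log_α L⌉` for the bandlimit `L ≥ 1`. -/
def maxScale (α : ℝ) (L : ℕ) : ℕ := ⌈Real.logb α L⌉₊

/-! ### Scattering networks -/

/-- `U[j] f = |f ⋆ ψ_j|`. -/
def propagatorStep (α : ℝ) (j : ℕ) (f : S2 → ℂ) : S2 → ℂ :=
  fun ω => ((‖sphConv f (wavelet α j) ω‖ : ℝ) : ℂ)

/-- `U[j₁, …, j_d] f = U[j_d] ⋯ U[j₁] f`. -/
def propagator (α : ℝ) : List ℕ → (S2 → ℂ) → S2 → ℂ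
  | [], f => f
  | j :: p, f => propagator α p (propagatorStep α j f)

/-- `S[p] f = (U[p] f) ⋆ Φ`. -/
def scatteringTransform (α : ℝ) (J₀ : ℕ) (p : List ℕ) (f : S2 → ℂ) : S2 → ℂ :=
  sphConv (propagator α p f) (scalingFunction α J₀)

/-- The path set `P_D`: all `(j₁, …, j_d)` with `J₀ ≤ j_i ≤ J` and `0 ≤ d ≤ D`. -/
def pathSet (J₀ J D : ℕ) : Set (List ℕ) :=
  {p | p.length ≤ D ∧ ∀ j ∈ p, J₀ ≤ j ∧ j ≤ J}

theorem pathSet_finite (J₀ J D : ℕ) : (pathSet J₀ J D).Finite := by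
  refine ((List.finite_length_le (Fin (J + 1)) D).image (List.map Fin.val)).subset ?_
  rintro p ⟨hp, hj⟩
  refine ⟨p.map (fun j => Fin.ofNat (J + 1) j), by simpa using hp, ?_⟩
  rw [List.map_map]
  conv_rhs => rw [← List.map_id p]
  refine List.map_congr_left fun j h => ?_
  have := (hj j h).2
  simp only [Function.comp, Fin.ofNat, id]
  exact Nat.mod_eq_of_lt (by omega)

instance instFintypePathSet (J₀ J D : ℕ) : Fintype (pathSet J₀ J D) :=
  (pathSet_finite J₀ J D).fintype

/-- The scattering network `S_{P_D} f = {S[p] f : p ∈ P_D}` for the bandlimit `L`. -/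
def scatteringNetwork (α : ℝ) (L J₀ D : ℕ) (f : S2 → ℂ) :
    pathSet J₀ (maxScale α L) D → S2 → ℂ :=
  fun p => scatteringTransform α J₀ p.1 f

/-- The norm `(∑_p ‖F_p‖₂²)^{1/2}` of a finite collection of signals. -/
def collectionNorm {ι : Type} [Fintype ι] (F : ι → S2 → ℂ) : ℝ :=
  Real.sqrt (∑ p, l2Norm (F p) ^ 2)

/-! ### Isometries and diffeomorphisms -/

/-- The geodesic distance on the sphere. -/
def geodesicDist (x y : S2) : ℝ := InnerProductGeometry.angle x.1 y.1

/-- `ζ ∈ Isom(S²)`. -/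
def IsSphereIsometry (ζ : S2 ≃ S2) : Prop :=
  ∀ x y, geodesicDist (ζ x) (ζ y) = geodesicDist x y

open scoped Manifold in
/-- `ζ ∈ Diff(S²)`: a differentiable bijection with differentiable inverse. -/
def IsSphereDiffeo (ζ : S2 ≃ S2) : Prop :=
  MDifferentiable (𝓡 2) (𝓡 2) ζ ∧ MDifferentiable (𝓡 2) (𝓡 2) ζ.symm

/-- `‖ζ‖_∞`, the maximum displacement. -/
def maxDisplacement (ζ : S2 ≃ S2) : ℝ := ⨆ ω : S2, geodesicDist ω (ζ ω)

/-- `(V_ζ f)(ω) = f(ζ⁻¹ ω)`. -/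
def deform (ζ : S2 ≃ S2) (f : S2 → ℂ) : S2 → ℂ := fun ω => f (ζ.symm ω)

end SphereScattering

end

noncomputable section

namespace SphereScattering

open MeasureTheory Polynomial

/-! ### Legendre polynomials -/

/-! Since `V_ζ f = V_ζ₁ (V_ζ₂ f)`, the error splits as (`S f - S V_ζ₁ f`) + (`S V_ζ₁ f - S V_ζ₁ V_ζ₂
f`), and the two pieces are bounded by unrelated mechanisms.

Isometry piece. Every filter is axisymmetric, so convolution, modulus and hence the whole network
commute with isometries (`scatteringTransform_isomAct`). It remains to compare `S[p] f` with its own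
rotation. In coordinates adapted to the axis, a rotation multiplies the order-`m` coefficient by `u
^ m` with `‖u‖ = 1`, and `‖1 - u ^ m‖ ≤ |m| ‖u - 1‖`. The low-pass filter `Φ` keeps only degrees `ℓ
< α ^ J₀`, which bounds `|m|`. An isometry of determinant `-1` reverses a unit vector, so its
displacement is at least 2 and the bound is trivial (`l2Norm_sphConv_sub_isomAct_le`). The squared
multipliers of the filter bank sum to at most 1, so each of the `D + 1` layers carries energy at
most `‖f‖²`, and summing over paths costs `√(D+1)` (`sum_l2Norm_propagator_sq_le`).

Diffeomorphism piece. The network is nonexpansive (`sum_l2Norm_scatteringTransform_sub_sq_le`) and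
`V_ζ₁` preserves the norm, so this piece is at most `‖f - V_ζ₂ f‖`. A bandlimited `f` agrees almost
everywhere with a finite harmonic sum that is Lipschitz with constant `L² ‖f‖`
(`norm_finiteSynthesis_sub_le`). The Lipschitz constant comes from Cauchy–Schwarz, the addition
theorem and a bound on `1 - P_ℓ(t)`. "Almost everywhere" survives composition with `ζ₂⁻¹` because a
differentiable map sends null sets to null sets.

The resulting bound, `2 (√(D+1) α^J₀ ‖ζ₁‖ + 4 L² ‖ζ₂‖) ‖f‖`, is stronger than the one claimed; the
remaining powers of `L` are at least 1.

The harmonic analysis on which this rests is built from the explicit formulas: orthonormality from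
Legendre's equation and the hat-box theorem, completeness from Stone–Weierstrass, and the addition
theorem from rotation invariance of polynomial spaces. -/

theorem integral_derivative_eval (p : ℝ[X]) (a b : ℝ) :
    ∫ t in a..b, (derivative p).eval t = p.eval b - p.eval a :=
  intervalIntegral.integral_eq_sub_of_hasDerivAt (fun t _ => p.hasDerivAt t)
    ((derivative p).continuous.intervalIntegrable _ _)

/-- With `q = (X² - 1)^l` one has `(X² - 1) q' = 2l X q`; this is that identity differentiated `n +
1` times. The case `n = l + m` gives the differentiated Legendre equation. -/
theorem iterate_derivative_sq_sub_one_pow (l n : ℕ) :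
    (X ^ 2 - 1) * derivative^[n + 2] ((X ^ 2 - 1) ^ l : ℝ[X]) +
      C (2 * (n + 1) - 2 * l : ℝ) * X * derivative^[n + 1] ((X ^ 2 - 1) ^ l) -
      C ((n + 1) * (2 * l - n) : ℝ) * derivative^[n] ((X ^ 2 - 1) ^ l) = 0 := by
  induction n with
  | zero =>
    have h : (X ^ 2 - 1) * derivative ((X ^ 2 - 1) ^ l : ℝ[X]) =
        C (2 * l : ℝ) * X * (X ^ 2 - 1) ^ l := by
      rcases l with _ | l
      · simp
      · rw [derivative_pow]
        simp only [Nat.cast_add, Nat.cast_one, map_add, map_natCast, map_one, add_tsub_cancel_right,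
          derivative_sub, derivative_pow, map_mul, map_ofNat, derivative_X, derivative_one]
        simp
        ring
    have h2 := congrArg derivative h
    simp only [derivative_mul, derivative_sub, derivative_X_pow, derivative_one, derivative_C,
      derivative_X] at h2
    simp only [Function.iterate_succ, Function.iterate_zero, Function.comp, id]
    simp only [map_sub, map_mul, map_add, map_natCast, map_one, map_ofNat, Nat.cast_zero,
      Nat.cast_ofNat] at h2 ⊢
    simp at h2 ⊢
    linear_combination h2
  | succ n ih =>
    have h2 := congrArg derivative ih
    simp only [derivative_mul, derivative_sub, derivative_add, derivative_X_pow, derivative_one,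
      derivative_C, derivative_X, ← Function.iterate_succ_apply', derivative_zero] at h2
    simp only [map_sub, map_mul, map_add, map_natCast, map_one, map_ofNat, Nat.cast_add,
      Nat.cast_one, Nat.cast_ofNat, Nat.succ_eq_add_one] at h2 ⊢
    simp at h2 ⊢
    linear_combination h2

/-- The differentiated Legendre equation. -/
theorem legendre_ode (l m : ℕ) :
    (X ^ 2 - 1) * derivative^[m + 2] (legendre l) +
      C (2 * (m + 1) : ℝ) * X * derivative^[m + 1] (legendre l) -
      C ((l - m) * (l + m + 1) : ℝ) * derivative^[m] (legendre l) = 0 := by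
  have h := iterate_derivative_sq_sub_one_pow l (l + m)
  simp only [legendre, iterate_derivative_C_mul, ← Function.iterate_add_apply]
  rw [show m + 2 + l = l + m + 2 by ring, show m + 1 + l = l + m + 1 by ring, add_comm m l]
  have e1 : (2 * ((l + m : ℕ) + 1) - 2 * l : ℝ) = 2 * (m + 1) := by push_cast; ring
  have e2 : ((l + m : ℕ) + 1) * (2 * l - (l + m : ℕ)) = ((l - m) * (l + m + 1) : ℝ) := by
    push_cast; ring
  rw [e1, e2] at h
  linear_combination C (1 / (2 ^ l * (Nat.factorial l : ℝ))) * h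

theorem natDegree_sq_sub_one_pow (l : ℕ) : ((X ^ 2 - 1 : ℝ[X]) ^ l).natDegree = 2 * l := by
  rw [natDegree_pow, ← C_1, natDegree_X_pow_sub_C, mul_comm]

/-- The derivatives `D^m P_{m+d}`, `d = 0, 1, …`, have exact degree `d`, so any polynomial can be
reduced against them. -/
theorem coeff_iterate_derivative_legendre (l m : ℕ) (h : m ≤ l) :
    (derivative^[m] (legendre l)).coeff (l - m) ≠ 0 := by
  have hm : ((X ^ 2 - 1 : ℝ[X]) ^ l).Monic := by
    rw [← C_1]; exact (monic_X_pow_sub_C _ two_ne_zero).pow l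
  have hc : ((X ^ 2 - 1 : ℝ[X]) ^ l).coeff (2 * l) = 1 := by
    rw [← natDegree_sq_sub_one_pow l]; exact hm
  rw [legendre, iterate_derivative_C_mul, ← Function.iterate_add_apply, coeff_C_mul,
    coeff_iterate_derivative, show l - m + (m + l) = 2 * l by omega, hc]
  have : ((2 * l).descFactorial (m + l)) ≠ 0 := by
    rw [Ne, Nat.descFactorial_eq_zero_iff_lt]; omega
  have h2 : ((2 * l).descFactorial (m + l) : ℝ) ≠ 0 := by exact_mod_cast this
  have h3 : (Nat.factorial l : ℝ) ≠ 0 := by exact_mod_cast Nat.factorial_ne_zero l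
  simp [h2, h3]

theorem natDegree_iterate_derivative_legendre_le (l m : ℕ) :
    (derivative^[m] (legendre l)).natDegree ≤ l - m := by
  rw [legendre, iterate_derivative_C_mul, ← Function.iterate_add_apply]
  refine (natDegree_C_mul_le _ _).trans ((natDegree_iterate_derivative _ _).trans ?_)
  rw [natDegree_sq_sub_one_pow]; omega

theorem iterate_derivative_legendre_self (l : ℕ) :
    derivative^[l] (legendre l) = C ((Nat.factorial (2 * l) : ℝ) / (2 ^ l * Nat.factorial l)) := by
  have h := natDegree_iterate_derivative_legendre_le l l
  rw [Nat.sub_self] at h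
  rw [eq_C_of_natDegree_le_zero h]
  congr 1
  have hm : ((X ^ 2 - 1 : ℝ[X]) ^ l).Monic := by
    rw [← C_1]; exact (monic_X_pow_sub_C _ two_ne_zero).pow l
  have hc : ((X ^ 2 - 1 : ℝ[X]) ^ l).coeff (2 * l) = 1 := by
    rw [← natDegree_sq_sub_one_pow l]; exact hm
  rw [legendre, iterate_derivative_C_mul, ← Function.iterate_add_apply, coeff_C_mul,
    coeff_iterate_derivative, zero_add, ← two_mul, hc, Nat.descFactorial_self]
  simp; ring

/-- Expanding at 1, `(X² - 1)^l` becomes `X^l (X + 2)^l`, whose coefficient at `X^l` is `2^l`. -/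
theorem legendre_eval_one (l : ℕ) : (legendre l).eval 1 = 1 := by
  have h1 : derivative^[l] ((X ^ 2 - 1 : ℝ[X]) ^ l) =
      (Nat.factorial l) • hasseDeriv l ((X ^ 2 - 1 : ℝ[X]) ^ l) := by
    rw [← factorial_smul_hasseDeriv]; rfl
  have h2 : (hasseDeriv l ((X ^ 2 - 1 : ℝ[X]) ^ l)).eval 1 = 2 ^ l := by
    rw [← taylor_coeff, taylor_pow]
    have : taylor 1 (X ^ 2 - 1 : ℝ[X]) = X * (X + C 2) := by
      rw [map_sub, taylor_X_pow, taylor_one, C_1]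
      rw [show (C 2 : ℝ[X]) = 2 from rfl]
      ring
    rw [this, mul_pow, coeff_X_pow_mul', if_pos le_rfl, Nat.sub_self, coeff_zero_eq_eval_zero]
    simp
  have h3 : (Nat.factorial l : ℝ) ≠ 0 := by exact_mod_cast Nat.factorial_ne_zero l
  rw [legendre, h1]
  simp only [eval_mul, eval_C, h2, nsmul_eq_mul, eval_natCast]
  field_simp

/-- `∫ (D^m P_l) (D^m P_k) (1 - t²)^m` over `[-1, 1]`. -/
def legendreInt (m l k : ℕ) : ℝ :=
  ∫ t in (-1 : ℝ)..1, (derivative^[m] (legendre l) * derivative^[m] (legendre k) *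
    (1 - X ^ 2) ^ m).eval t

theorem legendreInt_comm (m l k : ℕ) : legendreInt m l k = legendreInt m k l := by
  simp only [legendreInt, mul_comm (derivative^[m] (legendre l))]

/-- Integration by parts: the boundary terms carry the factor `(1 - t²)^(m+1)` and vanish at `±1`,
and Legendre's equation rewrites the derivative of `(1 - t²)^(m+1) D^(m+1) P_k`. -/
theorem legendreInt_succ (m l k : ℕ) :
    legendreInt (m + 1) l k = (k - m) * (k + m + 1) * legendreInt m l k := by
  have h := integral_derivative_eval
    (derivative^[m] (legendre l) * ((1 - X ^ 2) ^ (m + 1) * derivative^[m + 1] (legendre k))) (-1) 1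
  have hd : derivative
      (derivative^[m] (legendre l) * ((1 - X ^ 2) ^ (m + 1) * derivative^[m + 1] (legendre k))) =
      derivative^[m + 1] (legendre l) * derivative^[m + 1] (legendre k) * (1 - X ^ 2) ^ (m + 1) -
      C ((k - m) * (k + m + 1) : ℝ) *
        (derivative^[m] (legendre l) * derivative^[m] (legendre k) * (1 - X ^ 2) ^ m) := by
    have ho := legendre_ode k m
    simp only [derivative_mul, derivative_pow, derivative_sub, derivative_one, derivative_X,
      ← Function.iterate_succ_apply', Nat.succ_eq_add_one, add_tsub_cancel_right]
    simp only [map_sub, map_mul, map_add, map_natCast, map_one, map_ofNat, Nat.cast_add,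
      Nat.cast_one, Nat.cast_ofNat] at ho ⊢
    simp at ho ⊢
    linear_combination -(derivative^[m] (legendre l)) * (1 - X ^ 2) ^ m * ho
  rw [hd] at h
  simp only [eval_sub, eval_mul, eval_C] at h
  rw [intervalIntegral.integral_sub, intervalIntegral.integral_const_mul] at h
  · simp only [legendreInt, eval_mul]
    simp at h ⊢
    linarith
  · apply Continuous.intervalIntegrable; fun_prop
  · apply Continuous.intervalIntegrable; fun_prop

/-- Self-adjointness: `legendreInt 1 l k` is symmetric in `l, k`, so the recursion forces `k(k+1)`
and `l(l+1)` to agree unless the integral for `m = 0` vanishes. Larger `m` follow by the recursion.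
-/
theorem legendreInt_eq_zero {m l k : ℕ} (h : l ≠ k) : legendreInt m l k = 0 := by
  induction m with
  | zero =>
    have h1 := legendreInt_succ 0 l k
    have h2 := legendreInt_succ 0 k l
    rw [legendreInt_comm 1 k l, legendreInt_comm 0 k l, h1] at h2
    simp only [CharP.cast_eq_zero, sub_zero, add_zero] at h2
    have h3 : ((k : ℝ) - l) * (k + l + 1) * legendreInt 0 l k = 0 := by linear_combination h2
    rcases mul_eq_zero.1 h3 with h4 | h4
    · rcases mul_eq_zero.1 h4 with h5 | h5
      · exact absurd (by exact_mod_cast (sub_eq_zero.1 h5).symm) h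
      · have : (0 : ℝ) < k + l + 1 := by positivity
        linarith
    · exact h4
  | succ m ih => rw [legendreInt_succ, ih, mul_zero]

theorem legendreInt_eq_mul_legendreInt_zero (l m : ℕ) (h : m ≤ l) :
    legendreInt m l l =
      (Nat.factorial (l + m) : ℝ) / (Nat.factorial (l - m) : ℝ) * legendreInt 0 l l := by
  induction m with
  | zero =>
    have : (Nat.factorial l : ℝ) ≠ 0 := by exact_mod_cast Nat.factorial_ne_zero l
    simp [this]
  | succ m ih =>
    rw [legendreInt_succ, ih (by omega)]
    obtain ⟨d, rfl⟩ : ∃ d, l = m + 1 + d := ⟨l - (m + 1), by omega⟩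
    rw [show m + 1 + d - m = d + 1 by omega, show m + 1 + d - (m + 1) = d by omega,
      show m + 1 + d + (m + 1) = (m + 1 + d + m) + 1 by ring, Nat.factorial_succ, Nat.factorial_succ]
    have : (Nat.factorial d : ℝ) ≠ 0 := by exact_mod_cast Nat.factorial_ne_zero d
    push_cast
    field_simp
    ring

/-- The Wallis recursion, from the derivative of `t (1 - t²)^(l+1)`, which vanishes at `±1`. -/
theorem integral_one_sub_sq_pow_succ (l : ℕ) :
    (2 * l + 3 : ℝ) * ∫ t in (-1 : ℝ)..1, (1 - t ^ 2) ^ (l + 1) =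
      (2 * l + 2 : ℝ) * ∫ t in (-1 : ℝ)..1, (1 - t ^ 2) ^ l := by
  have h := integral_derivative_eval (X * (1 - X ^ 2) ^ (l + 1)) (-1) 1
  have hd : derivative (X * (1 - X ^ 2) ^ (l + 1) : ℝ[X]) =
      C (2 * l + 3 : ℝ) * (1 - X ^ 2) ^ (l + 1) - C (2 * l + 2 : ℝ) * (1 - X ^ 2) ^ l := by
    simp only [derivative_mul, derivative_pow, derivative_sub, derivative_one, derivative_X,
      add_tsub_cancel_right]
    simp only [map_mul, map_add, map_natCast, map_one, map_ofNat, Nat.cast_add,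
      Nat.cast_one, Nat.cast_ofNat]
    simp
    ring
  rw [hd] at h
  simp only [eval_sub, eval_mul, eval_C, eval_pow, eval_X, eval_one] at h
  rw [intervalIntegral.integral_sub, intervalIntegral.integral_const_mul,
    intervalIntegral.integral_const_mul] at h
  · simp at h
    linarith
  · apply Continuous.intervalIntegrable; fun_prop
  · apply Continuous.intervalIntegrable; fun_prop

/-- `D^l P_l` is constant, so `legendreInt l l l` is a Wallis integral; the recursion in `m` carries
its value down to `m = 0`. -/
theorem legendreInt_zero_self (l : ℕ) : legendreInt 0 l l = 2 / (2 * l + 1) := by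
  have hW : (Nat.factorial (2 * l) : ℝ) / (2 ^ l * Nat.factorial l) ^ 2 *
      (∫ t in (-1 : ℝ)..1, (1 - t ^ 2) ^ l) = 2 / (2 * l + 1) := by
    induction l with
    | zero => norm_num
    | succ l ih =>
      have h := integral_one_sub_sq_pow_succ l
      have h3 : (Nat.factorial l : ℝ) ≠ 0 := by exact_mod_cast Nat.factorial_ne_zero l
      have h4 : (2 * l + 3 : ℝ) ≠ 0 := by positivity
      have h5 : (2 * l + 1 : ℝ) ≠ 0 := by positivity
      have h6 : (l + 1 : ℝ) ≠ 0 := by positivity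
      rw [show 2 * (l + 1) = 2 * l + 1 + 1 by ring, Nat.factorial_succ, Nat.factorial_succ,
        Nat.factorial_succ]
      push_cast
      field_simp at ih ⊢
      generalize (∫ t in (-1 : ℝ)..1, (1 - t ^ 2) ^ (l + 1)) = A at *
      generalize (∫ t in (-1 : ℝ)..1, (1 - t ^ 2) ^ l) = B at *
      have e : A = (2 * l + 2) * B / (2 * l + 3) := by field_simp; linarith
      subst e
      field_simp
      ring_nf at ih ⊢
      linear_combination (4 * (l : ℝ) ^ 2 + 10 * l + 6) * ih
  have h1 := legendreInt_eq_mul_legendreInt_zero l l le_rfl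
  have h2 : legendreInt l l l = ((Nat.factorial (2 * l) : ℝ) / (2 ^ l * Nat.factorial l)) ^ 2 *
      ∫ t in (-1 : ℝ)..1, (1 - t ^ 2) ^ l := by
    rw [legendreInt, iterate_derivative_legendre_self, ← intervalIntegral.integral_const_mul]
    simp [sq]
  have h3 : (Nat.factorial (2 * l) : ℝ) ≠ 0 := by exact_mod_cast Nat.factorial_ne_zero _
  rw [h2, Nat.sub_self, ← two_mul, Nat.factorial_zero] at h1
  rw [← hW]
  apply mul_left_cancel₀ h3
  rw [Nat.cast_one, div_one] at h1
  rw [← h1]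
  field_simp

theorem legendreInt_self (l m : ℕ) (h : m ≤ l) : legendreInt m l l =
    (Nat.factorial (l + m) : ℝ) / (Nat.factorial (l - m) : ℝ) * (2 / (2 * l + 1)) := by
  rw [legendreInt_eq_mul_legendreInt_zero l m h, legendreInt_zero_self]

/-- For `t < 0` the bound `1 - P_l ≤ 2 ≤ 2 (1 - t)` suffices; for `t ≥ 0` use the mean value theorem
with `P_l' ≤ l(l+1)`. The assumption `|P_l| ≤ 1` is proved later from the addition theorem, as
`abs_legendre_le_one`. -/
theorem one_sub_legendre_le {l : ℕ} (hb : ∀ t ∈ Set.Icc (-1 : ℝ) 1, |(legendre l).eval t| ≤ 1)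
    {t : ℝ} (ht : t ∈ Set.Icc (-1 : ℝ) 1) :
    1 - (legendre l).eval t ≤ (l * (l + 1) + 2) * (1 - t) := by
  have hl : (0 : ℝ) ≤ l * (l + 1) := by positivity
  rcases lt_or_ge t 0 with h0 | h0
  · have := (abs_le.1 (hb t ht)).1
    nlinarith
  have hderiv : ∀ s ∈ Set.Icc (0 : ℝ) 1, s ≠ 1 → (derivative (legendre l)).eval s ≤ l * (l + 1) := by
    intro s hs hs1
    -- Legendre's equation integrated over `[s, 1]`: `(1 - s²) P_l'(s) = l(l+1) ∫_s^1 P_l ≤ l(l+1)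
    -- (1 - s)`. Dividing by `1 - s` is why `s ≠ 1` is required, and `1 + s ≥ 1` finishes.
    have h := integral_derivative_eval ((1 - X ^ 2) * derivative (legendre l)) s 1
    have hd : derivative ((1 - X ^ 2) * derivative (legendre l)) =
        C (-(l * (l + 1)) : ℝ) * legendre l := by
      have ho := legendre_ode l 0
      simp only [Function.iterate_succ, Function.iterate_zero, Function.comp, id] at ho
      simp only [derivative_mul, derivative_sub, derivative_one, derivative_X_pow]
      simp only [map_sub, map_mul, map_add, map_natCast, map_one, map_ofNat, map_neg] at ho ⊢
      simp at ho ⊢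
      linear_combination -ho
    rw [hd] at h
    simp only [eval_mul, eval_C, intervalIntegral.integral_const_mul] at h
    have hi : (∫ t in s..1, (legendre l).eval t) ≤ ∫ t in s..1, (1 : ℝ) := by
      apply intervalIntegral.integral_mono_on hs.2
      · exact (legendre l).continuous.intervalIntegrable _ _
      · exact continuous_const.intervalIntegrable _ _
      · intro x hx
        exact (abs_le.1 (hb x ⟨by linarith [hs.1, hx.1], hx.2⟩)).2
    simp at hi h
    have hs2 : 0 < 1 - s := by
      rcases lt_or_eq_of_le hs.2 with h1 | h1
      · linarith
      · exact absurd h1 hs1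
    have h7 : (1 - s) * ((1 + s) * (derivative (legendre l)).eval s) ≤ (1 - s) * (l * (l + 1)) := by
      nlinarith
    have h8 := le_of_mul_le_mul_left h7 hs2
    by_contra hcon
    push Not at hcon
    nlinarith [hs.1]
  rcases eq_or_lt_of_le ht.2 with h1 | h1
  · subst h1; simp [legendre_eval_one]
  obtain ⟨c, hc, hce⟩ := exists_hasDerivAt_eq_slope (fun t => (legendre l).eval t)
    (fun t => (derivative (legendre l)).eval t) h1 (legendre l).continuous.continuousOn
    (fun x _ => (legendre l).hasDerivAt x)
  have h2 := hderiv c ⟨by linarith [hc.1], hc.2.le⟩ hc.2.ne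
  have h3 : (0 : ℝ) < 1 - t := by linarith
  rw [hce, div_le_iff₀ h3, legendre_eval_one] at h2
  nlinarith

/-! ### Isometries acting on the sphere and the surface measure -/

instance : IsFiniteMeasure surfaceMeasure := by
  unfold surfaceMeasure; infer_instance

instance : surfaceMeasure.IsOpenPosMeasure := by
  unfold surfaceMeasure; infer_instance

/-- The action of a linear isometry on the sphere. -/
def isomAct (A : EuclideanSpace ℝ (Fin 3) ≃ₗᵢ[ℝ] EuclideanSpace ℝ (Fin 3)) (ω : S2) : S2 :=
  ⟨A ω.1, by rw [mem_sphere_zero_iff_norm, A.norm_map]; exact mem_sphere_zero_iff_norm.1 ω.2⟩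

theorem continuous_isomAct (A : EuclideanSpace ℝ (Fin 3) ≃ₗᵢ[ℝ] EuclideanSpace ℝ (Fin 3)) :
    Continuous (isomAct A) :=
  (A.continuous.comp continuous_subtype_val).subtype_mk _

@[simp] theorem isomAct_symm_isomAct
    (A : EuclideanSpace ℝ (Fin 3) ≃ₗᵢ[ℝ] EuclideanSpace ℝ (Fin 3)) (ω : S2) :
    isomAct A.symm (isomAct A ω) = ω := Subtype.ext (A.symm_apply_apply _)

@[simp] theorem isomAct_isomAct_symm
    (A : EuclideanSpace ℝ (Fin 3) ≃ₗᵢ[ℝ] EuclideanSpace ℝ (Fin 3)) (ω : S2) :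
    isomAct A (isomAct A.symm ω) = ω := Subtype.ext (A.apply_symm_apply _)

open scoped Pointwise in
-- The surface measure of `s` is three times the volume of the cone `(0,1) • s`, and linear
-- isometries carry cones to cones and preserve volume.
theorem measurePreserving_isomAct
    (A : EuclideanSpace ℝ (Fin 3) ≃ₗᵢ[ℝ] EuclideanSpace ℝ (Fin 3)) :
    MeasurePreserving (isomAct A) surfaceMeasure surfaceMeasure := by
  refine ⟨(continuous_isomAct A).measurable, ?_⟩
  ext s hs
  rw [Measure.map_apply (continuous_isomAct A).measurable hs, surfaceMeasure,
    Measure.toSphere_apply' _ hs,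
    Measure.toSphere_apply' _ ((continuous_isomAct A).measurable hs)]
  congr 1
  have : Set.Ioo (0 : ℝ) 1 • ((Subtype.val : S2 → EuclideanSpace ℝ (Fin 3)) '' (isomAct A ⁻¹' s)) =
      A ⁻¹' (Set.Ioo (0 : ℝ) 1 • (Subtype.val '' s)) := by
    ext x
    simp only [Set.mem_smul, Set.mem_image, Set.mem_preimage]
    constructor
    · rintro ⟨r, hr, _, ⟨ω, hω, rfl⟩, rfl⟩
      exact ⟨r, hr, _, ⟨_, hω, rfl⟩, by simp [isomAct]⟩
    · rintro ⟨r, hr, _, ⟨ω, hω, rfl⟩, h⟩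
      refine ⟨r, hr, _, ⟨isomAct A.symm ω, by simpa using hω, rfl⟩, ?_⟩
      apply A.injective
      rw [← h]
      simp [isomAct]
  rw [this]
  exact A.measurePreserving.measure_preimage_emb A.toMeasurableEquiv.measurableEmbedding _

theorem measurableEmbedding_isomAct
    (A : EuclideanSpace ℝ (Fin 3) ≃ₗᵢ[ℝ] EuclideanSpace ℝ (Fin 3)) :
    MeasurableEmbedding (isomAct A) :=
  (Homeomorph.mk ⟨isomAct A, isomAct A.symm, isomAct_symm_isomAct A, isomAct_isomAct_symm A⟩
    (continuous_isomAct A) (continuous_isomAct A.symm)).measurableEmbedding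

theorem integral_isomAct {F : Type*} [NormedAddCommGroup F] [NormedSpace ℝ F]
    (A : EuclideanSpace ℝ (Fin 3) ≃ₗᵢ[ℝ] EuclideanSpace ℝ (Fin 3)) (g : S2 → F) :
    ∫ ω, g (isomAct A ω) ∂surfaceMeasure = ∫ ω, g ω ∂surfaceMeasure :=
  (measurePreserving_isomAct A).integral_comp (measurableEmbedding_isomAct A) g

theorem integrable_of_continuous {F : Type*} [NormedAddCommGroup F]
    {g : S2 → F} (hg : Continuous g) : Integrable g surfaceMeasure := by
  rw [← integrableOn_univ]
  exact hg.continuousOn.integrableOn_compact isCompact_univ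

theorem continuous_coord (i : Fin 3) : Continuous fun ω : S2 => ω.1 i := by fun_prop

/-! ### Moments of the third coordinate and the hat-box theorem -/

theorem integral_mul_radial (g : EuclideanSpace ℝ (Fin 3) → ℝ) (h : ℝ → ℝ) (k : ℕ)
    (hg : ∀ (r : ℝ) x, 0 < r → g (r • x) = r ^ k * g x) :
    ∫ x, g x * h ‖x‖ =
      (∫ ω : S2, g ω.1 ∂surfaceMeasure) * ∫ r in Set.Ioi (0 : ℝ), r ^ (k + 2) * h r := by
  have hd : Module.finrank ℝ (EuclideanSpace ℝ (Fin 3)) - 1 = 2 := by simp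
  calc ∫ x, g x * h ‖x‖ =
      ∫ x : ({(0)}ᶜ : Set (EuclideanSpace ℝ (Fin 3))), g x * h ‖x.1‖ ∂(volume.comap Subtype.val) := by
        rw [integral_subtype_comap (measurableSet_singleton _).compl fun x ↦ g x * h ‖x‖,
          restrict_compl_singleton]
    _ = ∫ x, g x.1.1 * (x.2.1 ^ k * h x.2.1)
          ∂surfaceMeasure.prod (Measure.volumeIoiPow 2) := by
        rw [← hd]
        rw [surfaceMeasure, ← (volume : Measure (EuclideanSpace ℝ (Fin
          3))).measurePreserving_homeomorphUnitSphereProd.integral_comp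
          (Homeomorph.measurableEmbedding _)]
        refine integral_congr_ae (.of_forall fun x => ?_)
        have hx : (0 : ℝ) < ‖x.1‖ := norm_pos_iff.2 x.2
        have h1 := hg ‖x.1‖ ((homeomorphUnitSphereProd _ x).1).1 hx
        have h2 : ‖x.1‖ • ((homeomorphUnitSphereProd _ x).1).1 = x.1 := by
          simp [smul_smul, hx.ne']
        rw [h2] at h1
        simp only [homeomorphUnitSphereProd_apply_snd_coe] at h1 ⊢
        rw [h1]; ring
    _ = (∫ ω : S2, g ω.1 ∂surfaceMeasure) *
          ∫ r : Set.Ioi (0 : ℝ), (r.1 ^ k * h r.1) ∂(Measure.volumeIoiPow 2) :=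
        integral_prod_mul (fun ω : S2 => g ω.1) (fun r : Set.Ioi (0 : ℝ) => r.1 ^ k * h r.1)
    _ = _ := by
      congr 1
      simp only [Measure.volumeIoiPow, ENNReal.ofReal]
      rw [integral_withDensity_eq_integral_smul,
        integral_subtype_comap measurableSet_Ioi fun a ↦ Real.toNNReal (a ^ 2) • (a ^ k * h a),
        setIntegral_congr_fun measurableSet_Ioi fun x hx ↦ ?_]
      · rw [NNReal.smul_def, Real.coe_toNNReal _ (by positivity), smul_eq_mul]
        ring
      · exact (measurable_subtype_coe.pow_const _).real_toNNReal

theorem integral_pow_mul_exp_neg_sq_Ioi (k : ℕ) :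
    ∫ x in Set.Ioi (0 : ℝ), x ^ k * Real.exp (-x ^ 2) = 1 / 2 * Real.Gamma ((k + 1) / 2) := by
  have := integral_rpow_mul_exp_neg_rpow (p := 2) (q := k) two_pos
    (by have : (0 : ℝ) ≤ k := Nat.cast_nonneg k; linarith)
  simpa [Real.rpow_natCast] using this

/-- The Gaussian trick: `∫ x₂^(2j) exp(-‖x‖²)` is evaluated once as a product of one-dimensional
integrals, giving `π Γ(j + 1/2)`, and once in polar coordinates, where the sphere moment appears
times `Γ(j + 3/2) / 2`. -/
theorem integral_coord_pow_even (j : ℕ) :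
    ∫ ω : S2, (ω.1 2) ^ (2 * j) ∂surfaceMeasure = 4 * Real.pi / (2 * j + 1) := by
  have h := integral_mul_radial (fun x => x 2 ^ (2 * j)) (fun r => Real.exp (-r ^ 2)) (2 * j)
    (by intro r x hr; simp [mul_pow])
  rw [integral_pow_mul_exp_neg_sq_Ioi] at h
  have h2 : ∫ x : EuclideanSpace ℝ (Fin 3), x 2 ^ (2 * j) * Real.exp (-‖x‖ ^ 2) =
      Real.pi * Real.Gamma (j + 1 / 2) := by
    rw [← (PiLp.volume_preserving_toLp (Fin 3)).integral_comp
      (MeasurableEquiv.toLp 2 _).measurableEmbedding]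
    let F : Fin 3 → ℝ → ℝ := ![fun t => Real.exp (-t ^ 2), fun t => Real.exp (-t ^ 2),
      fun t => t ^ (2 * j) * Real.exp (-t ^ 2)]
    have e : ∀ x : Fin 3 → ℝ, (WithLp.toLp 2 x : EuclideanSpace ℝ (Fin 3)) 2 ^ (2 * j) *
        Real.exp (-‖(WithLp.toLp 2 x : EuclideanSpace ℝ (Fin 3))‖ ^ 2) = ∏ i, F i (x i) := by
      intro x
      rw [EuclideanSpace.norm_sq_eq, Fin.prod_univ_three, Fin.sum_univ_three]
      simp only [F, Matrix.cons_val_zero, Matrix.cons_val_one, Matrix.cons_val, Real.norm_eq_abs,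
        sq_abs, neg_add, Real.exp_add]
      ring
    simp_rw [e]
    rw [integral_fintype_prod_volume_eq_prod, Fin.prod_univ_three]
    simp only [F, Matrix.cons_val_zero, Matrix.cons_val_one, Matrix.cons_val]
    have g1 := integral_gaussian 1
    simp only [neg_mul, one_mul, div_one] at g1
    have g2 : ∫ t : ℝ, t ^ (2 * j) * Real.exp (-t ^ 2) = Real.Gamma (j + 1 / 2) := by
      have := integral_comp_abs (f := fun t : ℝ => t ^ (2 * j) * Real.exp (-t ^ 2))
      simp only [pow_mul, sq_abs] at this ⊢
      rw [this]
      simp only [← pow_mul]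
      rw [integral_pow_mul_exp_neg_sq_Ioi]
      push_cast
      rw [show ((2 * j + 1 : ℝ) / 2) = j + 1 / 2 by ring]
      ring
    rw [g1, g2, Real.mul_self_sqrt Real.pi_pos.le]
  rw [h2] at h
  push_cast at h
  rw [show ((2 * j + 2 + 1 : ℝ) / 2) = (j + 1 / 2) + 1 by ring,
    Real.Gamma_add_one (by positivity)] at h
  have hG : Real.Gamma ((j : ℝ) + 1 / 2) ≠ 0 := (Real.Gamma_pos_of_pos (by positivity)).ne'
  have h3 : (2 * j + 1 : ℝ) ≠ 0 := by positivity
  generalize (∫ ω : S2, (ω.1 2) ^ (2 * j) ∂surfaceMeasure) = m at *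
  rw [eq_div_iff h3]
  apply mul_right_cancel₀ hG
  linear_combination -4 * h

/-- The antipodal map changes the sign of the integrand. -/
theorem integral_coord_pow_odd {k : ℕ} (hk : Odd k) :
    ∫ ω : S2, (ω.1 2) ^ k ∂surfaceMeasure = 0 := by
  have h := integral_isomAct (LinearIsometryEquiv.neg ℝ) (fun ω : S2 => (ω.1 2) ^ k)
  simp only [isomAct, LinearIsometryEquiv.coe_neg, PiLp.neg_apply, hk.neg_pow, integral_neg] at h
  linarith

/-- Archimedes' hat-box theorem for polynomials. -/
theorem integral_eval_coord (Q : ℝ[X]) :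
    ∫ ω : S2, Q.eval (ω.1 2) ∂surfaceMeasure =
      2 * Real.pi * ∫ t in (-1 : ℝ)..1, Q.eval t := by
  induction Q using Polynomial.induction_on' with
  | add p q hp hq =>
    simp only [eval_add]
    rw [integral_add, intervalIntegral.integral_add, hp, hq, mul_add]
    · exact p.continuous.intervalIntegrable _ _
    · exact q.continuous.intervalIntegrable _ _
    · exact integrable_of_continuous (p.continuous.comp (continuous_coord 2))
    · exact integrable_of_continuous (q.continuous.comp (continuous_coord 2))
  | monomial k a =>
    simp only [eval_monomial]
    rw [integral_const_mul, intervalIntegral.integral_const_mul, integral_pow]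
    rcases Nat.even_or_odd k with hk | hk
    · obtain ⟨j, rfl⟩ := hk.two_dvd
      rw [integral_coord_pow_even, (odd_two_mul_add_one j).neg_one_pow, one_pow]
      push_cast
      ring
    · rw [integral_coord_pow_odd hk, hk.add_one.neg_one_pow]
      simp

/-! ### Orthonormality of the spherical harmonics -/

/-- The coordinate `ω₀ + i ω₁ = sin θ e^{iφ}`. -/
def horiz (ω : S2) : ℂ := (ω.1 0 : ℂ) + (ω.1 1 : ℂ) * Complex.I

theorem sum_coord_sq (ω : S2) : ω.1 0 ^ 2 + ω.1 1 ^ 2 + ω.1 2 ^ 2 = 1 := by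
  have h := mem_sphere_zero_iff_norm.1 ω.2
  have h2 := EuclideanSpace.norm_sq_eq ω.1
  rw [h, Fin.sum_univ_three] at h2
  simpa using h2.symm

theorem horiz_mul_conj (ω : S2) :
    horiz ω * (starRingEnd ℂ) (horiz ω) = ((1 - ω.1 2 ^ 2 : ℝ) : ℂ) := by
  rw [Complex.mul_conj]
  congr 1
  rw [horiz, Complex.normSq_add_mul_I]
  linarith [sum_coord_sq ω]

theorem continuous_sphericalHarmonicNat (l m : ℕ) : Continuous (sphericalHarmonicNat l m) := by
  unfold sphericalHarmonicNat; fun_prop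

theorem continuous_sphericalHarmonic (l : ℕ) (m : ℤ) : Continuous (sphericalHarmonic l m) := by
  have := continuous_sphericalHarmonicNat l m.natAbs
  unfold sphericalHarmonic
  by_cases h : 0 ≤ m
  · simpa [h]
  · simp only [h, if_false]
    exact continuous_const.mul (Complex.continuous_conj.comp this)

theorem sphericalHarmonicNat_rotate {A : EuclideanSpace ℝ (Fin 3) ≃ₗᵢ[ℝ] EuclideanSpace ℝ (Fin 3)}
    {u : ℂ} (h2 : ∀ ω : S2, (isomAct A ω).1 2 = ω.1 2)
    (hw : ∀ ω, horiz (isomAct A ω) = u * horiz ω) (l m : ℕ) (ω : S2) :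
    sphericalHarmonicNat l m (isomAct A ω) = u ^ m * sphericalHarmonicNat l m ω := by
  have := hw ω
  simp only [horiz] at this
  rw [sphericalHarmonicNat, sphericalHarmonicNat, h2, this, mul_pow]
  ring

/-- A rotation about the third axis acts diagonally. This phase gives orthogonality of different
orders and, later, the displacement estimate for isometries. -/
theorem sphericalHarmonic_rotate {A : EuclideanSpace ℝ (Fin 3) ≃ₗᵢ[ℝ] EuclideanSpace ℝ (Fin 3)}
    {u : ℂ} (hu : ‖u‖ = 1) (h2 : ∀ ω : S2, (isomAct A ω).1 2 = ω.1 2)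
    (hw : ∀ ω, horiz (isomAct A ω) = u * horiz ω) (l : ℕ) (m : ℤ) (ω : S2) :
    sphericalHarmonic l m (isomAct A ω) = u ^ m * sphericalHarmonic l m ω := by
  unfold sphericalHarmonic
  rw [sphericalHarmonicNat_rotate h2 hw]
  split_ifs with h
  · rw [← zpow_natCast, Int.natAbs_of_nonneg h]
  · have hinv : (starRingEnd ℂ) u = u⁻¹ := by
      rw [Complex.inv_def, Complex.normSq_eq_norm_sq, hu]; simp
    rw [map_mul, map_pow, hinv, ← zpow_natCast u⁻¹, inv_zpow', Int.ofNat_natAbs_of_nonpos (by omega),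
      neg_neg]
    ring

/-- A rotation as a linear isometry. -/
def SO3.toIsom (R : SO3) : EuclideanSpace ℝ (Fin 3) ≃ₗᵢ[ℝ] EuclideanSpace ℝ (Fin 3) where
  toFun v := WithLp.toLp 2 (R.1.mulVec v.ofLp)
  invFun v := WithLp.toLp 2 ((R⁻¹).1.mulVec v.ofLp)
  map_add' v w := by simp [Matrix.mulVec_add]
  map_smul' c v := by simp [Matrix.mulVec_smul]
  left_inv v := by
    have : (R⁻¹).1 * R.1 = 1 := congrArg Subtype.val (inv_mul_cancel R)
    simp [Matrix.mulVec_mulVec, this]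
  right_inv v := by
    have : R.1 * (R⁻¹).1 = 1 := congrArg Subtype.val (mul_inv_cancel R)
    simp [Matrix.mulVec_mulVec, this]
  norm_map' v := SO3.norm_toLp_mulVec R v

/-- Rotation about the third axis as an element of `SO(3)`. -/
def rotZ (t : ℝ) : SO3 := ⟨rotZMatrix t, rotZMatrix_mem t⟩

theorem rotZ_coord_two (t : ℝ) (ω : S2) : (isomAct (rotZ t).toIsom ω).1 2 = ω.1 2 := by
  change (rotZMatrix t).mulVec ω.1.ofLp 2 = _
  simp [rotZMatrix, Matrix.mulVec, dotProduct, Fin.sum_univ_three]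

theorem rotZ_horiz (t : ℝ) (ω : S2) :
    horiz (isomAct (rotZ t).toIsom ω) = Complex.exp (t * Complex.I) * horiz ω := by
  change (((rotZMatrix t).mulVec ω.1.ofLp 0 : ℝ) : ℂ) +
    (((rotZMatrix t).mulVec ω.1.ofLp 1 : ℝ) : ℂ) * Complex.I = _
  simp only [rotZMatrix, Matrix.mulVec, dotProduct, Fin.sum_univ_three, horiz]
  rw [Complex.exp_mul_I]
  simp
  linear_combination (-Complex.sin t * ω.1 1) * Complex.I_mul_I

theorem l2Inner_isomAct (A : EuclideanSpace ℝ (Fin 3) ≃ₗᵢ[ℝ] EuclideanSpace ℝ (Fin 3))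
    (f g : S2 → ℂ) :
    l2Inner (fun ω => f (isomAct A ω)) (fun ω => g (isomAct A ω)) = l2Inner f g :=
  integral_isomAct A fun ω => f ω * (starRingEnd ℂ) (g ω)

theorem l2Inner_conj_symm (f g : S2 → ℂ) : (starRingEnd ℂ) (l2Inner f g) = l2Inner g f := by
  rw [l2Inner, l2Inner, ← integral_conj]
  simp [mul_comm]

/-- The rotation by the angle `π / (m - n)` about the third axis preserves the inner product and
multiplies it by `exp(iπ) = -1`. -/
theorem l2Inner_sphericalHarmonic_of_ne {l k : ℕ} {m n : ℤ} (h : m ≠ n) :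
    l2Inner (sphericalHarmonic l m) (sphericalHarmonic k n) = 0 := by
  have hmn : ((m - n : ℤ) : ℝ) ≠ 0 := by exact_mod_cast sub_ne_zero.2 h
  set t : ℝ := Real.pi / (m - n : ℤ) with ht
  set u := Complex.exp (t * Complex.I) with hu
  have hu1 : ‖u‖ = 1 := Complex.norm_exp_ofReal_mul_I t
  have hu0 : u ≠ 0 := Complex.exp_ne_zero _
  have e := l2Inner_isomAct (rotZ t).toIsom (sphericalHarmonic l m) (sphericalHarmonic k n)
  have h1 := sphericalHarmonic_rotate hu1 (rotZ_coord_two t) (rotZ_horiz t)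
  simp only [h1, l2Inner, map_mul] at e
  have hum : u ^ m * (starRingEnd ℂ) (u ^ n) = -1 := by
    have hinv : (starRingEnd ℂ) u = u⁻¹ := by
      rw [Complex.inv_def, Complex.normSq_eq_norm_sq, hu1]; simp
    rw [map_zpow₀, hinv, inv_zpow', ← zpow_add₀ hu0, ← sub_eq_add_neg, hu, ← Complex.exp_int_mul,
      ← Complex.exp_pi_mul_I]
    congr 1
    rw [← mul_assoc]
    congr 1
    rw [ht]
    have : (((m - n : ℤ) : ℝ) : ℂ) ≠ 0 := by exact_mod_cast hmn
    push_cast at this ⊢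
    field_simp
  have e2 : ∀ ω, u ^ m * sphericalHarmonic l m ω *
      ((starRingEnd ℂ) (u ^ n) * (starRingEnd ℂ) (sphericalHarmonic k n ω)) =
      -(sphericalHarmonic l m ω * (starRingEnd ℂ) (sphericalHarmonic k n ω)) := by
    intro ω
    linear_combination (sphericalHarmonic l m ω * (starRingEnd ℂ) (sphericalHarmonic k n ω)) * hum
  simp only [e2, integral_neg] at e
  rw [l2Inner]
  exact self_eq_neg.1 e.symm

/-- Because `|horiz ω|² = 1 - ω₂²`, the integrand is a polynomial in `ω₂`, and the hat-box theorem
reduces the inner product to `legendreInt m l k`. For `k < m` the truncated `k - m` is harmless,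
since then `k ≠ l` and the integral is zero. -/
theorem l2Inner_sphericalHarmonicNat (l k m : ℕ) (hl : m ≤ l) :
    l2Inner (sphericalHarmonicNat l m) (sphericalHarmonicNat k m) = if l = k then 1 else 0 := by
  have e : ∀ ω, sphericalHarmonicNat l m ω * (starRingEnd ℂ) (sphericalHarmonicNat k m ω) =
      ((Real.sqrt ((2 * l + 1) / (4 * Real.pi) *
      ((Nat.factorial (l - m) : ℝ) / (Nat.factorial (l + m) : ℝ))) *
      Real.sqrt ((2 * k + 1) / (4 * Real.pi) *
      ((Nat.factorial (k - m) : ℝ) / (Nat.factorial (k + m) : ℝ))) *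
      (derivative^[m] (legendre l) * derivative^[m] (legendre k) *
        (1 - X ^ 2) ^ m).eval (ω.1 2) : ℝ) : ℂ) := by
    intro ω
    have h := horiz_mul_conj ω
    rw [horiz] at h
    simp only [sphericalHarmonicNat, map_mul, map_pow, Complex.conj_ofReal, eval_mul, eval_pow,
      eval_sub, eval_one, eval_X, map_neg, map_one]
    rw [Complex.ofReal_mul, Complex.ofReal_mul, Complex.ofReal_mul, Complex.ofReal_mul,
      Complex.ofReal_pow (1 - (ω.1 2) ^ 2), ← h, mul_pow]
    have h1 : ((-1 : ℂ) ^ m) * (-1) ^ m = 1 := by rw [← mul_pow]; simp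
    simp only [map_add, map_mul, Complex.conj_ofReal]
    linear_combination ((Real.sqrt ((2 * l + 1) / (4 * Real.pi) *
      ((Nat.factorial (l - m) : ℝ) / (Nat.factorial (l + m) : ℝ))) : ℂ) *
      (Real.sqrt ((2 * k + 1) / (4 * Real.pi) *
      ((Nat.factorial (k - m) : ℝ) / (Nat.factorial (k + m) : ℝ))) : ℂ) *
      (((derivative^[m] (legendre l)).eval (ω.1 2) : ℝ) : ℂ) *
      (((derivative^[m] (legendre k)).eval (ω.1 2) : ℝ) : ℂ) *
      ((ω.1 0 : ℂ) + (ω.1 1 : ℂ) * Complex.I) ^ m *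
      ((ω.1 0 : ℂ) + (ω.1 1 : ℂ) * (starRingEnd ℂ) Complex.I) ^ m) * h1
  simp only [l2Inner, e]
  rw [integral_complex_ofReal, integral_const_mul, integral_eval_coord]
  change ((_ * (2 * Real.pi * legendreInt m l k) : ℝ) : ℂ) = _
  split_ifs with h
  · subst h
    rw [legendreInt_self l m hl, Real.mul_self_sqrt (by positivity)]
    have h1 : (Nat.factorial (l - m) : ℝ) ≠ 0 := by exact_mod_cast Nat.factorial_ne_zero _
    have h2 : (Nat.factorial (l + m) : ℝ) ≠ 0 := by exact_mod_cast Nat.factorial_ne_zero _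
    have h3 : (2 * l + 1 : ℝ) ≠ 0 := by positivity
    have h4 := Real.pi_ne_zero
    rw [← Complex.ofReal_one]
    congr 1
    field_simp
    norm_num
  · rw [legendreInt_eq_zero h]; simp

theorem l2Inner_sphericalHarmonic {l k : ℕ} {m n : ℤ} (hm : |m| ≤ l) :
    l2Inner (sphericalHarmonic l m) (sphericalHarmonic k n) = if l = k ∧ m = n then 1 else 0 := by
  by_cases h : m = n
  · subst h
    have hl : m.natAbs ≤ l := by have := abs_le.1 hm; omega
    simp only [and_true]
    rw [← l2Inner_sphericalHarmonicNat l k m.natAbs hl]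
    by_cases h0 : 0 ≤ m
    · simp only [l2Inner, sphericalHarmonic, if_pos h0]
    · rw [l2Inner_sphericalHarmonicNat l k m.natAbs hl]
      have : l2Inner (sphericalHarmonic l m) (sphericalHarmonic k m) =
          (starRingEnd ℂ) (l2Inner (sphericalHarmonicNat l m.natAbs)
            (sphericalHarmonicNat k m.natAbs)) := by
        rw [l2Inner, l2Inner, ← integral_conj]
        congr 1
        ext ω
        have h1 : ((-1 : ℂ) ^ m.natAbs) * (-1) ^ m.natAbs = 1 := by rw [← mul_pow]; simp
        simp only [sphericalHarmonic, if_neg h0, map_mul, map_pow, map_neg, map_one,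
          Complex.conj_conj]
        linear_combination ((starRingEnd ℂ) (sphericalHarmonicNat l m.natAbs ω) *
          sphericalHarmonicNat k m.natAbs ω) * h1
      rw [this, l2Inner_sphericalHarmonicNat l k m.natAbs hl]
      split_ifs <;> simp
  · rw [l2Inner_sphericalHarmonic_of_ne h, if_neg (fun h' => h h'.2)]

/-! ### Polynomials on the sphere -/

/-- A Cartesian coordinate as a complex function on the sphere. -/
def coordFun (i : Fin 3) : S2 → ℂ := fun ω => (ω.1 i : ℂ)

/-- The affine functions on the sphere. -/
def affineSpace : Submodule ℂ (S2 → ℂ) := Submodule.span ℂ (insert 1 (Set.range coordFun))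

/-- The polynomials of degree at most `n` on the sphere. -/
def polySpace (n : ℕ) : Submodule ℂ (S2 → ℂ) := affineSpace ^ n

theorem one_mem_affineSpace : (1 : S2 → ℂ) ∈ affineSpace :=
  Submodule.subset_span (Set.mem_insert _ _)

theorem coordFun_mem_affineSpace (i : Fin 3) : coordFun i ∈ affineSpace :=
  Submodule.subset_span (Set.mem_insert_of_mem _ ⟨i, rfl⟩)

/-- Powers of `affineSpace` increase because it contains the constant 1. -/
theorem polySpace_mono {m n : ℕ} (h : m ≤ n) : polySpace m ≤ polySpace n :=
  pow_le_pow_right' (Submodule.one_le.2 one_mem_affineSpace) h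

theorem mul_mem_polySpace {m n : ℕ} {f g : S2 → ℂ} (hf : f ∈ polySpace m) (hg : g ∈ polySpace n) :
    f * g ∈ polySpace (m + n) := by
  unfold polySpace at *
  rw [pow_add]; exact Submodule.mul_mem_mul hf hg

theorem affineSpace_le_polySpace_one : affineSpace ≤ polySpace 1 := by
  rw [polySpace, pow_one]

theorem pow_mem_polySpace {f : S2 → ℂ} (hf : f ∈ affineSpace) (n : ℕ) : f ^ n ∈ polySpace n :=
  Submodule.pow_mem_pow _ hf n

theorem horiz_mem_affineSpace : horiz ∈ affineSpace := by
  have : horiz = coordFun 0 + Complex.I • coordFun 1 := by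
    ext ω; simp [horiz, coordFun, mul_comm]
  rw [this]
  exact add_mem (coordFun_mem_affineSpace 0) (Submodule.smul_mem _ _ (coordFun_mem_affineSpace 1))

theorem conj_horiz_mem_affineSpace :
    (fun ω => (starRingEnd ℂ) (horiz ω)) ∈ affineSpace := by
  have : (fun ω => (starRingEnd ℂ) (horiz ω)) = coordFun 0 + (-Complex.I) • coordFun 1 := by
    ext ω; simp [horiz, coordFun, mul_comm]
  rw [this]
  exact add_mem (coordFun_mem_affineSpace 0) (Submodule.smul_mem _ _ (coordFun_mem_affineSpace 1))

theorem eval_coord_mem_polySpace (Q : ℝ[X]) {n : ℕ} (h : Q.natDegree ≤ n) :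
    (fun ω : S2 => ((Q.eval (ω.1 2) : ℝ) : ℂ)) ∈ polySpace n := by
  have : (fun ω : S2 => ((Q.eval (ω.1 2) : ℝ) : ℂ)) =
      ∑ i ∈ Finset.range (Q.natDegree + 1), (Q.coeff i : ℂ) • coordFun 2 ^ i := by
    ext ω
    rw [eval_eq_sum_range]
    simp [coordFun]
  rw [this]
  refine Submodule.sum_mem _ fun i hi => Submodule.smul_mem _ _ ?_
  rw [Finset.mem_range] at hi
  exact polySpace_mono (by omega) (pow_mem_polySpace (coordFun_mem_affineSpace 2) i)

theorem conj_sphericalHarmonic (l : ℕ) (m : ℤ) (ω : S2) :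
    (starRingEnd ℂ) (sphericalHarmonic l m ω) = (-1) ^ m.natAbs * sphericalHarmonic l (-m) ω := by
  have h1 : ((-1 : ℂ) ^ m.natAbs) * (-1) ^ m.natAbs = 1 := by rw [← mul_pow]; simp
  rcases lt_trichotomy m 0 with h | h | h
  · rw [sphericalHarmonic, sphericalHarmonic, if_neg (by omega), if_pos (by omega)]
    simp
  · subst h
    simp [sphericalHarmonic, sphericalHarmonicNat]
  · rw [sphericalHarmonic, sphericalHarmonic, if_pos (by omega), if_neg (by omega), Int.natAbs_neg,
      ← mul_assoc, h1, one_mul]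

theorem sphericalHarmonicNat_mem_polySpace {l m : ℕ} (h : m ≤ l) :
    sphericalHarmonicNat l m ∈ polySpace l := by
  have e : sphericalHarmonicNat l m = ((-1) ^ m *
    ((Real.sqrt ((2 * l + 1) / (4 * Real.pi) *
      ((Nat.factorial (l - m) : ℝ) / (Nat.factorial (l + m) : ℝ))) : ℝ) : ℂ)) •
      ((fun ω : S2 => (((derivative^[m] (legendre l)).eval (ω.1 2) : ℝ) : ℂ)) * horiz ^ m) := by
    ext ω; simp [sphericalHarmonicNat, horiz, mul_assoc]
  rw [e]
  refine Submodule.smul_mem _ _ ?_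
  have := mul_mem_polySpace (eval_coord_mem_polySpace _
    (natDegree_iterate_derivative_legendre_le l m)) (pow_mem_polySpace horiz_mem_affineSpace m)
  rwa [Nat.sub_add_cancel h] at this

theorem conj_mem_polySpace_sphericalHarmonicNat {l m : ℕ} (h : m ≤ l) :
    (fun ω => (starRingEnd ℂ) (sphericalHarmonicNat l m ω)) ∈ polySpace l := by
  have e : (fun ω => (starRingEnd ℂ) (sphericalHarmonicNat l m ω)) = ((-1) ^ m *
    ((Real.sqrt ((2 * l + 1) / (4 * Real.pi) *
      ((Nat.factorial (l - m) : ℝ) / (Nat.factorial (l + m) : ℝ))) : ℝ) : ℂ)) •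
      ((fun ω : S2 => (((derivative^[m] (legendre l)).eval (ω.1 2) : ℝ) : ℂ)) *
        (fun ω => (starRingEnd ℂ) (horiz ω)) ^ m) := by
    ext ω; simp [sphericalHarmonicNat, horiz, mul_assoc]
  rw [e]
  refine Submodule.smul_mem _ _ ?_
  have := mul_mem_polySpace (eval_coord_mem_polySpace _
    (natDegree_iterate_derivative_legendre_le l m)) (pow_mem_polySpace conj_horiz_mem_affineSpace m)
  rwa [Nat.sub_add_cancel h] at this

/-- The span of the spherical harmonics of degree at most `n`. -/
def harmonicSpan (n : ℕ) : Submodule ℂ (S2 → ℂ) :=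
  Submodule.span ℂ {f | ∃ (l : ℕ) (m : ℤ), l ≤ n ∧ |m| ≤ l ∧ f = sphericalHarmonic l m}

theorem sphericalHarmonic_mem_harmonicSpan {n l : ℕ} {m : ℤ} (h : l ≤ n) (hm : |m| ≤ l) :
    sphericalHarmonic l m ∈ harmonicSpan n := Submodule.subset_span ⟨l, m, h, hm, rfl⟩

theorem sphericalHarmonic_mem_polySpace {l : ℕ} {m : ℤ} (hm : |m| ≤ l) :
    sphericalHarmonic l m ∈ polySpace l := by
  have hm' : m.natAbs ≤ l := by have := abs_le.1 hm; omega
  by_cases h0 : 0 ≤ m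
  · have : sphericalHarmonic l m = sphericalHarmonicNat l m.natAbs := by
      ext ω; simp [sphericalHarmonic, h0]
    rw [this]; exact sphericalHarmonicNat_mem_polySpace hm'
  · have : sphericalHarmonic l m = ((-1 : ℂ) ^ m.natAbs) •
        (fun ω => (starRingEnd ℂ) (sphericalHarmonicNat l m.natAbs ω)) := by
      ext ω; simp only [sphericalHarmonic, h0, if_false]; rfl
    rw [this]; exact Submodule.smul_mem _ _ (conj_mem_polySpace_sphericalHarmonicNat hm')

theorem harmonicSpan_le_polySpace (n : ℕ) : harmonicSpan n ≤ polySpace n := by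
  refine Submodule.span_le.2 ?_
  rintro _ ⟨l, m, h, hm, rfl⟩
  exact polySpace_mono h (sphericalHarmonic_mem_polySpace hm)

/-- Conjugation exchanges the orders `m` and `-m` up to sign. -/
theorem conj_mem_harmonicSpan {n : ℕ} {f : S2 → ℂ} (hf : f ∈ harmonicSpan n) :
    (fun ω => (starRingEnd ℂ) (f ω)) ∈ harmonicSpan n := by
  induction hf using Submodule.span_induction with
  | mem f h =>
    obtain ⟨l, m, h, hm, rfl⟩ := h
    simp only [conj_sphericalHarmonic]
    exact Submodule.smul_mem _ ((-1 : ℂ) ^ m.natAbs)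
      (sphericalHarmonic_mem_harmonicSpan h (by rwa [abs_neg]))
  | zero =>
    simp only [Pi.zero_apply, map_zero]
    exact Submodule.zero_mem (harmonicSpan n)
  | add f g _ _ hf hg =>
    have := add_mem hf hg
    simpa [Pi.add_def] using! this
  | smul c f _ hf =>
    have := Submodule.smul_mem _ ((starRingEnd ℂ) c) hf
    simpa [Pi.smul_def] using! this

theorem horiz_pow_mul_legendre_mem {m d n : ℕ} (hd : m + d ≤ n) : (fun ω : S2 => horiz ω ^ m *
    (((derivative^[m] (legendre (m + d))).eval (ω.1 2) : ℝ) : ℂ)) ∈ harmonicSpan n := by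
  set c : ℂ := (-1) ^ m * ((Real.sqrt ((2 * (m + d : ℕ) + 1) / (4 * Real.pi) *
    ((Nat.factorial (m + d - m) : ℝ) / (Nat.factorial (m + d + m) : ℝ))) : ℝ) : ℂ) with hc
  have hc0 : c ≠ 0 := by
    refine mul_ne_zero (pow_ne_zero _ (by norm_num)) ?_
    rw [Complex.ofReal_ne_zero]
    have h1 : (0 : ℝ) < Nat.factorial (m + d - m) := by exact_mod_cast Nat.factorial_pos _
    have h2 : (0 : ℝ) < Nat.factorial (m + d + m) := by exact_mod_cast Nat.factorial_pos _
    have := Real.pi_pos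
    positivity
  have h1 := Submodule.smul_mem _ c⁻¹ (sphericalHarmonic_mem_harmonicSpan (n := n)
    (l := m + d) (m := m) hd (by simp))
  convert h1 using 1
  ext ω
  simp only [Pi.smul_apply, smul_eq_mul, sphericalHarmonic, Int.natCast_nonneg, if_true,
    Int.natAbs_natCast, sphericalHarmonicNat, ← hc]
  rw [eq_inv_mul_iff_mul_eq₀ hc0, horiz]
  ring

theorem exists_sub_legendre_coeff_eq_zero (m d : ℕ) {Q : ℝ[X]} (hQ : Q.natDegree ≤ d) :
    ∃ (a : ℝ) (Q' : ℝ[X]), Q = Q' + C a * derivative^[m] (legendre (m + d)) ∧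
      Q'.natDegree ≤ d ∧ Q'.coeff d = 0 := by
  have hc := coeff_iterate_derivative_legendre (m + d) m (by omega)
  have hdeg := natDegree_iterate_derivative_legendre_le (m + d) m
  rw [Nat.add_sub_cancel_left] at hc hdeg
  refine ⟨Q.coeff d / (derivative^[m] (legendre (m + d))).coeff d,
    Q - C (Q.coeff d / (derivative^[m] (legendre (m + d))).coeff d) *
      derivative^[m] (legendre (m + d)), by ring, ?_, ?_⟩
  · exact (natDegree_sub_le_of_le hQ ((natDegree_C_mul_le _ _).trans hdeg)).trans (by simp)
  · rw [coeff_sub, coeff_C_mul, div_mul_cancel₀ _ hc, sub_self]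

/-- Up to a nonzero scalar, `horiz^m · D^m P_{m+d}` is `Y_{m+d,m}`; subtracting multiples of these
removes the leading term of `Q` one degree at a time. -/
theorem horiz_pow_mul_eval_mem {m d n : ℕ} (h : m + d ≤ n) {Q : ℝ[X]} (hQ : Q.natDegree ≤ d) :
    (fun ω : S2 => horiz ω ^ m * ((Q.eval (ω.1 2) : ℝ) : ℂ)) ∈ harmonicSpan n := by
  induction d generalizing Q with
  | zero =>
    obtain ⟨a, Q', rfl, h1, h2⟩ := exists_sub_legendre_coeff_eq_zero m 0 hQ
    have h3 : Q' = 0 := by rw [eq_C_of_natDegree_le_zero h1, h2, C_0]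
    subst h3
    convert Submodule.smul_mem _ (a : ℂ) (horiz_pow_mul_legendre_mem h) using 1
    ext ω
    simp
    ring
  | succ d ih =>
    obtain ⟨a, Q', rfl, h1, h2⟩ := exists_sub_legendre_coeff_eq_zero m (d + 1) hQ
    have h3 : Q'.natDegree ≤ d := by
      by_contra hcon
      have h4 : Q'.natDegree = d + 1 := by omega
      rw [← h4, coeff_natDegree, leadingCoeff_eq_zero] at h2
      rw [h2] at h4
      simp at h4
    convert add_mem (ih (by omega) h3)
      (Submodule.smul_mem _ (a : ℂ) (horiz_pow_mul_legendre_mem h)) using 1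
    ext ω
    simp
    ring

theorem horiz_pow_mul_pow_mem {m k n : ℕ} (h : m + k ≤ n) :
    horiz ^ m * coordFun 2 ^ k ∈ harmonicSpan n := by
  convert horiz_pow_mul_eval_mem h (natDegree_X_pow_le (R := ℝ) k) using 1
  ext ω
  simp [coordFun]

/-- The conjugate of `horiz`. -/
def conjHoriz : S2 → ℂ := fun ω => (starRingEnd ℂ) (horiz ω)

theorem conjHoriz_pow_mul_pow_mem {m k n : ℕ} (h : m + k ≤ n) :
    conjHoriz ^ m * coordFun 2 ^ k ∈ harmonicSpan n := by
  convert conj_mem_harmonicSpan (horiz_pow_mul_pow_mem h) using 1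
  ext ω
  simp [coordFun, conjHoriz]

/-- The reduced monomials of degree at most `n` on the sphere. -/
def reducedMonomials (n : ℕ) : Set (S2 → ℂ) :=
  {f | ∃ m k : ℕ, m + k ≤ n ∧
    (f = horiz ^ m * coordFun 2 ^ k ∨ f = conjHoriz ^ m * coordFun 2 ^ k)}

theorem horiz_mul_conjHoriz : horiz * conjHoriz = 1 - coordFun 2 ^ 2 := by
  ext ω
  have := horiz_mul_conj ω
  simpa [conjHoriz, coordFun] using this

theorem affineSpace_le : affineSpace ≤ Submodule.span ℂ {1, horiz, conjHoriz, coordFun 2} := by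
  have hh : horiz ∈ Submodule.span ℂ ({1, horiz, conjHoriz, coordFun 2} : Set (S2 → ℂ)) :=
    Submodule.subset_span (by simp)
  have hc : conjHoriz ∈ Submodule.span ℂ ({1, horiz, conjHoriz, coordFun 2} : Set (S2 → ℂ)) :=
    Submodule.subset_span (by simp)
  refine Submodule.span_le.2 ?_
  rintro f (rfl | ⟨i, rfl⟩)
  · exact Submodule.subset_span (by simp)
  · fin_cases i
    · have : coordFun 0 = (1 / 2 : ℂ) • (horiz + conjHoriz) := by
        ext ω
        simp [coordFun, horiz, conjHoriz]
        ring
      change coordFun 0 ∈ _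
      rw [this]
      exact Submodule.smul_mem _ _ (add_mem hh hc)
    · have : coordFun 1 = (-Complex.I / 2 : ℂ) • (horiz - conjHoriz) := by
        ext ω
        simp [coordFun, horiz, conjHoriz]
        linear_combination (ω.1 1 : ℂ) * Complex.I_mul_I
      change coordFun 1 ∈ _
      rw [this]
      exact Submodule.smul_mem _ _ (sub_mem hh hc)
    · exact Submodule.subset_span (by simp)

/-- With `w = horiz` and `z = ω₂`, the affine functions are spanned by `1, w, w̄, z`, and the sphere
relation `w w̄ = 1 - z²` removes every mixed product of `w` and `w̄` without raising the degree. -/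
theorem polySpace_le_span_reducedMonomials (n : ℕ) :
    polySpace n ≤ Submodule.span ℂ (reducedMonomials n) := by
  induction n with
  | zero =>
    rw [polySpace, pow_zero, Submodule.one_le]
    exact Submodule.subset_span ⟨0, 0, le_rfl, Or.inl (by simp)⟩
  | succ n ih =>
    rw [polySpace, pow_succ]
    refine (mul_le_mul' ih affineSpace_le).trans ?_
    rw [Submodule.span_mul_span, Submodule.span_le]
    have key : ∀ g : S2 → ℂ, ∀ m k : ℕ, m + k ≤ n + 1 →
        (g = horiz ^ m * coordFun 2 ^ k ∨ g = conjHoriz ^ m * coordFun 2 ^ k) →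
        g ∈ Submodule.span ℂ (reducedMonomials (n + 1)) :=
      fun g m k h hg => Submodule.subset_span ⟨m, k, h, hg⟩
    have hw := horiz_mul_conjHoriz
    rintro _ ⟨f, ⟨m, k, h, hf⟩, g, hg, rfl⟩
    simp only [Set.mem_insert_iff, Set.mem_singleton_iff] at hg
    change f * g ∈ _
    rcases hf with rfl | rfl <;> rcases hg with rfl | rfl | rfl | rfl
    · exact key _ m k (by omega) (Or.inl (by ring))
    · exact key _ (m + 1) k (by omega) (Or.inl (by ring))
    · rcases m with _ | m
      · exact key _ 1 k (by omega) (Or.inr (by ring))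
      · have : horiz ^ (m + 1) * coordFun 2 ^ k * conjHoriz =
          horiz ^ m * coordFun 2 ^ k - horiz ^ m * coordFun 2 ^ (k + 2) := by
          linear_combination (horiz ^ m * coordFun 2 ^ k) * hw
        rw [this]
        exact sub_mem (key _ m k (by omega) (Or.inl rfl))
          (key _ m (k + 2) (by omega) (Or.inl rfl))
    · exact key _ m (k + 1) (by omega) (Or.inl (by ring))
    · exact key _ m k (by omega) (Or.inr (by ring))
    · rcases m with _ | m
      · exact key _ 1 k (by omega) (Or.inl (by ring))
      · have : conjHoriz ^ (m + 1) * coordFun 2 ^ k * horiz =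
          conjHoriz ^ m * coordFun 2 ^ k - conjHoriz ^ m * coordFun 2 ^ (k + 2) := by
          linear_combination (conjHoriz ^ m * coordFun 2 ^ k) * hw
        rw [this]
        exact sub_mem (key _ m k (by omega) (Or.inr rfl))
          (key _ m (k + 2) (by omega) (Or.inr rfl))
    · exact key _ (m + 1) k (by omega) (Or.inr (by ring))
    · exact key _ m (k + 1) (by omega) (Or.inr (by ring))

/-- The bridge between two descriptions: `polySpace` is visibly invariant under isometries and
stable under products, while `harmonicSpan` has an orthonormal basis. -/
theorem harmonicSpan_eq_polySpace (n : ℕ) : harmonicSpan n = polySpace n := by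
  refine le_antisymm (harmonicSpan_le_polySpace n)
    ((polySpace_le_span_reducedMonomials n).trans (Submodule.span_le.2 ?_))
  rintro _ ⟨m, k, h, rfl | rfl⟩
  · exact horiz_pow_mul_pow_mem h
  · exact conjHoriz_pow_mul_pow_mem h

/-- Composition with `A` is an algebra homomorphism that maps each coordinate to a linear
combination of coordinates. -/
theorem polySpace_isomAct (A : EuclideanSpace ℝ (Fin 3) ≃ₗᵢ[ℝ] EuclideanSpace ℝ (Fin 3)) {n : ℕ}
    {f : S2 → ℂ} (hf : f ∈ polySpace n) : (fun ω => f (isomAct A ω)) ∈ polySpace n := by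
  let φ : (S2 → ℂ) →ₐ[ℂ] (S2 → ℂ) :=
    { toFun := fun f ω => f (isomAct A ω)
      map_one' := rfl
      map_mul' := fun _ _ => rfl
      map_zero' := rfl
      map_add' := fun _ _ => rfl
      commutes' := fun _ => rfl }
  have h1 : affineSpace.map φ.toLinearMap ≤ affineSpace := by
    rw [affineSpace, Submodule.map_span, Submodule.span_le]
    rintro _ ⟨f, (rfl | ⟨i, rfl⟩), rfl⟩
    · exact one_mem_affineSpace
    · have : φ.toLinearMap (coordFun i) =
          ∑ j, ((A (EuclideanSpace.single j 1) i : ℝ) : ℂ) • coordFun j := by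
        ext ω
        have h : ω.1 = ∑ j, ω.1 j • EuclideanSpace.single j (1 : ℝ) := by
          ext k; simp [Finset.sum_apply, Pi.single_apply]
        change ((A ω.1 i : ℝ) : ℂ) = _
        conv_lhs => rw [h]
        simp [coordFun, mul_comm]
      rw [this]
      exact Submodule.sum_mem _ fun j _ => Submodule.smul_mem _ _ (coordFun_mem_affineSpace j)
  have h2 : (polySpace n).map φ.toLinearMap ≤ polySpace n := by
    rw [polySpace, Submodule.map_pow]
    exact pow_le_pow_left' h1 n
  exact h2 ⟨f, hf, rfl⟩

theorem continuous_of_mem_harmonicSpan {n : ℕ} {f : S2 → ℂ} (hf : f ∈ harmonicSpan n) :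
    Continuous f := by
  induction hf using Submodule.span_induction with
  | mem f h =>
    obtain ⟨l, m, h, hm, rfl⟩ := h
    exact continuous_sphericalHarmonic l m
  | zero => exact continuous_const
  | add f g _ _ hf hg => exact hf.add hg
  | smul c f _ hf => exact hf.const_smul c

theorem continuous_of_mem_polySpace {n : ℕ} {f : S2 → ℂ} (hf : f ∈ polySpace n) :
    Continuous f := continuous_of_mem_harmonicSpan (by rwa [harmonicSpan_eq_polySpace])

/-! ### Harmonic expansions -/

theorem memLp_of_continuous {f : S2 → ℂ} (hf : Continuous f) : MemLp f 2 surfaceMeasure :=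
  hf.memLp_of_hasCompactSupport (HasCompactSupport.of_compactSpace f)

theorem memLp_sphericalHarmonic (l : ℕ) (m : ℤ) : MemLp (sphericalHarmonic l m) 2 surfaceMeasure :=
  memLp_of_continuous (continuous_sphericalHarmonic l m)

/-- The arguments are swapped because `inner` is conjugate-linear in its first slot and `l2Inner` in
its second. -/
theorem l2Inner_eq_inner {f g : S2 → ℂ} (hf : MemLp f 2 surfaceMeasure)
    (hg : MemLp g 2 surfaceMeasure) : l2Inner f g = inner ℂ (hg.toLp g) (hf.toLp f) := by
  rw [L2.inner_def, l2Inner]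
  refine integral_congr_ae ?_
  filter_upwards [hf.coeFn_toLp, hg.coeFn_toLp] with ω h1 h2
  rw [h1, h2]
  rfl

theorem l2Norm_eq_norm {f : S2 → ℂ} (hf : MemLp f 2 surfaceMeasure) :
    l2Norm f = ‖hf.toLp f‖ := (Lp.norm_toLp f hf).symm

theorem l2Norm_nonneg (f : S2 → ℂ) : 0 ≤ l2Norm f := ENNReal.toReal_nonneg

theorem l2Norm_congr {f g : S2 → ℂ} (h : f =ᵐ[surfaceMeasure] g) : l2Norm f = l2Norm g := by
  rw [l2Norm, l2Norm, eLpNorm_congr_ae h]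

theorem l2Inner_sub_left {f g h : S2 → ℂ} (hf : MemLp f 2 surfaceMeasure)
    (hg : MemLp g 2 surfaceMeasure) (hh : MemLp h 2 surfaceMeasure) :
    l2Inner (f - g) h = l2Inner f h - l2Inner g h := by
  rw [l2Inner_eq_inner (hf.sub hg) hh, l2Inner_eq_inner hf hh, l2Inner_eq_inner hg hh,
    MemLp.toLp_sub, inner_sub_right]

theorem harmonicCoeff_sub {f g : S2 → ℂ} (hf : MemLp f 2 surfaceMeasure)
    (hg : MemLp g 2 surfaceMeasure) (l : ℕ) (m : ℤ) :
    harmonicCoeff (f - g) l m = harmonicCoeff f l m - harmonicCoeff g l m :=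
  l2Inner_sub_left hf hg (memLp_sphericalHarmonic l m)

/-- The indices `(ℓ, m)` with `ℓ < N` and `|m| ≤ ℓ`. -/
def degIdx (N : ℕ) : Finset (Σ _ : ℕ, ℤ) :=
  (Finset.range N).sigma fun l => Finset.Icc (-(l : ℤ)) (l : ℤ)

theorem mem_degIdx {N : ℕ} {p : Σ _ : ℕ, ℤ} : p ∈ degIdx N ↔ p.1 < N ∧ |p.2| ≤ p.1 := by
  rw [degIdx, Finset.mem_sigma, Finset.mem_range, Finset.mem_Icc, abs_le]

theorem sum_degIdx {M : Type*} [AddCommMonoid M] (N : ℕ) (g : ℕ → ℤ → M) :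
    ∑ p ∈ degIdx N, g p.1 p.2 =
      ∑ l ∈ Finset.range N, ∑ m ∈ Finset.Icc (-(l : ℤ)) (l : ℤ), g l m :=
  Finset.sum_sigma _ _ _

/-- The finite harmonic sum with coefficients `c` in degrees below `N`. -/
def finiteSynthesis (N : ℕ) (c : ℕ → ℤ → ℂ) : S2 → ℂ := fun ω =>
  ∑ p ∈ degIdx N, c p.1 p.2 * sphericalHarmonic p.1 p.2 ω

theorem continuous_finiteSynthesis (N : ℕ) (c : ℕ → ℤ → ℂ) :
    Continuous (finiteSynthesis N c) :=
  continuous_finsetSum _ fun _ _ => continuous_const.mul (continuous_sphericalHarmonic _ _)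

theorem memLp_finiteSynthesis (N : ℕ) (c : ℕ → ℤ → ℂ) :
    MemLp (finiteSynthesis N c) 2 surfaceMeasure :=
  memLp_of_continuous (continuous_finiteSynthesis N c)

/-- A spherical harmonic as an element of `L²`. -/
def harmonicLp (p : Σ _ : ℕ, ℤ) : Lp ℂ 2 surfaceMeasure :=
  (memLp_sphericalHarmonic p.1 p.2).toLp _

theorem orthonormal_harmonicLp (N : ℕ) : Orthonormal ℂ fun p : degIdx N => harmonicLp p.1 := by
  classical
  rw [orthonormal_iff_ite]
  rintro ⟨p, hp⟩ ⟨q, hq⟩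
  rw [harmonicLp, harmonicLp, ← l2Inner_eq_inner, l2Inner_sphericalHarmonic (mem_degIdx.1 hq).2]
  congr 1
  simp only [Subtype.mk.injEq, eq_iff_iff]
  constructor
  · rintro ⟨h1, h2⟩
    exact Sigma.ext h1.symm (heq_of_eq h2.symm)
  · rintro rfl
    exact ⟨rfl, rfl⟩

theorem toLp_finiteSynthesis (N : ℕ) (c : ℕ → ℤ → ℂ) :
    (memLp_finiteSynthesis N c).toLp _ = ∑ p : degIdx N, c p.1.1 p.1.2 • harmonicLp p.1 := by
  rw [Finset.sum_coe_sort (degIdx N) (fun p => c p.1 p.2 • harmonicLp p)]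
  apply Lp.ext
  have h : ∀ᵐ ω ∂surfaceMeasure, ∀ p ∈ degIdx N, harmonicLp p ω = sphericalHarmonic p.1 p.2 ω :=
    (ae_ball_iff (degIdx N).countable_toSet).2 fun p _ =>
      (memLp_sphericalHarmonic p.1 p.2).coeFn_toLp
  have h2 : ∀ᵐ ω ∂surfaceMeasure, ∀ p ∈ degIdx N,
      (c p.1 p.2 • harmonicLp p : Lp ℂ 2 surfaceMeasure) ω = c p.1 p.2 • harmonicLp p ω :=
    (ae_ball_iff (degIdx N).countable_toSet).2 fun p _ => Lp.coeFn_smul _ _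
  filter_upwards [(memLp_finiteSynthesis N c).coeFn_toLp, h, h2,
    Lp.coeFn_finsetSum (degIdx N) (fun p => c p.1 p.2 • harmonicLp p)] with ω h3 h4 h5 h6
  rw [h3, h6, Finset.sum_apply, finiteSynthesis]
  refine Finset.sum_congr rfl fun p hp => ?_
  rw [h5 p hp, h4 p hp, smul_eq_mul]

/-- Parseval's identity for finite harmonic sums. -/
theorem l2Norm_finiteSynthesis_sq (N : ℕ) (c : ℕ → ℤ → ℂ) :
    l2Norm (finiteSynthesis N c) ^ 2 = ∑ p ∈ degIdx N, ‖c p.1 p.2‖ ^ 2 := by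
  rw [l2Norm_eq_norm (memLp_finiteSynthesis N c), toLp_finiteSynthesis]
  have h := (orthonormal_harmonicLp N).inner_sum (fun p => c p.1.1 p.1.2)
    (fun p => c p.1.1 p.1.2) Finset.univ
  rw [inner_self_eq_norm_sq_to_K] at h
  have h2 : ∀ p : degIdx N, (starRingEnd ℂ) (c p.1.1 p.1.2) * c p.1.1 p.1.2 =
      ((‖c p.1.1 p.1.2‖ ^ 2 : ℝ) : ℂ) := fun p => by
    rw [mul_comm, Complex.mul_conj, Complex.normSq_eq_norm_sq]
  simp only [h2] at h
  rw [← Complex.ofReal_sum] at h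
  rw [← Finset.sum_coe_sort (degIdx N) (fun p => ‖c p.1 p.2‖ ^ 2)]
  apply Complex.ofReal_injective
  rw [← h, Complex.ofReal_pow]
  rfl

/-- Bessel's inequality. -/
theorem sum_norm_harmonicCoeff_sq_le {f : S2 → ℂ} (hf : MemLp f 2 surfaceMeasure) (N : ℕ) :
    ∑ p ∈ degIdx N, ‖harmonicCoeff f p.1 p.2‖ ^ 2 ≤ l2Norm f ^ 2 := by
  rw [l2Norm_eq_norm hf, ← Finset.sum_coe_sort (degIdx N)
    (fun p => ‖harmonicCoeff f p.1 p.2‖ ^ 2)]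
  refine le_of_eq_of_le (Finset.sum_congr rfl fun p _ => ?_)
    ((orthonormal_harmonicLp N).sum_inner_products_le (hf.toLp f) (s := Finset.univ))
  rw [harmonicCoeff, l2Inner_eq_inner hf (memLp_sphericalHarmonic _ _)]
  rfl

theorem harmonicCoeff_finiteSynthesis (N : ℕ) (c : ℕ → ℤ → ℂ) {l : ℕ} {m : ℤ} (hm : |m| ≤ l) :
    harmonicCoeff (finiteSynthesis N c) l m = if l < N then c l m else 0 := by
  have hi : ∀ p ∈ degIdx N, Integrable (fun ω => c p.1 p.2 * sphericalHarmonic p.1 p.2 ω *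
      (starRingEnd ℂ) (sphericalHarmonic l m ω)) surfaceMeasure := fun p _ =>
    integrable_of_continuous ((continuous_const.mul (continuous_sphericalHarmonic _ _)).mul
      (Complex.continuous_conj.comp (continuous_sphericalHarmonic _ _)))
  have h1 : harmonicCoeff (finiteSynthesis N c) l m =
      ∑ p ∈ degIdx N, c p.1 p.2 * l2Inner (sphericalHarmonic p.1 p.2) (sphericalHarmonic l m) := by
    simp only [harmonicCoeff, l2Inner, finiteSynthesis, Finset.sum_mul]
    rw [integral_finsetSum _ hi]
    refine Finset.sum_congr rfl fun p _ => ?_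
    rw [← integral_const_mul]
    simp only [mul_assoc]
  rw [h1]
  have h2 : ∀ p ∈ degIdx N, c p.1 p.2 *
      l2Inner (sphericalHarmonic p.1 p.2) (sphericalHarmonic l m) =
      if p = ⟨l, m⟩ then c l m else 0 := by
    rintro ⟨k, n⟩ hp
    rw [l2Inner_sphericalHarmonic (mem_degIdx.1 hp).2]
    by_cases h : k = l ∧ n = m
    · obtain ⟨rfl, rfl⟩ := h; simp
    · have : ¬ ((⟨k, n⟩ : Σ _ : ℕ, ℤ) = ⟨l, m⟩) := by
        intro h'; apply h; cases h'; exact ⟨rfl, rfl⟩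
      simp only [if_neg h, if_neg this, mul_zero]
  rw [Finset.sum_congr rfl h2, Finset.sum_ite_eq']
  simp [mem_degIdx, hm]

theorem eq_finiteSynthesis_of_mem_harmonicSpan {n : ℕ} {f : S2 → ℂ} (hf : f ∈ harmonicSpan n) :
    ∃ c : ℕ → ℤ → ℂ, f = finiteSynthesis (n + 1) c := by
  induction hf using Submodule.span_induction with
  | mem f h =>
    obtain ⟨l, m, h, hm, rfl⟩ := h
    refine ⟨fun k j => if (⟨k, j⟩ : Σ _ : ℕ, ℤ) = ⟨l, m⟩ then 1 else 0, ?_⟩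
    ext ω
    simp only [finiteSynthesis, Sigma.eta, ite_mul, one_mul, zero_mul]
    rw [Finset.sum_ite_eq', if_pos (mem_degIdx.2 ⟨by simp; omega, hm⟩)]
  | zero => exact ⟨fun _ _ => 0, by ext ω; simp [finiteSynthesis]⟩
  | add f g _ _ hf hg =>
    obtain ⟨a, rfl⟩ := hf
    obtain ⟨b, rfl⟩ := hg
    exact ⟨fun l m => a l m + b l m, by
      ext ω; simp [finiteSynthesis, add_mul, Finset.sum_add_distrib]⟩
  | smul r f _ hf =>
    obtain ⟨a, rfl⟩ := hf
    exact ⟨fun l m => r * a l m, by ext ω; simp [finiteSynthesis, mul_assoc, Finset.mul_sum]⟩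

theorem finiteSynthesis_congr {N : ℕ} {c d : ℕ → ℤ → ℂ}
    (h : ∀ l m, l < N → |m| ≤ (l : ℤ) → c l m = d l m) :
    finiteSynthesis N c = finiteSynthesis N d := by
  ext ω
  refine Finset.sum_congr rfl fun p hp => ?_
  rw [mem_degIdx] at hp
  rw [h _ _ hp.1 hp.2]

theorem harmonic_expansion {n : ℕ} {f : S2 → ℂ} (hf : f ∈ polySpace n) :
    f = finiteSynthesis (n + 1) (harmonicCoeff f) := by
  rw [← harmonicSpan_eq_polySpace] at hf
  obtain ⟨c, rfl⟩ := eq_finiteSynthesis_of_mem_harmonicSpan hf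
  refine finiteSynthesis_congr fun l m hl hm => ?_
  rw [harmonicCoeff_finiteSynthesis _ _ hm, if_pos hl]

theorem harmonicCoeff_eq_zero_of_mem_polySpace {n l : ℕ} {m : ℤ} {f : S2 → ℂ}
    (hf : f ∈ polySpace n) (h : n < l) (hm : |m| ≤ l) : harmonicCoeff f l m = 0 := by
  rw [harmonic_expansion hf, harmonicCoeff_finiteSynthesis _ _ hm, if_neg (by omega)]

/-! ### Completeness -/

theorem exists_mem_polySpace_of_mem_adjoin {h : C(S2, ℂ)}
    (hh : h ∈ StarAlgebra.adjoin ℂ (Set.range fun i => (⟨coordFun i, by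
      unfold coordFun; fun_prop⟩ : C(S2, ℂ)))) : ∃ n, (h : S2 → ℂ) ∈ polySpace n := by
  induction hh using StarAlgebra.adjoin_induction with
  | mem x hx =>
    obtain ⟨i, rfl⟩ := hx
    exact ⟨1, affineSpace_le_polySpace_one (coordFun_mem_affineSpace i)⟩
  | algebraMap r =>
    refine ⟨1, affineSpace_le_polySpace_one ?_⟩
    convert Submodule.smul_mem _ r one_mem_affineSpace using 1
    ext ω
    simp
  | add x y _ _ hx hy =>
    obtain ⟨a, ha⟩ := hx
    obtain ⟨b, hb⟩ := hy
    exact ⟨max a b, add_mem (polySpace_mono (le_max_left _ _) ha)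
      (polySpace_mono (le_max_right _ _) hb)⟩
  | mul x y _ _ hx hy =>
    obtain ⟨a, ha⟩ := hx
    obtain ⟨b, hb⟩ := hy
    exact ⟨a + b, mul_mem_polySpace ha hb⟩
  | star x _ hx =>
    obtain ⟨a, ha⟩ := hx
    rw [← harmonicSpan_eq_polySpace] at ha
    refine ⟨a, ?_⟩
    rw [← harmonicSpan_eq_polySpace]
    exact conj_mem_harmonicSpan ha

/-- Such an `f` is orthogonal to all polynomials, hence to all continuous functions by
Stone–Weierstrass, hence to all of `L²` by density, and so to itself. -/
theorem ae_eq_zero_of_harmonicCoeff_eq_zero {f : S2 → ℂ} (hf : MemLp f 2 surfaceMeasure)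
    (h : ∀ (l : ℕ) (m : ℤ), |m| ≤ l → harmonicCoeff f l m = 0) : f =ᵐ[surfaceMeasure] 0 := by
  have hpoly : ∀ n, ∀ g ∈ polySpace n, l2Inner f g = 0 := by
    intro n g hg
    have hgm := memLp_of_continuous (continuous_of_mem_polySpace hg)
    have e := harmonic_expansion hg
    have e2 : hgm.toLp g = ∑ p : degIdx (n + 1),
        harmonicCoeff g p.1.1 p.1.2 • harmonicLp p.1 := by
      rw [← toLp_finiteSynthesis]
      congr 1
    rw [l2Inner_eq_inner hf hgm, e2, sum_inner]
    refine Finset.sum_eq_zero fun p _ => ?_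
    rw [inner_smul_left]
    have := h p.1.1 p.1.2 (mem_degIdx.1 p.2).2
    rw [harmonicCoeff, l2Inner_eq_inner hf (memLp_sphericalHarmonic _ _)] at this
    rw [harmonicLp, this, mul_zero]
  let T := ContinuousMap.toLp (E := ℂ) 2 surfaceMeasure ℂ
  let S := StarAlgebra.adjoin ℂ (Set.range fun i => (⟨coordFun i, by
      unfold coordFun; fun_prop⟩ : C(S2, ℂ)))
  have hsep : S.SeparatesPoints := by
    intro x y hxy
    by_contra hcon
    push Not at hcon
    apply hxy
    apply Subtype.ext
    ext i
    have := hcon (coordFun i) ⟨⟨coordFun i, by unfold coordFun; fun_prop⟩,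
      StarAlgebra.subset_adjoin _ _ ⟨i, rfl⟩, rfl⟩
    exact Complex.ofReal_injective this
  have htop := ContinuousMap.starSubalgebra_topologicalClosure_eq_top_of_separatesPoints S hsep
  have h1 : ∀ g : C(S2, ℂ), inner ℂ (T g) (hf.toLp f) = 0 := by
    intro g
    have hg : g ∈ closure (S : Set C(S2, ℂ)) := by
      rw [← StarSubalgebra.topologicalClosure_coe, htop]; trivial
    have hcl : IsClosed {g : C(S2, ℂ) | inner ℂ (T g) (hf.toLp f) = 0} :=
      isClosed_eq (T.continuous.inner continuous_const) continuous_const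
    refine closure_minimal (fun g hg => ?_) hcl hg
    obtain ⟨n, hn⟩ := exists_mem_polySpace_of_mem_adjoin hg
    have h2 := hpoly n g hn
    rw [l2Inner_eq_inner hf (memLp_of_continuous g.continuous)] at h2
    exact h2
  have hd : DenseRange T := ContinuousMap.toLp_denseRange ℂ surfaceMeasure ℂ (by simp)
  have h2 : ∀ v : Lp ℂ 2 surfaceMeasure, inner ℂ v (hf.toLp f) = 0 := by
    intro v
    have hcl : IsClosed {v : Lp ℂ 2 surfaceMeasure | inner ℂ v (hf.toLp f) = 0} :=
      isClosed_eq (continuous_id.inner continuous_const) continuous_const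
    refine hd.induction_on v hcl h1
  have h3 := inner_self_eq_zero.1 (h2 (hf.toLp f))
  filter_upwards [hf.coeFn_toLp, Lp.eq_zero_iff_ae_eq_zero.1 h3] with ω h4 h5
  rw [← h4, h5]

/-- Supplies the continuous representative on which pointwise estimates and composition with a
diffeomorphism make sense. -/
theorem ae_eq_finiteSynthesis_of_isBandlimited {L : ℕ} {f : S2 → ℂ}
    (hf : MemLp f 2 surfaceMeasure) (h : IsBandlimited L f) :
    f =ᵐ[surfaceMeasure] finiteSynthesis L (harmonicCoeff f) := by
  have hs := memLp_finiteSynthesis L (harmonicCoeff f)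
  have := ae_eq_zero_of_harmonicCoeff_eq_zero (hf.sub hs) fun l m hm => by
    rw [harmonicCoeff_sub hf hs, harmonicCoeff_finiteSynthesis _ _ hm]
    split_ifs with hl
    · exact sub_self _
    · rw [h l (by omega) m hm, sub_zero]
  filter_upwards [this] with ω hω
  exact sub_eq_zero.1 hω

/-! ### The addition theorem -/

theorem l2Inner_isomAct_left (A : EuclideanSpace ℝ (Fin 3) ≃ₗᵢ[ℝ] EuclideanSpace ℝ (Fin 3))
    (f g : S2 → ℂ) :
    l2Inner (fun ω => f (isomAct A ω)) g = l2Inner f (fun ω => g (isomAct A.symm ω)) := by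
  rw [← l2Inner_isomAct A f]
  simp

/-- Isometries preserve the degree. For `l < k`, `Y_l ∘ A` is a polynomial of degree at most `l`, so
its degree-`k` coefficients vanish; for `l > k`, move `A` to the other factor. -/
theorem l2Inner_sphericalHarmonic_isomAct_of_ne
    (A : EuclideanSpace ℝ (Fin 3) ≃ₗᵢ[ℝ] EuclideanSpace ℝ (Fin 3)) {l k : ℕ} {m n : ℤ}
    (hm : |m| ≤ l) (hn : |n| ≤ k) (h : l ≠ k) :
    l2Inner (fun ω => sphericalHarmonic l m (isomAct A ω)) (sphericalHarmonic k n) = 0 := by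
  rcases lt_or_gt_of_ne h with h | h
  · exact harmonicCoeff_eq_zero_of_mem_polySpace
      (polySpace_isomAct A (sphericalHarmonic_mem_polySpace hm)) h hn
  · rw [l2Inner_isomAct_left, ← l2Inner_conj_symm]
    have := harmonicCoeff_eq_zero_of_mem_polySpace
      (polySpace_isomAct A.symm (sphericalHarmonic_mem_polySpace hn)) h hm
    rw [harmonicCoeff] at this
    rw [this, map_zero]

/-- The reproducing kernel of the spherical harmonics of degree `l`. -/
def zonalKernel (l : ℕ) (ω η : S2) : ℂ :=
  ∑ m ∈ Finset.Icc (-(l : ℤ)) (l : ℤ),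
    sphericalHarmonic l m ω * (starRingEnd ℂ) (sphericalHarmonic l m η)

theorem zonalKernel_mem_polySpace (l : ℕ) (η : S2) :
    (fun ω => zonalKernel l ω η) ∈ polySpace l := by
  have : (fun ω => zonalKernel l ω η) = ∑ m ∈ Finset.Icc (-(l : ℤ)) (l : ℤ),
      (starRingEnd ℂ) (sphericalHarmonic l m η) • sphericalHarmonic l m := by
    ext ω
    simp [zonalKernel, mul_comm]
  rw [this]
  exact Submodule.sum_mem _ fun m hm => Submodule.smul_mem _ _
    (sphericalHarmonic_mem_polySpace (abs_le.2 (Finset.mem_Icc.1 hm)))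

/-- The kernel reproduces polynomials whose only nonzero coefficients are in degree `l`. -/
theorem l2Inner_zonalKernel {l n : ℕ} {g : S2 → ℂ} (hg : g ∈ polySpace n) (η : S2)
    (h : ∀ (k : ℕ) (m : ℤ), |m| ≤ k → k ≠ l → harmonicCoeff g k m = 0) :
    l2Inner (fun ω => zonalKernel l ω η) g = (starRingEnd ℂ) (g η) := by
  have hc := continuous_of_mem_polySpace hg
  have h1 : l2Inner (fun ω => zonalKernel l ω η) g =
      ∑ m ∈ Finset.Icc (-(l : ℤ)) (l : ℤ), (starRingEnd ℂ) (sphericalHarmonic l m η) *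
        (starRingEnd ℂ) (harmonicCoeff g l m) := by
    simp only [l2Inner, zonalKernel, Finset.sum_mul]
    rw [integral_finsetSum]
    · refine Finset.sum_congr rfl fun m _ => ?_
      rw [harmonicCoeff, l2Inner_conj_symm, l2Inner, ← integral_const_mul]
      congr 1
      ext ω
      ring
    · intro m _
      have h1 := continuous_sphericalHarmonic l m
      exact integrable_of_continuous ((h1.mul continuous_const).mul
        (Complex.continuous_conj.comp hc))
  have h2 := congrFun (harmonic_expansion (polySpace_mono (le_max_left n l) hg)) η
  rw [h1, h2, finiteSynthesis,
    sum_degIdx (max n l + 1) (fun l m => harmonicCoeff g l m * sphericalHarmonic l m η),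
    Finset.sum_eq_single l, map_sum]
  · refine Finset.sum_congr rfl fun m _ => ?_
    rw [map_mul, mul_comm]
  · intro k _ hk
    refine Finset.sum_eq_zero fun m hm => ?_
    rw [h k m (abs_le.2 (Finset.mem_Icc.1 hm)) hk, zero_mul]
  · intro hl
    simp at hl

/-- As functions of `ω`, both sides have the same harmonic coefficients. In degree `l` the
reproducing property gives the conjugate of `Y_{lm}(A⁻¹ A η) = Y_{lm}(η)`; in every other degree
both coefficients vanish. -/
theorem zonalKernel_isomAct (A : EuclideanSpace ℝ (Fin 3) ≃ₗᵢ[ℝ] EuclideanSpace ℝ (Fin 3))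
    (l : ℕ) (ω η : S2) :
    zonalKernel l (isomAct A ω) (isomAct A η) = zonalKernel l ω η := by
  have h1 : (fun ω => zonalKernel l (isomAct A ω) (isomAct A η)) ∈ polySpace l :=
    polySpace_isomAct A (zonalKernel_mem_polySpace l (isomAct A η))
  have h2 := zonalKernel_mem_polySpace l η
  have e1 := harmonic_expansion h1
  have e2 := harmonic_expansion h2
  have : (fun ω => zonalKernel l (isomAct A ω) (isomAct A η)) = fun ω => zonalKernel l ω η := by
    rw [e1, e2]
    refine finiteSynthesis_congr fun k m _ hm => ?_
    rw [harmonicCoeff, l2Inner_isomAct_left A (fun ω => zonalKernel l ω (isomAct A η)),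
      harmonicCoeff]
    by_cases hk : k = l
    · subst hk
      rw [l2Inner_zonalKernel (polySpace_isomAct A.symm (sphericalHarmonic_mem_polySpace hm)),
        l2Inner_zonalKernel (sphericalHarmonic_mem_polySpace hm), isomAct_symm_isomAct]
      · intro j n hn hj
        rw [harmonicCoeff, l2Inner_sphericalHarmonic hm, if_neg (fun h' => hj h'.1.symm)]
      · intro j n hn hj
        exact l2Inner_sphericalHarmonic_isomAct_of_ne A.symm hm hn hj.symm
    · have key : ∀ (x : S2) (g : S2 → ℂ), Continuous g →
          (∀ n : ℤ, |n| ≤ l → l2Inner (sphericalHarmonic l n) g = 0) →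
          l2Inner (fun ω => zonalKernel l ω x) g = 0 := by
        intro x g hg h
        simp only [l2Inner, zonalKernel, Finset.sum_mul]
        rw [integral_finsetSum]
        · refine Finset.sum_eq_zero fun n hn => ?_
          have := h n (abs_le.2 (Finset.mem_Icc.1 hn))
          rw [l2Inner] at this
          rw [← mul_zero ((starRingEnd ℂ) (sphericalHarmonic l n x)), ← this,
            ← integral_const_mul]
          congr 1
          ext ω
          ring
        · intro n _
          have h1 := continuous_sphericalHarmonic l n
          exact integrable_of_continuous ((h1.mul continuous_const).mul
            (Complex.continuous_conj.comp hg))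
      rw [key, key]
      · exact continuous_sphericalHarmonic k m
      · intro n hn
        rw [l2Inner_sphericalHarmonic hn, if_neg (fun h' => hk h'.1.symm)]
      · exact (continuous_sphericalHarmonic k m).comp (continuous_isomAct _)
      · intro n hn
        rw [← l2Inner_isomAct_left]
        exact l2Inner_sphericalHarmonic_isomAct_of_ne A hn hm (Ne.symm hk)
  exact congrFun this ω

/-- The north pole. -/
def northPole : S2 := ⟨EuclideanSpace.single 2 1, by simp⟩

theorem inner_northPole (ω : S2) : inner ℝ ω.1 northPole.1 = ω.1 2 := by
  simp [northPole, EuclideanSpace.inner_single_right]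

theorem isomAct_rotTo_northPole (ω : S2) : isomAct (rotTo ω).toIsom northPole = ω := by
  apply Subtype.ext
  change WithLp.toLp 2 ((rotZMatrix (Complex.arg (horiz ω)) *
    rotYMatrix (Real.arccos (ω.1 2))).mulVec northPole.1.ofLp) = ω.1
  have hs := sum_coord_sq ω
  have h2 : ω.1 2 ^ 2 ≤ 1 := by nlinarith [sq_nonneg (ω.1 0), sq_nonneg (ω.1 1)]
  have hcos : Real.cos (Real.arccos (ω.1 2)) = ω.1 2 :=
    Real.cos_arccos (by nlinarith) (by nlinarith)
  have hsin : Real.sin (Real.arccos (ω.1 2)) = ‖horiz ω‖ := by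
    rw [Real.sin_arccos, horiz, Complex.norm_add_mul_I]
    congr 1
    linarith
  have hre : ‖horiz ω‖ * Real.cos (Complex.arg (horiz ω)) = ω.1 0 := by
    rw [Complex.norm_mul_cos_arg]; simp [horiz]
  have him : ‖horiz ω‖ * Real.sin (Complex.arg (horiz ω)) = ω.1 1 := by
    rw [Complex.norm_mul_sin_arg]; simp [horiz]
  have e : northPole.1.ofLp = Pi.single 2 1 := rfl
  rw [e, Matrix.mulVec_single_one]
  ext i
  fin_cases i
  · simp [rotZMatrix, rotYMatrix, hsin]
    linarith
  · simp [rotZMatrix, rotYMatrix, hsin]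
    linarith
  · simp [rotZMatrix, rotYMatrix, hcos]

theorem inner_isomAct (A : EuclideanSpace ℝ (Fin 3) ≃ₗᵢ[ℝ] EuclideanSpace ℝ (Fin 3)) (ω η : S2) :
    inner ℝ (isomAct A ω).1 (isomAct A η).1 = inner ℝ ω.1 η.1 :=
  A.inner_map_map _ _

theorem isomAct_rotTo_symm_coord_two (ω η : S2) :
    (isomAct (rotTo ω).toIsom.symm η).1 2 = inner ℝ η.1 ω.1 := by
  rw [← inner_northPole, ← inner_isomAct (rotTo ω).toIsom, isomAct_isomAct_symm,
    isomAct_rotTo_northPole]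

theorem sphericalHarmonic_zero (l : ℕ) (ω : S2) : sphericalHarmonic l 0 ω =
    ((Real.sqrt ((2 * l + 1) / (4 * Real.pi)) * (legendre l).eval (ω.1 2) : ℝ) : ℂ) := by
  have : (Nat.factorial l : ℝ) ≠ 0 := by exact_mod_cast Nat.factorial_ne_zero l
  simp [sphericalHarmonic, sphericalHarmonicNat, this]

theorem sphericalHarmonic_northPole {l : ℕ} {m : ℤ} (hm : m ≠ 0) :
    sphericalHarmonic l m northPole = 0 := by
  have : m.natAbs ≠ 0 := by simpa
  simp [sphericalHarmonic, sphericalHarmonicNat, northPole, this]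

/-- The addition theorem for spherical harmonics. -/
theorem zonalKernel_eq (l : ℕ) (ω η : S2) : zonalKernel l ω η =
    (((2 * l + 1) / (4 * Real.pi) * (legendre l).eval (inner ℝ ω.1 η.1) : ℝ) : ℂ) := by
  rw [← zonalKernel_isomAct (rotTo η).toIsom.symm]
  have h : isomAct (rotTo η).toIsom.symm η = northPole := by
    have := isomAct_symm_isomAct (rotTo η).toIsom northPole
    rwa [isomAct_rotTo_northPole] at this
  -- By invariance `η` has been moved to the north pole, where only the order `m = 0` is nonzero.
  rw [h, zonalKernel, Finset.sum_eq_single 0, sphericalHarmonic_zero, sphericalHarmonic_zero,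
    isomAct_rotTo_symm_coord_two]
  · have h1 : northPole.1 2 = 1 := by simp [northPole]
    rw [h1, legendre_eval_one, Complex.conj_ofReal, ← Complex.ofReal_mul]
    congr 1
    have : Real.sqrt ((2 * l + 1) / (4 * Real.pi)) * Real.sqrt ((2 * l + 1) / (4 * Real.pi)) =
      (2 * l + 1) / (4 * Real.pi) := Real.mul_self_sqrt (by positivity)
    linear_combination (legendre l).eval (inner ℝ ω.1 η.1) * this
  · intro m _ hm
    rw [sphericalHarmonic_northPole hm, map_zero, mul_zero]
  · intro h0
    simp at h0

/-! ### Convolution with axisymmetric filters -/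

/-- Harmonic coefficients of the axisymmetric filter with multiplier `a`. -/
def filterCoeff (a : ℕ → ℝ) (l : ℕ) (m : ℤ) : ℂ :=
  if m = 0 then ((Real.sqrt ((2 * l + 1) / (4 * Real.pi)) * a l : ℝ) : ℂ) else 0

theorem harmonicSynthesis_filterCoeff {a : ℕ → ℝ} {N : ℕ} (ha : ∀ l, N ≤ l → a l = 0) (η : S2) :
    harmonicSynthesis (filterCoeff a) η = ∑ l ∈ Finset.range N,
      (a l : ℂ) * (((2 * l + 1) / (4 * Real.pi) * (legendre l).eval (η.1 2) : ℝ) : ℂ) := by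
  have h : ∀ l : ℕ, ∑ m ∈ Finset.Icc (-(l : ℤ)) (l : ℤ),
      filterCoeff a l m * sphericalHarmonic l m η =
      (a l : ℂ) * (((2 * l + 1) / (4 * Real.pi) * (legendre l).eval (η.1 2) : ℝ) : ℂ) := by
    intro l
    rw [Finset.sum_eq_single 0]
    · rw [filterCoeff, if_pos rfl, sphericalHarmonic_zero, ← Complex.ofReal_mul,
        ← Complex.ofReal_mul]
      congr 1
      have : Real.sqrt ((2 * l + 1) / (4 * Real.pi)) * Real.sqrt ((2 * l + 1) / (4 * Real.pi)) =
        (2 * l + 1) / (4 * Real.pi) := Real.mul_self_sqrt (by positivity)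
      linear_combination (a l * (legendre l).eval (η.1 2)) * this
    · intro m _ hm
      simp [filterCoeff, hm]
    · intro h0
      simp at h0
  rw [harmonicSynthesis, tsum_congr h]
  refine tsum_eq_sum fun l hl => ?_
  rw [ha l (by simpa using hl)]
  simp

theorem integrable_mul_conj {f g : S2 → ℂ} (hf : MemLp f 2 surfaceMeasure)
    (hg : MemLp g 2 surfaceMeasure) :
    Integrable (fun ω => f ω * (starRingEnd ℂ) (g ω)) surfaceMeasure :=
  hf.integrable_mul hg.star

/-- By the addition theorem the rotated filter is `η ↦ ∑ a_l K_l(η, ω)` with `K_l` the zonal kernel,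
so convolution is a Fourier multiplier. The factor `√((2l+1)/4π)` in the filter coefficients is what
makes the multiplier exactly `a_l`. -/
theorem sphConv_filter {a : ℕ → ℝ} {N : ℕ} (ha : ∀ l, N ≤ l → a l = 0) {f : S2 → ℂ}
    (hf : MemLp f 2 surfaceMeasure) :
    sphConv f (harmonicSynthesis (filterCoeff a)) =
      finiteSynthesis N (fun l m => (a l : ℂ) * harmonicCoeff f l m) := by
  ext ω
  have hrot : ∀ η, SO3.rotate (rotTo ω) (harmonicSynthesis (filterCoeff a)) η =
      ∑ p ∈ degIdx N, (a p.1 : ℂ) * (sphericalHarmonic p.1 p.2 η *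
        (starRingEnd ℂ) (sphericalHarmonic p.1 p.2 ω)) := by
    intro η
    rw [SO3.rotate, harmonicSynthesis_filterCoeff ha, sum_degIdx N (fun l m => (a l : ℂ) *
      (sphericalHarmonic l m η * (starRingEnd ℂ) (sphericalHarmonic l m ω)))]
    refine Finset.sum_congr rfl fun l _ => ?_
    rw [← Finset.mul_sum]
    congr 1
    have := isomAct_rotTo_symm_coord_two ω η
    change (SO3.act (rotTo ω)⁻¹ η).1 2 = _ at this
    rw [this]
    exact (zonalKernel_eq l η ω).symm
  simp only [sphConv, l2Inner, hrot, map_sum, Finset.mul_sum]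
  rw [integral_finsetSum]
  · rw [finiteSynthesis]
    refine Finset.sum_congr rfl fun p _ => ?_
    rw [harmonicCoeff, l2Inner, mul_assoc, mul_comm (∫ _, _ ∂_), ← integral_const_mul,
      ← integral_const_mul]
    congr 1
    ext η
    simp only [map_mul, Complex.conj_ofReal, Complex.conj_conj]
    ring
  · intro p _
    have := (integrable_mul_conj hf (memLp_sphericalHarmonic p.1 p.2)).const_mul
      ((a p.1 : ℂ) * sphericalHarmonic p.1 p.2 ω)
    convert this using 2
    simp only [map_mul, Complex.conj_ofReal, Complex.conj_conj]
    ring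

/-- The rotated filter depends only on the inner product of `η` and `ω`, so convolution commutes
with all isometries, reflections included. -/
theorem sphConv_isomAct (A : EuclideanSpace ℝ (Fin 3) ≃ₗᵢ[ℝ] EuclideanSpace ℝ (Fin 3))
    {a : ℕ → ℝ} {N : ℕ} (ha : ∀ l, N ≤ l → a l = 0) (f : S2 → ℂ) (ω : S2) :
    sphConv (fun η => f (isomAct A η)) (harmonicSynthesis (filterCoeff a)) ω =
      sphConv f (harmonicSynthesis (filterCoeff a)) (isomAct A ω) := by
  have hrot : ∀ ω η, SO3.rotate (rotTo ω) (harmonicSynthesis (filterCoeff a)) η =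
      ∑ l ∈ Finset.range N, (a l : ℂ) *
        (((2 * l + 1) / (4 * Real.pi) * (legendre l).eval (inner ℝ η.1 ω.1) : ℝ) : ℂ) := by
    intro ω η
    rw [SO3.rotate, harmonicSynthesis_filterCoeff ha]
    have := isomAct_rotTo_symm_coord_two ω η
    change (SO3.act (rotTo ω)⁻¹ η).1 2 = _ at this
    rw [this]
  have h : SO3.rotate (rotTo ω) (harmonicSynthesis (filterCoeff a)) = fun η =>
      SO3.rotate (rotTo (isomAct A ω)) (harmonicSynthesis (filterCoeff a)) (isomAct A η) := by
    ext η
    rw [hrot, hrot, inner_isomAct]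
  rw [sphConv, sphConv, h]
  exact l2Inner_isomAct A f _

/-! ### Tiling of the harmonic line -/

/-- The integrand `s_α(u)² / u`. -/
def tilingDensity (α u : ℝ) : ℝ := bumpScaled α u ^ 2 / u

theorem measurable_tilingDensity (α : ℝ) : Measurable (tilingDensity α) := by
  have h : Measurable bump := by
    unfold bump
    refine Measurable.ite ?_ (by fun_prop) measurable_const
    exact (measurableSet_lt measurable_const measurable_id).inter
      (measurableSet_lt measurable_id measurable_const)
  have h2 : Measurable (bumpScaled α) := h.comp (by fun_prop)
  exact (h2.pow_const 2).div measurable_id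

theorem tilingDensity_of_le {α u : ℝ} (hα : 1 < α) (hu : u ≤ α⁻¹) : tilingDensity α u = 0 := by
  have h : 2 * α / (α - 1) * (u - α⁻¹) ≤ 0 :=
    mul_nonpos_of_nonneg_of_nonpos (div_nonneg (by linarith) (by linarith)) (by linarith)
  have : bumpScaled α u = 0 := by
    rw [bumpScaled, bump, if_neg]
    intro h'
    linarith [h'.1]
  simp [tilingDensity, this]

theorem tilingDensity_of_one_le {α u : ℝ} (hα : 1 < α) (hu : 1 ≤ u) : tilingDensity α u = 0 := by
  have h1 : 2 * α / (α - 1) * (1 - α⁻¹) = 2 := by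
    have : α - 1 ≠ 0 := by linarith
    field_simp
  have h : 2 * α / (α - 1) * (1 - α⁻¹) ≤ 2 * α / (α - 1) * (u - α⁻¹) :=
    mul_le_mul_of_nonneg_left (by linarith) (div_nonneg (by linarith) (by linarith))
  have : bumpScaled α u = 0 := by
    rw [bumpScaled, bump, if_neg]
    intro h'
    linarith [h'.2]
  simp [tilingDensity, this]

theorem bump_sq_le_one (t : ℝ) : bump t ^ 2 ≤ 1 := by
  unfold bump
  split_ifs with h
  · have h1 : 0 ≤ (1 - t ^ 2)⁻¹ := inv_nonneg.2 (by nlinarith)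
    have h2 : Real.exp (-(1 - t ^ 2)⁻¹) ≤ 1 := Real.exp_le_one_iff.2 (by linarith)
    exact pow_le_one₀ (Real.exp_pos _).le h2
  · norm_num

theorem tilingDensity_nonneg {α : ℝ} (hα : 1 < α) (u : ℝ) : 0 ≤ tilingDensity α u := by
  rcases le_or_gt u α⁻¹ with h | h
  · rw [tilingDensity_of_le hα h]
  · have : 0 < α⁻¹ := inv_pos.2 (by linarith)
    exact div_nonneg (sq_nonneg _) (by linarith)

theorem tilingDensity_le {α : ℝ} (hα : 1 < α) (u : ℝ) : tilingDensity α u ≤ α := by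
  rcases le_or_gt u α⁻¹ with h | h
  · rw [tilingDensity_of_le hα h]; linarith
  · have h0 : 0 < α⁻¹ := inv_pos.2 (by linarith)
    have hu : 0 < u := by linarith
    rw [tilingDensity, div_le_iff₀ hu]
    have : 1 ≤ α * u := by
      have := mul_lt_mul_of_pos_left h (show 0 < α by linarith)
      rw [mul_inv_cancel₀ (by linarith)] at this
      exact this.le
    exact (bump_sq_le_one _).trans this

theorem intervalIntegrable_tilingDensity {α : ℝ} (hα : 1 < α) (a b : ℝ) :
    IntervalIntegrable (tilingDensity α) volume a b := by
  refine (intervalIntegrable_const (c := α)).mono_fun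
    (measurable_tilingDensity α).aestronglyMeasurable (.of_forall fun u => ?_)
  beta_reduce
  rw [Real.norm_of_nonneg (tilingDensity_nonneg hα u), Real.norm_of_nonneg (by linarith)]
  exact tilingDensity_le hα u

theorem integral_tilingDensity_antitone {α : ℝ} (hα : 1 < α) :
    Antitone fun t : ℝ => ∫ u in t..1, tilingDensity α u := by
  intro s t hst
  have h := intervalIntegral.integral_add_adjacent_intervals
    (intervalIntegrable_tilingDensity hα s t) (intervalIntegrable_tilingDensity hα t 1)
  have h2 : 0 ≤ ∫ u in s..t, tilingDensity α u :=
    intervalIntegral.integral_nonneg hst fun u _ => tilingDensity_nonneg hα u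
  change (∫ u in t..1, tilingDensity α u) ≤ ∫ u in s..1, tilingDensity α u
  linarith

theorem integral_tilingDensity_of_one_le {α t : ℝ} (hα : 1 < α) (ht : 1 ≤ t) :
    ∫ u in t..1, tilingDensity α u = 0 := by
  rw [intervalIntegral.integral_symm, intervalIntegral.integral_congr (g := fun _ => (0 : ℝ))]
  · simp
  · intro u hu
    rw [Set.uIcc_of_le ht] at hu
    exact tilingDensity_of_one_le hα hu.1

theorem integral_tilingDensity_le {α : ℝ} (hα : 1 < α) (t : ℝ) :
    ∫ u in t..1, tilingDensity α u ≤ ∫ u in α⁻¹..1, tilingDensity α u := by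
  rcases le_or_gt t α⁻¹ with h | h
  · rw [← intervalIntegral.integral_add_adjacent_intervals
      (intervalIntegrable_tilingDensity hα t α⁻¹) (intervalIntegrable_tilingDensity hα α⁻¹ 1),
      intervalIntegral.integral_congr (a := t) (b := α⁻¹) (g := fun _ => (0 : ℝ))]
    · simp
    · intro u hu
      rw [Set.uIcc_of_le h] at hu
      exact tilingDensity_of_le hα hu.2
  · exact integral_tilingDensity_antitone hα h.le

theorem integral_tilingDensity_nonneg {α : ℝ} (hα : 1 < α) (t : ℝ) :
    0 ≤ ∫ u in t..1, tilingDensity α u := by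
  rw [← integral_tilingDensity_of_one_le hα (le_max_right t 1)]
  exact integral_tilingDensity_antitone hα (le_max_left t 1)

/-- Nonnegativity of the normalising integral is enough here and in the next bounds: were it zero,
division by zero would make `kFun` vanish identically. -/
theorem kFun_antitone {α : ℝ} (hα : 1 < α) : Antitone (kFun α) := fun _ _ h =>
  div_le_div_of_nonneg_right (integral_tilingDensity_antitone hα h)
    (integral_tilingDensity_nonneg hα _)

theorem kFun_nonneg {α : ℝ} (hα : 1 < α) (t : ℝ) : 0 ≤ kFun α t :=
  div_nonneg (integral_tilingDensity_nonneg hα _) (integral_tilingDensity_nonneg hα _)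

theorem kFun_le_one {α : ℝ} (hα : 1 < α) (t : ℝ) : kFun α t ≤ 1 :=
  div_le_one_of_le₀ (integral_tilingDensity_le hα t) (integral_tilingDensity_nonneg hα _)

theorem kFun_of_one_le {α t : ℝ} (hα : 1 < α) (ht : 1 ≤ t) : kFun α t = 0 := by
  have := integral_tilingDensity_of_one_le hα ht
  unfold tilingDensity at this
  rw [kFun, this, zero_div]

/-- The multiplier of the wavelet at scale `j`. -/
def waveletMultiplier (α : ℝ) (j l : ℕ) : ℝ := kappa α ((α ^ j)⁻¹ * l)

/-- The multiplier of the scaling function. -/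
def scalingMultiplier (α : ℝ) (J₀ l : ℕ) : ℝ := Real.sqrt (kFun α ((α ^ J₀)⁻¹ * l))

theorem inv_mul_pow_inv_mul {α : ℝ} (j l : ℕ) :
    α⁻¹ * ((α ^ j)⁻¹ * l) = (α ^ (j + 1))⁻¹ * l := by
  rw [pow_succ, mul_inv]; ring

theorem waveletMultiplier_sq {α : ℝ} (hα : 1 < α) (j l : ℕ) : waveletMultiplier α j l ^ 2 =
    kFun α ((α ^ (j + 1))⁻¹ * l) - kFun α ((α ^ j)⁻¹ * l) := by
  have h0 : 0 < α := by linarith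
  rw [waveletMultiplier, kappa, Real.sq_sqrt, inv_mul_pow_inv_mul]
  rw [sub_nonneg]
  apply kFun_antitone hα
  exact mul_le_of_le_one_left (by positivity) (inv_le_one_of_one_le₀ hα.le)

theorem scalingMultiplier_sq {α : ℝ} (hα : 1 < α) (J₀ l : ℕ) :
    scalingMultiplier α J₀ l ^ 2 = kFun α ((α ^ J₀)⁻¹ * l) :=
  Real.sq_sqrt (kFun_nonneg hα _)

theorem scalingMultiplier_eq_zero {α : ℝ} (hα : 1 < α) {J₀ l : ℕ} (h : α ^ J₀ ≤ l) :
    scalingMultiplier α J₀ l = 0 := by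
  have h0 : 0 < α ^ J₀ := by positivity
  rw [scalingMultiplier, kFun_of_one_le hα, Real.sqrt_zero]
  rw [inv_mul_eq_div, le_div_iff₀ h0, one_mul]
  exact h

theorem waveletMultiplier_eq_zero {α : ℝ} (hα : 1 < α) {j l : ℕ} (h : α ^ (j + 1) ≤ l) :
    waveletMultiplier α j l = 0 := by
  have h0 : 0 < α ^ (j + 1) := by positivity
  have h1 : 0 < α ^ j := by positivity
  have h2 : α ^ j ≤ α ^ (j + 1) := pow_le_pow_right₀ hα.le (by omega)
  rw [waveletMultiplier, kappa, inv_mul_pow_inv_mul, kFun_of_one_le hα, kFun_of_one_le hα, sub_zero,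
    Real.sqrt_zero]
  · rw [inv_mul_eq_div, le_div_iff₀ h1, one_mul]; linarith
  · rw [inv_mul_eq_div, le_div_iff₀ h0, one_mul]; exact h

/-- The energy of the filter bank is at most one. -/
theorem sum_multiplier_sq_le {α : ℝ} (hα : 1 < α) {J₀ J : ℕ} (hJ : J₀ ≤ J) (l : ℕ) :
    scalingMultiplier α J₀ l ^ 2 + ∑ j ∈ Finset.Icc J₀ J, waveletMultiplier α j l ^ 2 ≤ 1 := by
  -- The squared wavelet multipliers are consecutive differences of `k_α(α⁻ʲ l)`, and the scaling
  -- function supplies the initial term, so the sum telescopes.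
  have : scalingMultiplier α J₀ l ^ 2 + ∑ j ∈ Finset.Icc J₀ J, waveletMultiplier α j l ^ 2 =
      kFun α ((α ^ (J + 1))⁻¹ * l) := by
    induction J, hJ using Nat.le_induction with
    | base => rw [Finset.Icc_self, Finset.sum_singleton, scalingMultiplier_sq hα,
        waveletMultiplier_sq hα]; ring
    | succ J hJ ih =>
      rw [Finset.sum_Icc_succ_top (by omega), waveletMultiplier_sq hα]
      linarith
  rw [this]
  exact kFun_le_one hα _

/-! ### Energy estimates for the scattering network -/

/-- One cutoff `⌈α ^ (J + 1)⌉₊` serves `Φ` and all wavelets of scale at most `J`, so all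
convolutions are finite sums over a common index set. -/
theorem ceil_pow_multiplier {α : ℝ} (hα : 1 < α) {J₀ J : ℕ} (hJ : J₀ ≤ J) {l : ℕ}
    (hl : ⌈α ^ (J + 1)⌉₊ ≤ l) : scalingMultiplier α J₀ l = 0 := by
  refine scalingMultiplier_eq_zero hα (le_trans ?_ (Nat.ceil_le.1 hl))
  exact pow_le_pow_right₀ hα.le (by omega)

theorem ceil_pow_waveletMultiplier {α : ℝ} (hα : 1 < α) {j J : ℕ} (hJ : j ≤ J) {l : ℕ}
    (hl : ⌈α ^ (J + 1)⌉₊ ≤ l) : waveletMultiplier α j l = 0 := by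
  refine waveletMultiplier_eq_zero hα (le_trans ?_ (Nat.ceil_le.1 hl))
  exact pow_le_pow_right₀ hα.le (by omega)

theorem sphConv_wavelet {α : ℝ} (hα : 1 < α) {j J : ℕ} (hj : j ≤ J) {f : S2 → ℂ}
    (hf : MemLp f 2 surfaceMeasure) : sphConv f (wavelet α j) = finiteSynthesis ⌈α ^ (J + 1)⌉₊
      (fun l m => (waveletMultiplier α j l : ℂ) * harmonicCoeff f l m) :=
  sphConv_filter (fun _ h => ceil_pow_waveletMultiplier hα hj h) hf

theorem sphConv_scalingFunction {α : ℝ} (hα : 1 < α) {J₀ J : ℕ} (hj : J₀ ≤ J) {f : S2 → ℂ}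
    (hf : MemLp f 2 surfaceMeasure) :
    sphConv f (scalingFunction α J₀) = finiteSynthesis ⌈α ^ (J + 1)⌉₊
      (fun l m => (scalingMultiplier α J₀ l : ℂ) * harmonicCoeff f l m) :=
  sphConv_filter (fun _ h => ceil_pow_multiplier hα hj h) hf

theorem continuous_sphConv_wavelet {α : ℝ} (hα : 1 < α) (j : ℕ) {f : S2 → ℂ}
    (hf : MemLp f 2 surfaceMeasure) : Continuous (sphConv f (wavelet α j)) := by
  rw [sphConv_wavelet hα le_rfl hf]
  exact continuous_finiteSynthesis _ _

theorem continuous_sphConv_scalingFunction {α : ℝ} (hα : 1 < α) (J₀ : ℕ) {f : S2 → ℂ}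
    (hf : MemLp f 2 surfaceMeasure) : Continuous (sphConv f (scalingFunction α J₀)) := by
  rw [sphConv_scalingFunction hα le_rfl hf]
  exact continuous_finiteSynthesis _ _

theorem memLp_propagatorStep {α : ℝ} (hα : 1 < α) (j : ℕ) {f : S2 → ℂ}
    (hf : MemLp f 2 surfaceMeasure) : MemLp (propagatorStep α j f) 2 surfaceMeasure :=
  memLp_of_continuous (Complex.continuous_ofReal.comp (continuous_sphConv_wavelet hα j hf).norm)

theorem memLp_propagator {α : ℝ} (hα : 1 < α) (p : List ℕ) {f : S2 → ℂ}
    (hf : MemLp f 2 surfaceMeasure) : MemLp (propagator α p f) 2 surfaceMeasure := by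
  induction p generalizing f with
  | nil => exact hf
  | cons j p ih => exact ih (memLp_propagatorStep hα j hf)

theorem continuous_scatteringTransform {α : ℝ} (hα : 1 < α) (J₀ : ℕ) (p : List ℕ) {f : S2 → ℂ}
    (hf : MemLp f 2 surfaceMeasure) : Continuous (scatteringTransform α J₀ p f) :=
  continuous_sphConv_scalingFunction hα J₀ (memLp_propagator hα p hf)

/-- Parseval on each output, the multiplier bound in each degree, then Bessel. Bessel suffices, so
`f` need not be bandlimited; this matters because the modulus destroys bandlimitedness. -/
theorem filterBank_energy_le {α : ℝ} (hα : 1 < α) {J₀ J : ℕ} (hJ : J₀ ≤ J) {f : S2 → ℂ}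
    (hf : MemLp f 2 surfaceMeasure) :
    l2Norm (sphConv f (scalingFunction α J₀)) ^ 2 +
      ∑ j ∈ Finset.Icc J₀ J, l2Norm (sphConv f (wavelet α j)) ^ 2 ≤ l2Norm f ^ 2 := by
  set N := ⌈α ^ (J + 1)⌉₊
  have h1 : ∀ j ∈ Finset.Icc J₀ J, l2Norm (sphConv f (wavelet α j)) ^ 2 =
      ∑ p ∈ degIdx N, waveletMultiplier α j p.1 ^ 2 * ‖harmonicCoeff f p.1 p.2‖ ^ 2 := by
    intro j hj
    rw [sphConv_wavelet hα (Finset.mem_Icc.1 hj).2 hf, l2Norm_finiteSynthesis_sq]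
    simp [mul_pow, N]
  rw [Finset.sum_congr rfl h1, Finset.sum_comm, sphConv_scalingFunction hα hJ hf,
    l2Norm_finiteSynthesis_sq, ← Finset.sum_add_distrib]
  refine le_trans (Finset.sum_le_sum fun p _ => ?_) (sum_norm_harmonicCoeff_sq_le hf N)
  rw [← Finset.sum_mul, norm_mul, mul_pow, ← add_mul]
  have := sum_multiplier_sq_le hα hJ p.1
  refine mul_le_of_le_one_left (by positivity) ?_
  simpa using this

theorem l2Norm_mono {f g : S2 → ℂ} (hg : MemLp g 2 surfaceMeasure) (h : ∀ ω, ‖f ω‖ ≤ ‖g ω‖) :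
    l2Norm f ≤ l2Norm g :=
  ENNReal.toReal_mono hg.2.ne (eLpNorm_mono h)

theorem l2Norm_propagatorStep {α : ℝ} (j : ℕ) (f : S2 → ℂ) :
    l2Norm (propagatorStep α j f) = l2Norm (sphConv f (wavelet α j)) := by
  rw [l2Norm, l2Norm]
  congr 1
  refine eLpNorm_congr_norm_ae (.of_forall fun ω => ?_)
  simp [propagatorStep]

theorem sphConv_sub_wavelet {α : ℝ} (hα : 1 < α) (j : ℕ) {f g : S2 → ℂ}
    (hf : MemLp f 2 surfaceMeasure) (hg : MemLp g 2 surfaceMeasure) :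
    sphConv (f - g) (wavelet α j) = sphConv f (wavelet α j) - sphConv g (wavelet α j) := by
  rw [sphConv_wavelet hα le_rfl hf, sphConv_wavelet hα le_rfl hg,
    sphConv_wavelet hα le_rfl (hf.sub hg)]
  ext ω
  simp [finiteSynthesis, harmonicCoeff_sub hf hg, mul_sub, sub_mul, Finset.sum_sub_distrib]

theorem sphConv_sub_scalingFunction {α : ℝ} (hα : 1 < α) (J₀ : ℕ) {f g : S2 → ℂ}
    (hf : MemLp f 2 surfaceMeasure) (hg : MemLp g 2 surfaceMeasure) :
    sphConv (f - g) (scalingFunction α J₀) =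
      sphConv f (scalingFunction α J₀) - sphConv g (scalingFunction α J₀) := by
  rw [sphConv_scalingFunction hα le_rfl hf, sphConv_scalingFunction hα le_rfl hg,
    sphConv_scalingFunction hα le_rfl (hf.sub hg)]
  ext ω
  simp [finiteSynthesis, harmonicCoeff_sub hf hg, mul_sub, sub_mul, Finset.sum_sub_distrib]

theorem l2Norm_propagatorStep_sub_le {α : ℝ} (hα : 1 < α) (j : ℕ) {f g : S2 → ℂ}
    (hf : MemLp f 2 surfaceMeasure) (hg : MemLp g 2 surfaceMeasure) :
    l2Norm (propagatorStep α j f - propagatorStep α j g) ≤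
      l2Norm (sphConv (f - g) (wavelet α j)) := by
  refine l2Norm_mono (memLp_of_continuous (continuous_sphConv_wavelet hα j (hf.sub hg)))
    fun ω => ?_
  rw [sphConv_sub_wavelet hα j hf hg]
  simp only [propagatorStep, Pi.sub_apply]
  rw [← Complex.ofReal_sub, Complex.norm_real]
  exact abs_norm_sub_norm_le _ _

/-- The path set as a finite set. -/
def pathFinset (J₀ J D : ℕ) : Finset (List ℕ) := (pathSet_finite J₀ J D).toFinset

theorem mem_pathFinset {J₀ J D : ℕ} {p : List ℕ} :
    p ∈ pathFinset J₀ J D ↔ p.length ≤ D ∧ ∀ j ∈ p, J₀ ≤ j ∧ j ≤ J :=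
  Set.Finite.mem_toFinset _

theorem sum_pathSet {J₀ J D : ℕ} (G : List ℕ → ℝ) :
    ∑ p : pathSet J₀ J D, G p.1 = ∑ p ∈ pathFinset J₀ J D, G p :=
  (Finset.sum_subtype _ (fun _ => mem_pathFinset) G).symm

theorem sum_pathFinset_zero {J₀ J : ℕ} (G : List ℕ → ℝ) :
    ∑ p ∈ pathFinset J₀ J 0, G p = G [] := by
  have : pathFinset J₀ J 0 = {[]} := by
    ext p
    rw [mem_pathFinset, Finset.mem_singleton]
    constructor
    · intro h; exact List.length_eq_zero_iff.1 (by omega)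
    · rintro rfl; simp
  rw [this, Finset.sum_singleton]

theorem sum_pathFinset_succ {J₀ J D : ℕ} (G : List ℕ → ℝ) :
    ∑ p ∈ pathFinset J₀ J (D + 1), G p =
      G [] + ∑ j ∈ Finset.Icc J₀ J, ∑ p ∈ pathFinset J₀ J D, G (j :: p) := by
  have : pathFinset J₀ J (D + 1) = insert []
      ((Finset.Icc J₀ J ×ˢ pathFinset J₀ J D).image fun q => q.1 :: q.2) := by
    ext p
    rw [mem_pathFinset, Finset.mem_insert, Finset.mem_image]
    constructor
    · rcases p with _ | ⟨j, p⟩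
      · simp
      · rintro ⟨h1, h2⟩
        refine Or.inr ⟨(j, p), ?_, rfl⟩
        rw [Finset.mem_product, Finset.mem_Icc, mem_pathFinset]
        exact ⟨h2 j (by simp), by simpa using h1, fun i hi => h2 i (by simp [hi])⟩
    · rintro (rfl | ⟨⟨j, p⟩, h, rfl⟩)
      · simp
      · rw [Finset.mem_product, Finset.mem_Icc, mem_pathFinset] at h
        refine ⟨by simpa using h.2.1, fun i hi => ?_⟩
        rcases List.mem_cons.1 hi with rfl | hi
        · exact h.1
        · exact h.2.2 i hi
  rw [this, Finset.sum_insert (by simp), Finset.sum_image, Finset.sum_product]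
  rintro ⟨a, b⟩ _ ⟨c, d⟩ _ h
  simpa using h

/-- Each of the `D + 1` layers has total energy at most `‖f‖²`. The induction splits off the empty
path and the first scale of every other path. -/
theorem sum_l2Norm_propagator_sq_le {α : ℝ} (hα : 1 < α) {J₀ J : ℕ} (hJ : J₀ ≤ J) (D : ℕ)
    {f : S2 → ℂ} (hf : MemLp f 2 surfaceMeasure) :
    ∑ p ∈ pathFinset J₀ J D, l2Norm (propagator α p f) ^ 2 ≤ (D + 1) * l2Norm f ^ 2 := by
  induction D generalizing f with
  | zero =>
    rw [sum_pathFinset_zero]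
    simp [propagator]
  | succ D ih =>
    rw [sum_pathFinset_succ]
    simp only [propagator]
    have h1 : ∑ j ∈ Finset.Icc J₀ J, ∑ p ∈ pathFinset J₀ J D,
        l2Norm (propagator α p (propagatorStep α j f)) ^ 2 ≤
        ∑ j ∈ Finset.Icc J₀ J, (D + 1) * l2Norm (sphConv f (wavelet α j)) ^ 2 := by
      refine Finset.sum_le_sum fun j _ => ?_
      rw [← l2Norm_propagatorStep]
      exact ih (memLp_propagatorStep hα j hf)
    rw [← Finset.mul_sum] at h1
    have h2 := filterBank_energy_le hα hJ hf
    have h3 := sq_nonneg (l2Norm (sphConv f (scalingFunction α J₀)))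
    have h4 : ∑ j ∈ Finset.Icc J₀ J, l2Norm (sphConv f (wavelet α j)) ^ 2 ≤ l2Norm f ^ 2 := by
      linarith
    have h5 := mul_le_mul_of_nonneg_left h4 (show (0 : ℝ) ≤ D + 1 by positivity)
    push_cast
    linarith

/-- The scattering network is nonexpansive. -/
theorem sum_l2Norm_scatteringTransform_sub_sq_le {α : ℝ} (hα : 1 < α) {J₀ J : ℕ} (hJ : J₀ ≤ J)
    (D : ℕ) {f g : S2 → ℂ} (hf : MemLp f 2 surfaceMeasure) (hg : MemLp g 2 surfaceMeasure) :
    ∑ p ∈ pathFinset J₀ J D,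
      l2Norm (scatteringTransform α J₀ p f - scatteringTransform α J₀ p g) ^ 2 ≤
      l2Norm (f - g) ^ 2 := by
  have h2 := fun f g (hf : MemLp f 2 surfaceMeasure) (hg : MemLp g 2 surfaceMeasure) =>
    filterBank_energy_le hα hJ (hf.sub hg)
  induction D generalizing f g with
  | zero =>
    rw [sum_pathFinset_zero]
    simp only [scatteringTransform, propagator]
    rw [← sphConv_sub_scalingFunction hα J₀ hf hg]
    have := h2 f g hf hg
    have h3 : 0 ≤ ∑ j ∈ Finset.Icc J₀ J, l2Norm (sphConv (f - g) (wavelet α j)) ^ 2 :=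
      Finset.sum_nonneg fun _ _ => sq_nonneg _
    linarith
  | succ D ih =>
    rw [sum_pathFinset_succ]
    -- The paths starting with `j` together cost at most the energy of `(f - g) ⋆ ψ_j`, by induction
    -- and the contraction of the modulus. The empty path costs the energy of `(f - g) ⋆ Φ`, and the
    -- filter bank bounds the total with no factor depending on `D`.
    have h1 : ∑ j ∈ Finset.Icc J₀ J, ∑ p ∈ pathFinset J₀ J D,
        l2Norm (scatteringTransform α J₀ (j :: p) f - scatteringTransform α J₀ (j :: p) g) ^ 2 ≤
        ∑ j ∈ Finset.Icc J₀ J, l2Norm (sphConv (f - g) (wavelet α j)) ^ 2 := by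
      refine Finset.sum_le_sum fun j _ => ?_
      refine (ih (memLp_propagatorStep hα j hf) (memLp_propagatorStep hα j hg)).trans ?_
      exact pow_le_pow_left₀ (l2Norm_nonneg _) (l2Norm_propagatorStep_sub_le hα j hf hg) 2
    have := h2 f g hf hg
    have h3 : scatteringTransform α J₀ [] f - scatteringTransform α J₀ [] g =
        sphConv (f - g) (scalingFunction α J₀) :=
      (sphConv_sub_scalingFunction hα J₀ hf hg).symm
    rw [h3]
    linarith

/-! ### Isometries of the sphere -/

theorem norm_S2 (ω : S2) : ‖ω.1‖ = 1 := mem_sphere_zero_iff_norm.1 ω.2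

theorem cos_geodesicDist (x y : S2) : Real.cos (geodesicDist x y) = inner ℝ x.1 y.1 := by
  rw [geodesicDist, InnerProductGeometry.cos_angle, norm_S2, norm_S2]
  simp

/-- A chord is no longer than its arc: `‖x - y‖² = 2 - 2 cos d ≤ d²`. -/
theorem norm_sub_le_geodesicDist (x y : S2) : ‖x.1 - y.1‖ ≤ geodesicDist x y := by
  have h0 : 0 ≤ geodesicDist x y := InnerProductGeometry.angle_nonneg _ _
  refine abs_le_of_sq_le_sq' ?_ h0 |>.2
  have h1 := norm_sub_sq_real x.1 y.1
  rw [norm_S2, norm_S2, ← cos_geodesicDist] at h1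
  have h2 := Real.one_sub_sq_div_two_le_cos (x := geodesicDist x y)
  linarith

/-- Preserving distances means preserving inner products, so the images of the standard basis
vectors are orthonormal and `ζ ω` has in them the same coordinates as `ω` in the standard basis. -/
theorem exists_isomAct_of_isSphereIsometry {ζ : S2 ≃ S2} (h : IsSphereIsometry ζ) :
    ∃ A : EuclideanSpace ℝ (Fin 3) ≃ₗᵢ[ℝ] EuclideanSpace ℝ (Fin 3), ∀ ω, ζ ω = isomAct A ω := by
  have hin : ∀ x y, inner ℝ (ζ x).1 (ζ y).1 = inner ℝ x.1 y.1 := fun x y => by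
    rw [← cos_geodesicDist, ← cos_geodesicDist, h]
  let e : Fin 3 → S2 := fun i => ⟨EuclideanSpace.single i 1, by simp⟩
  have ho : Orthonormal ℝ (Set.univ.domRestrict fun i => (ζ (e i)).1) := by
    rw [orthonormal_iff_ite]
    rintro ⟨i, _⟩ ⟨j, _⟩
    simp only [Set.domRestrict_apply, hin, e, Subtype.mk.injEq]
    simp [EuclideanSpace.inner_single_left]
  obtain ⟨b, hb⟩ := ho.exists_orthonormalBasis_extension_of_card_eq (by simp)
  refine ⟨(EuclideanSpace.basisFun (Fin 3) ℝ).equiv b (Equiv.refl _), fun ω => Subtype.ext ?_⟩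
  have h1 : (isomAct ((EuclideanSpace.basisFun (Fin 3) ℝ).equiv b (Equiv.refl _)) ω).1 =
      ∑ i, ω.1 i • b i := by
    simp only [isomAct]
    rw [OrthonormalBasis.equiv_apply]
    simp
  rw [h1, ← b.sum_repr (ζ ω).1]
  refine Finset.sum_congr rfl fun i _ => ?_
  rw [b.repr_apply_apply]
  congr 1
  rw [hb i (Set.mem_univ _), hin]
  simp [e, EuclideanSpace.inner_single_left]

theorem toMatrix_isometry_apply
    (A : EuclideanSpace ℝ (Fin 3) ≃ₗᵢ[ℝ] EuclideanSpace ℝ (Fin 3))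
    (b : OrthonormalBasis (Fin 3) ℝ (EuclideanSpace ℝ (Fin 3))) (i j : Fin 3) :
    LinearMap.toMatrix b.toBasis b.toBasis A.toLinearEquiv.toLinearMap i j =
      inner ℝ (b i) (A (b j)) := by
  rw [LinearMap.toMatrix_apply, OrthonormalBasis.coe_toBasis,
    OrthonormalBasis.coe_toBasis_repr_apply, b.repr_apply_apply]
  rfl

theorem toMatrix_isometry_mul_transpose
    (A : EuclideanSpace ℝ (Fin 3) ≃ₗᵢ[ℝ] EuclideanSpace ℝ (Fin 3))
    (b : OrthonormalBasis (Fin 3) ℝ (EuclideanSpace ℝ (Fin 3))) :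
    (LinearMap.toMatrix b.toBasis b.toBasis A.toLinearEquiv.toLinearMap).transpose *
      LinearMap.toMatrix b.toBasis b.toBasis A.toLinearEquiv.toLinearMap = 1 := by
  ext i j
  rw [Matrix.mul_apply, Matrix.one_apply, ← orthonormal_iff_ite.1 b.orthonormal i j,
    ← A.inner_map_map, ← b.sum_inner_mul_inner (A (b i)) (A (b j))]
  refine Finset.sum_congr rfl fun k _ => ?_
  rw [Matrix.transpose_apply, toMatrix_isometry_apply, toMatrix_isometry_apply,
    real_inner_comm]

/-- The determinant `d = ±1` is itself an eigenvalue: `Mᵀ (M - d) = -d (M - d)ᵀ`, and taking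
determinants in odd dimension gives `d x = -d x` for `x = det (M - d)`. -/
theorem det_sub_det_smul_one {M : Matrix (Fin 3) (Fin 3) ℝ} (h : M.transpose * M = 1) :
    M.det * M.det = 1 ∧ (M - M.det • (1 : Matrix (Fin 3) (Fin 3) ℝ)).det = 0 := by
  have h1 : M.det * M.det = 1 := by
    have := congrArg Matrix.det h
    rwa [Matrix.det_mul, Matrix.det_transpose, Matrix.det_one] at this
  refine ⟨h1, ?_⟩
  set d := M.det with hd
  have h2 : M.transpose * (M - d • (1 : Matrix (Fin 3) (Fin 3) ℝ)) =
      (-d) • (M - d • (1 : Matrix (Fin 3) (Fin 3) ℝ)).transpose := by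
    rw [mul_sub, h, Matrix.transpose_sub, Matrix.transpose_smul, Matrix.transpose_one, smul_sub,
      smul_smul, neg_mul, h1]
    simp [sub_eq_add_neg, add_comm]
  have h3 := congrArg Matrix.det h2
  rw [Matrix.det_mul, Matrix.det_transpose, Matrix.det_smul, Matrix.det_transpose, ← hd] at h3
  simp only [Fintype.card_fin] at h3
  have h4 : d ^ 2 = 1 := by rw [sq]; exact h1
  have h5 : d ≠ 0 := fun h => by rw [h] at h1; simp at h1
  have h6 : (-d) ^ 3 = -d := by linear_combination (-d) * h4
  rw [h6] at h3
  have h7 : 2 * d * (M - d • (1 : Matrix (Fin 3) (Fin 3) ℝ)).det = 0 := by linarith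
  rcases mul_eq_zero.1 h7 with h8 | h8
  · exact absurd h8 (mul_ne_zero two_ne_zero h5)
  · exact h8

/-- An isometry of three-space either reverses a unit vector or is a rotation about an axis. -/
theorem exists_reversed_or_exists_rotation
    (A : EuclideanSpace ℝ (Fin 3) ≃ₗᵢ[ℝ] EuclideanSpace ℝ (Fin 3)) :
    (∃ ω : S2, (isomAct A ω).1 = -ω.1) ∨
    ∃ (Q B : EuclideanSpace ℝ (Fin 3) ≃ₗᵢ[ℝ] EuclideanSpace ℝ (Fin 3)) (u : ℂ) (ω₀ : S2),
      ‖u‖ = 1 ∧ ‖u - 1‖ = ‖ω₀.1 - (isomAct A ω₀).1‖ ∧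
      (∀ ω : S2, (isomAct B ω).1 2 = ω.1 2) ∧ (∀ ω, horiz (isomAct B ω) = u * horiz ω) ∧
      ∀ ω, isomAct A (isomAct Q ω) = isomAct Q (isomAct B ω) := by
  let b₀ := EuclideanSpace.basisFun (Fin 3) ℝ
  let a : EuclideanSpace ℝ (Fin 3) →ₗ[ℝ] EuclideanSpace ℝ (Fin 3) := A.toLinearEquiv.toLinearMap
  set d := LinearMap.det a with hd
  have hdM : ∀ b : OrthonormalBasis (Fin 3) ℝ (EuclideanSpace ℝ (Fin 3)),
      (LinearMap.toMatrix b.toBasis b.toBasis a).det = d := fun b => LinearMap.det_toMatrix _ _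
  obtain ⟨h1, h2⟩ := det_sub_det_smul_one (toMatrix_isometry_mul_transpose A b₀)
  change (LinearMap.toMatrix b₀.toBasis b₀.toBasis a).det * _ = _ at h1
  change (LinearMap.toMatrix b₀.toBasis b₀.toBasis a -
    (LinearMap.toMatrix b₀.toBasis b₀.toBasis a).det • _).det = 0 at h2
  rw [hdM] at h1 h2
  have h3 : LinearMap.det (a - d • LinearMap.id) = 0 := by
    rw [← LinearMap.det_toMatrix b₀.toBasis, map_sub, map_smul, LinearMap.toMatrix_id]
    exact h2
  obtain ⟨x, hx, hx0⟩ := (Submodule.ne_bot_iff _).1 (LinearMap.bot_lt_ker_of_det_eq_zero h3).ne'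
  have hxe : A x = d • x := by
    rw [LinearMap.mem_ker] at hx
    exact sub_eq_zero.1 hx
  have hn : ‖x‖ ≠ 0 := norm_ne_zero_iff.2 hx0
  let v : S2 := ⟨‖x‖⁻¹ • x, by simp [norm_smul, hn]⟩
  have hv : A v.1 = d • v.1 := by
    change A (‖x‖⁻¹ • x) = d • ‖x‖⁻¹ • x
    rw [map_smul, hxe, smul_comm]
  have hdd : d = -1 ∨ d = 1 := (mul_self_eq_one_iff.1 h1).symm
  rcases hdd with hneg | hpos
  -- Determinant `-1`: the unit eigenvector `v` is reversed. Otherwise `v` is fixed and becomes the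
  -- axis, placed third in an orthonormal basis `b`.
  · left
    refine ⟨v, ?_⟩
    change A v.1 = -v.1
    rw [hv, hneg, neg_one_smul]
  right
  rw [hpos, one_smul] at hv
  have ho : Orthonormal ℝ (({2} : Set (Fin 3)).domRestrict fun _ => v.1) := by
    rw [orthonormal_iff_ite]
    rintro ⟨i, hi⟩ ⟨j, hj⟩
    rw [Set.mem_singleton_iff] at hi hj
    subst hi
    subst hj
    simp only [Set.domRestrict_apply, if_true]
    rw [real_inner_self_eq_norm_sq, norm_S2, one_pow]
  obtain ⟨b, hb⟩ := ho.exists_orthonormalBasis_extension_of_card_eq (by simp)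
  have hb2 : b 2 = v.1 := hb 2 rfl
  have hAb : A (b 2) = b 2 := by rw [hb2, hv]
  set N := LinearMap.toMatrix b.toBasis b.toBasis a with hN
  have hNN : N.transpose * N = 1 := toMatrix_isometry_mul_transpose A b
  have hdet : N.det = 1 := by rw [hN, hdM b, hpos]
  have hNapp : ∀ i j, N i j = inner ℝ (b i) (A (b j)) := toMatrix_isometry_apply A b
  have hbo := orthonormal_iff_ite.1 b.orthonormal
  have c2 : ∀ i, N i 2 = if i = 2 then 1 else 0 := fun i => by rw [hNapp, hAb, hbo]
  have r2 : ∀ j, N 2 j = if 2 = j then 1 else 0 := fun j => by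
    rw [hNapp, ← hbo 2 j, ← A.inner_map_map (b 2) (b j), hAb]
  have e00 := congrFun (congrFun hNN 0) 0
  have e11 := congrFun (congrFun hNN 1) 1
  rw [Matrix.mul_apply, Fin.sum_univ_three] at e00 e11
  simp [r2] at e00 e11
  rw [Matrix.det_fin_three] at hdet
  simp [r2, c2] at hdet
  -- The left side is the sum of the squared norms of the first two columns minus twice the
  -- determinant, that is `1 + 1 - 2`. Its vanishing makes the upper block a plane rotation.
  have hsq : (N 1 1 - N 0 0) ^ 2 + (N 0 1 + N 1 0) ^ 2 = 0 := by
    linear_combination e00 + e11 - 2 * hdet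
  have s1 : N 1 1 = N 0 0 := by nlinarith [sq_nonneg (N 1 1 - N 0 0), sq_nonneg (N 0 1 + N 1 0)]
  have s2 : N 0 1 = -N 1 0 := by nlinarith [sq_nonneg (N 1 1 - N 0 0), sq_nonneg (N 0 1 + N 1 0)]
  let Q := b₀.equiv b (Equiv.refl _)
  let B := (Q.trans A).trans Q.symm
  have hQ : ∀ j, Q (b₀ j) = b j := fun j => by simp [Q]
  have hB : ∀ (ω : S2) (i : Fin 3), (isomAct B ω).1 i = ∑ j, N i j * ω.1 j := by
    intro ω i
    have e1 : (isomAct B ω).1 i = inner ℝ (b₀ i) (B ω.1) := by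
      simp [b₀, isomAct, EuclideanSpace.inner_single_left]
    have e2 : ω.1 = ∑ j, ω.1 j • b₀ j := by
      conv_lhs => rw [← b₀.sum_repr ω.1]
      simp [b₀]
    rw [e1, ← Q.inner_map_map, hQ]
    have e3 : Q (B ω.1) = A (Q ω.1) := Q.apply_symm_apply _
    rw [e3]
    conv_lhs => rw [e2]
    simp only [map_sum, map_smul, hQ, inner_sum, inner_smul_right, hNapp]
    exact Finset.sum_congr rfl fun j _ => mul_comm _ _
  -- The phase `u` is the first column of the plane rotation, and `b 0`, orthogonal to the axis, is
  -- moved by exactly `‖u - 1‖`.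
  refine ⟨Q, B, ⟨N 0 0, N 1 0⟩, ⟨b 0, by simp⟩, ?_, ?_, ?_, ?_, ?_⟩
  · rw [Complex.norm_def, Complex.normSq_mk, e00, Real.sqrt_one]
  · have k1 : ‖b 0 - A (b 0)‖ ^ 2 = 2 - 2 * N 0 0 := by
      rw [norm_sub_sq_real, A.norm_map, b.norm_eq_one, hNapp]; ring
    have k2 : ‖(⟨N 0 0, N 1 0⟩ : ℂ) - 1‖ ^ 2 = 2 - 2 * N 0 0 := by
      rw [← Complex.normSq_eq_norm_sq, Complex.normSq_apply]
      simp
      linear_combination e00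
    exact (sq_eq_sq₀ (norm_nonneg _) (norm_nonneg _)).1 (k2.trans k1.symm)
  · intro ω
    rw [hB, Fin.sum_univ_three]
    simp [r2]
  · intro ω
    rw [horiz, hB, hB, Fin.sum_univ_three, Fin.sum_univ_three, s1, s2]
    simp only [c2]
    apply Complex.ext <;> simp [horiz] <;> ring
  · intro ω
    apply Subtype.ext
    change A (Q ω.1) = Q (B ω.1)
    exact (Q.apply_symm_apply _).symm

/-! ### Equivariance and the effect of isometries -/

/-- Each convolution commutes with isometries and the modulus acts pointwise. -/
theorem scatteringTransform_isomAct {α : ℝ} (hα : 1 < α) (J₀ : ℕ) (p : List ℕ) (f : S2 → ℂ)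
    (A : EuclideanSpace ℝ (Fin 3) ≃ₗᵢ[ℝ] EuclideanSpace ℝ (Fin 3)) (ω : S2) :
    scatteringTransform α J₀ p (fun η => f (isomAct A η)) ω =
      scatteringTransform α J₀ p f (isomAct A ω) := by
  have h : ∀ (p : List ℕ) (f : S2 → ℂ), propagator α p (fun η => f (isomAct A η)) =
      fun η => propagator α p f (isomAct A η) := by
    intro p
    induction p with
    | nil => intro f; rfl
    | cons j p ih =>
      intro f
      rw [propagator, propagator, ← ih]
      congr 1
      ext ω
      simp only [propagatorStep]
      have := sphConv_isomAct A (fun _ h => ceil_pow_waveletMultiplier hα (le_refl j) h) f ω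
      rw [show wavelet α j = harmonicSynthesis (filterCoeff (waveletMultiplier α j)) from rfl, this]
  rw [scatteringTransform, h]
  exact sphConv_isomAct A (fun _ h => ceil_pow_multiplier hα (le_refl J₀) h) _ ω

theorem l2Norm_comp_isomAct (A : EuclideanSpace ℝ (Fin 3) ≃ₗᵢ[ℝ] EuclideanSpace ℝ (Fin 3))
    {f : S2 → ℂ} (hf : AEStronglyMeasurable f surfaceMeasure) :
    l2Norm (fun ω => f (isomAct A ω)) = l2Norm f := by
  rw [l2Norm, l2Norm]
  congr 1
  exact eLpNorm_comp_measurePreserving hf (measurePreserving_isomAct A)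

theorem memLp_comp_isomAct (A : EuclideanSpace ℝ (Fin 3) ≃ₗᵢ[ℝ] EuclideanSpace ℝ (Fin 3))
    {f : S2 → ℂ} (hf : MemLp f 2 surfaceMeasure) :
    MemLp (fun ω => f (isomAct A ω)) 2 surfaceMeasure :=
  hf.comp_measurePreserving (measurePreserving_isomAct A)

theorem norm_one_sub_zpow_le {u : ℂ} (hu : ‖u‖ = 1) (m : ℤ) : ‖1 - u ^ m‖ ≤ |m| * ‖u - 1‖ := by
  have hu0 : u ≠ 0 := fun h => by rw [h] at hu; simp at hu
  have hnat : ∀ n : ℕ, ‖1 - u ^ n‖ ≤ n * ‖u - 1‖ := by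
    intro n
    induction n with
    | zero => simp
    | succ n ih =>
      have : 1 - u ^ (n + 1) = (1 - u ^ n) - u ^ n * (u - 1) := by ring
      rw [this]
      refine (norm_sub_le _ _).trans ?_
      rw [norm_mul, norm_pow, hu, one_pow, one_mul]
      push_cast
      linarith
  obtain ⟨n, rfl | rfl⟩ := m.eq_nat_or_neg
  · simpa using hnat n
  · have : 1 - u ^ (-(n : ℤ)) = -(u ^ (-(n : ℤ)) * (1 - u ^ n)) := by
      rw [zpow_neg, zpow_natCast]
      field_simp
      ring
    rw [this, norm_neg, norm_mul, norm_zpow, hu, one_zpow, one_mul]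
    simpa using hnat n

/-- The difference has coefficients multiplied by `1 - u ^ m`, at most `|m| ‖u - 1‖` in size. Since
`Φ` kills all degrees `l ≥ α ^ J₀`, only `|m| ≤ l < α ^ J₀` contributes. -/
theorem l2Norm_sphConv_sub_rotate_le {α : ℝ} (hα : 1 < α) (J₀ : ℕ) {g : S2 → ℂ}
    (hg : MemLp g 2 surfaceMeasure)
    {B : EuclideanSpace ℝ (Fin 3) ≃ₗᵢ[ℝ] EuclideanSpace ℝ (Fin 3)}
    {u : ℂ} (hu : ‖u‖ = 1) (h2 : ∀ ω : S2, (isomAct B ω).1 2 = ω.1 2)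
    (hw : ∀ ω, horiz (isomAct B ω) = u * horiz ω) :
    l2Norm (sphConv g (scalingFunction α J₀) -
      fun ω => sphConv g (scalingFunction α J₀) (isomAct B ω)) ≤
      α ^ J₀ * ‖u - 1‖ * l2Norm g := by
  have h0 : 0 < α ^ J₀ := pow_pos (by linarith) _
  rw [sphConv_scalingFunction hα le_rfl hg]
  set N := ⌈α ^ (J₀ + 1)⌉₊
  have e : (finiteSynthesis N (fun l m => (scalingMultiplier α J₀ l : ℂ) * harmonicCoeff g l m) -
      fun ω => finiteSynthesis N
        (fun l m => (scalingMultiplier α J₀ l : ℂ) * harmonicCoeff g l m) (isomAct B ω)) =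
      finiteSynthesis N (fun l m => (1 - u ^ m) *
        ((scalingMultiplier α J₀ l : ℂ) * harmonicCoeff g l m)) := by
    ext ω
    simp only [Pi.sub_apply, finiteSynthesis, ← Finset.sum_sub_distrib]
    refine Finset.sum_congr rfl fun p _ => ?_
    rw [sphericalHarmonic_rotate hu h2 hw]
    ring
  rw [e]
  refine abs_le_of_sq_le_sq' ?_ (by have := l2Norm_nonneg g; positivity) |>.2
  rw [l2Norm_finiteSynthesis_sq, mul_pow]
  refine le_trans ?_ (mul_le_mul_of_nonneg_left (sum_norm_harmonicCoeff_sq_le hg N) (sq_nonneg _))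
  rw [Finset.mul_sum]
  refine Finset.sum_le_sum fun p hp => ?_
  rw [norm_mul, norm_mul, ← mul_assoc, mul_pow]
  refine mul_le_mul_of_nonneg_right ?_ (sq_nonneg _)
  refine pow_le_pow_left₀ (by positivity) ?_ 2
  have hs0 : 0 ≤ scalingMultiplier α J₀ p.1 := Real.sqrt_nonneg _
  rw [Complex.norm_real, Real.norm_of_nonneg hs0]
  by_cases hl : α ^ J₀ ≤ p.1
  · rw [scalingMultiplier_eq_zero hα hl, mul_zero]
    positivity
  · have hs1 : scalingMultiplier α J₀ p.1 ≤ 1 := Real.sqrt_le_one.2 (kFun_le_one hα _)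
    have hm : ((|p.2| : ℤ) : ℝ) ≤ p.1 := by exact_mod_cast (mem_degIdx.1 hp).2
    calc ‖1 - u ^ p.2‖ * scalingMultiplier α J₀ p.1 ≤ ‖1 - u ^ p.2‖ * 1 := by gcongr
      _ ≤ |p.2| * ‖u - 1‖ := by rw [mul_one]; exact norm_one_sub_zpow_le hu _
      _ ≤ α ^ J₀ * ‖u - 1‖ := by
        refine mul_le_mul_of_nonneg_right ?_ (norm_nonneg _)
        push Not at hl
        linarith

theorem l2Norm_sub_le {f g : S2 → ℂ} (hf : MemLp f 2 surfaceMeasure)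
    (hg : MemLp g 2 surfaceMeasure) : l2Norm (f - g) ≤ l2Norm f + l2Norm g := by
  rw [l2Norm_eq_norm hf, l2Norm_eq_norm hg, l2Norm_eq_norm (hf.sub hg), MemLp.toLp_sub]
  exact norm_sub_le _ _

/-- A bandlimited signal moves under an isometry by at most bandlimit times displacement. -/
theorem l2Norm_sphConv_sub_isomAct_le {α : ℝ} (hα : 1 < α) (J₀ : ℕ) {g : S2 → ℂ}
    (hg : MemLp g 2 surfaceMeasure)
    (A : EuclideanSpace ℝ (Fin 3) ≃ₗᵢ[ℝ] EuclideanSpace ℝ (Fin 3)) {δ : ℝ}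
    (hδ : ∀ ω, geodesicDist ω (isomAct A ω) ≤ δ) :
    l2Norm (sphConv g (scalingFunction α J₀) -
      fun ω => sphConv g (scalingFunction α J₀) (isomAct A ω)) ≤ α ^ J₀ * δ * l2Norm g := by
  have hc := continuous_sphConv_scalingFunction hα J₀ hg
  have h1 : 1 ≤ α ^ J₀ := one_le_pow₀ hα.le
  have hg0 := l2Norm_nonneg g
  rcases exists_reversed_or_exists_rotation A with ⟨ω, hω⟩ | ⟨Q, B, u, ω₀, hu, hu1, h2, hw, hQ⟩
  -- A reversed unit vector moves by at least its chord, 2, so the trivial bound `2 ‖g‖` is enough.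
  · have hπ : 2 ≤ δ := by
      have h3 := norm_sub_le_geodesicDist ω (isomAct A ω)
      rw [hω, sub_neg_eq_add, ← two_smul ℝ, norm_smul, norm_S2] at h3
      have h4 := hδ ω
      norm_num at h3
      linarith
    have h3 : l2Norm (sphConv g (scalingFunction α J₀)) ≤ l2Norm g := by
      refine abs_le_of_sq_le_sq' ?_ hg0 |>.2
      have := filterBank_energy_le hα (le_refl J₀) hg
      have h4 : 0 ≤ ∑ j ∈ Finset.Icc J₀ J₀, l2Norm (sphConv g (wavelet α j)) ^ 2 :=
        Finset.sum_nonneg fun _ _ => sq_nonneg _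
      linarith
    refine (l2Norm_sub_le (memLp_of_continuous hc)
      (memLp_comp_isomAct A (memLp_of_continuous hc))).trans ?_
    rw [l2Norm_comp_isomAct A hc.aestronglyMeasurable]
    have h5 : 2 ≤ α ^ J₀ * δ := by nlinarith
    nlinarith
  -- Conjugation by `Q` turns `A` into the rotation `B` about the third axis; equivariance and
  -- invariance of the norm replace `g` by `g ∘ Q`.
  · have hcA : Continuous fun ω => sphConv g (scalingFunction α J₀) (isomAct A ω) :=
      hc.comp (continuous_isomAct A)
    rw [← l2Norm_comp_isomAct Q (hc.sub hcA).aestronglyMeasurable]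
    have e : (fun ω => (sphConv g (scalingFunction α J₀) -
        fun ω => sphConv g (scalingFunction α J₀) (isomAct A ω)) (isomAct Q ω)) =
        sphConv (fun η => g (isomAct Q η)) (scalingFunction α J₀) -
        fun ω => sphConv (fun η => g (isomAct Q η)) (scalingFunction α J₀) (isomAct B ω) := by
      have hcomm : ∀ ω, sphConv (fun η => g (isomAct Q η)) (scalingFunction α J₀) ω =
          sphConv g (scalingFunction α J₀) (isomAct Q ω) := fun ω =>
        sphConv_isomAct Q (fun _ h => ceil_pow_multiplier hα (le_refl J₀) h) g ω
      ext ω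
      simp only [Pi.sub_apply, hcomm, hQ]
    have h3 := l2Norm_sphConv_sub_rotate_le hα J₀ (memLp_comp_isomAct Q hg) hu h2 hw
    rw [l2Norm_comp_isomAct Q hg.1] at h3
    refine (le_of_eq (congrArg l2Norm e)).trans (h3.trans ?_)
    have h4 : ‖u - 1‖ ≤ δ := by
      rw [hu1]; exact (norm_sub_le_geodesicDist _ _).trans (hδ _)
    gcongr

/-! ### Diffeomorphisms preserve null sets -/

/-- The radial projection to the sphere (with an arbitrary value at the origin). -/
def radialProj (x : EuclideanSpace ℝ (Fin 3)) : S2 :=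
  if h : x = 0 then northPole else ⟨‖x‖⁻¹ • x, by simp [norm_smul, norm_ne_zero_iff.2 h]⟩

theorem coe_radialProj {x : EuclideanSpace ℝ (Fin 3)} (h : x ≠ 0) :
    (radialProj x).1 = ‖x‖⁻¹ • x := by
  simp [radialProj, h]

theorem radialProj_smul {r : ℝ} (hr : 0 < r) (ω : S2) : radialProj (r • ω.1) = ω := by
  have h : r • ω.1 ≠ 0 := smul_ne_zero hr.ne' (norm_ne_zero_iff.1 (by rw [norm_S2]; simp))
  apply Subtype.ext
  rw [coe_radialProj h, norm_smul, norm_S2, mul_one, Real.norm_of_nonneg hr.le, smul_smul,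
    inv_mul_cancel₀ hr.ne', one_smul]

theorem coe_radialProj_eventuallyEq {x : EuclideanSpace ℝ (Fin 3)} (h : x ≠ 0) :
    (fun y => (radialProj y).1) =ᶠ[nhds x] fun y => ‖y‖⁻¹ • y := by
  filter_upwards [isOpen_compl_singleton.mem_nhds (show x ∈ ({0}ᶜ : Set _) from h)] with y hy
  exact coe_radialProj hy

theorem differentiableAt_coe_radialProj {x : EuclideanSpace ℝ (Fin 3)} (h : x ≠ 0) :
    DifferentiableAt ℝ (fun y => (radialProj y).1) x := by
  refine DifferentiableAt.congr_of_eventuallyEq ?_ (coe_radialProj_eventuallyEq h)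
  exact ((differentiableAt_id.norm ℝ h).inv (norm_ne_zero_iff.2 h)).smul differentiableAt_id

open scoped Manifold in
theorem mdifferentiableAt_radialProj {x : EuclideanSpace ℝ (Fin 3)} (h : x ≠ 0) :
    MDifferentiableAt 𝓘(ℝ, EuclideanSpace ℝ (Fin 3)) (𝓡 2) radialProj x := by
  rw [mdifferentiableAt_iff_target]
  have hd := differentiableAt_coe_radialProj h
  refine ⟨Topology.IsInducing.subtypeVal.continuousAt_iff.2 hd.continuousAt, ?_⟩
  rw [mdifferentiableAt_iff_differentiableAt]
  let v := radialProj x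
  let U : _ ≃ₗᵢ[ℝ] _ :=
    (OrthonormalBasis.fromOrthogonalSpanSingleton (𝕜 := ℝ)
      2 (ne_zero_of_mem_unit_sphere (-v))).repr
  have h1 : DifferentiableAt ℝ (stereoToFun (-v).1) (radialProj x).1 := by
    refine ((contDiffOn_stereoToFun (n := 1)).contDiffAt ?_).differentiableAt one_ne_zero
    -- The chart at `v` is stereographic projection from `-v`, which is smooth at `v` because `⟨-v,
    -- v⟩ = -1 ≠ 1`.
    refine IsOpen.mem_nhds (isOpen_ne_fun (by fun_prop) continuous_const) ?_
    change inner ℝ (-v.1) v.1 ≠ 1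
    rw [inner_neg_left, real_inner_self_eq_norm_sq, norm_S2]
    norm_num
  have h2 : DifferentiableAt ℝ (fun y => U (stereoToFun (-v).1 (radialProj y).1)) x :=
    (U.differentiable _).comp x
      (DifferentiableAt.comp (g := stereoToFun (-v).1) (f := fun y => (radialProj y).1) x h1 hd)
  exact h2

/-- The positively homogeneous extension of a map of the sphere. -/
def homogeneousExtension (ζ : S2 → S2) (x : EuclideanSpace ℝ (Fin 3)) :
    EuclideanSpace ℝ (Fin 3) := ‖x‖ • (ζ (radialProj x)).1

open scoped Manifold in
theorem differentiableAt_homogeneousExtension {ζ : S2 → S2}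
    (hζ : MDifferentiable (𝓡 2) (𝓡 2) ζ) {x : EuclideanSpace ℝ (Fin 3)} (h : x ≠ 0) :
    DifferentiableAt ℝ (homogeneousExtension ζ) x := by
  refine (differentiableAt_id.norm ℝ h).smul ?_
  rw [← mdifferentiableAt_iff_differentiableAt]
  have h1 : MDifferentiableAt (𝓡 2) 𝓘(ℝ, EuclideanSpace ℝ (Fin 3))
      (Subtype.val : S2 → EuclideanSpace ℝ (Fin 3)) (ζ (radialProj x)) :=
    (contMDiff_coe_sphere (m := 1) (n := 2)).contMDiffAt.mdifferentiableAt one_ne_zero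
  exact h1.comp x ((hζ _).comp x (mdifferentiableAt_radialProj h))

open scoped Pointwise in
-- The cone over `ζ '' t` is the image of the cone over `t` under the homogeneous extension, which
-- is differentiable off the origin. Differentiable maps between spaces of equal dimension send null
-- sets to null sets, with no continuity of the derivative needed.
theorem measure_image_eq_zero_of_isSphereDiffeo {ζ : S2 ≃ S2} (hζ : IsSphereDiffeo ζ) {s : Set S2}
    (hs : surfaceMeasure s = 0) : surfaceMeasure (ζ '' s) = 0 := by
  obtain ⟨t, hst, htm, ht⟩ := exists_measurable_superset_of_null hs
  refine measure_mono_null (Set.image_mono hst) ?_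
  have him : MeasurableSet (ζ '' t) := by
    rw [Equiv.image_eq_preimage_symm]
    exact hζ.2.continuous.measurable htm
  rw [surfaceMeasure, Measure.toSphere_apply' _ htm] at ht
  rw [surfaceMeasure, Measure.toSphere_apply' _ him]
  have h3 : (Module.finrank ℝ (EuclideanSpace ℝ (Fin 3)) : ENNReal) ≠ 0 := by simp
  have ht0 := (mul_eq_zero.1 ht).resolve_left h3
  have hne : ∀ x ∈ Set.Ioo (0 : ℝ) 1 • ((Subtype.val : S2 → EuclideanSpace ℝ (Fin 3)) '' t),
      x ≠ 0 := by
    rintro _ ⟨r, hr, _, ⟨ω, _, rfl⟩, rfl⟩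
    exact smul_ne_zero hr.1.ne' (norm_ne_zero_iff.1 (by rw [norm_S2]; simp))
  have hF := addHaar_image_eq_zero_of_differentiableOn_of_addHaar_eq_zero volume
    (f := homogeneousExtension ζ) (fun x hx =>
      (differentiableAt_homogeneousExtension hζ.1 (hne x hx)).differentiableWithinAt) ht0
  refine mul_eq_zero.2 (Or.inr (measure_mono_null ?_ hF))
  rintro _ ⟨r, hr, _, ⟨_, ⟨ω, hω, rfl⟩, rfl⟩, rfl⟩
  refine ⟨r • ω.1, ⟨r, hr, _, ⟨ω, hω, rfl⟩, rfl⟩, ?_⟩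
  rw [homogeneousExtension, radialProj_smul hr.1, norm_smul, norm_S2, mul_one,
    Real.norm_of_nonneg hr.1.le]

theorem quasiMeasurePreserving_symm_of_isSphereDiffeo {ζ : S2 ≃ S2} (hζ : IsSphereDiffeo ζ) :
    Measure.QuasiMeasurePreserving ζ.symm surfaceMeasure surfaceMeasure := by
  refine ⟨hζ.2.continuous.measurable, Measure.AbsolutelyContinuous.mk fun s hs h => ?_⟩
  rw [Measure.map_apply hζ.2.continuous.measurable hs, ← Equiv.image_eq_preimage_symm]
  exact measure_image_eq_zero_of_isSphereDiffeo hζ h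

/-! ### Lipschitz bound for bandlimited signals -/

/-- Expand the square and apply the addition theorem to each of the four sums. Both signs `c = ±1`
give `|P_l| ≤ 1`, and `c = -1` gives the Lipschitz estimate. -/
theorem sum_sphericalHarmonic_add_smul_sq (l : ℕ) (ω η : S2) (c : ℝ) (hc : c ^ 2 = 1) :
    ∑ m ∈ Finset.Icc (-(l : ℤ)) (l : ℤ),
      ‖sphericalHarmonic l m ω + c * sphericalHarmonic l m η‖ ^ 2 =
      2 * (2 * l + 1) / (4 * Real.pi) * (1 + c * (legendre l).eval (inner ℝ ω.1 η.1)) := by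
  apply Complex.ofReal_injective
  have h1 : ∀ m, ((‖sphericalHarmonic l m ω + c * sphericalHarmonic l m η‖ ^ 2 : ℝ) : ℂ) =
      sphericalHarmonic l m ω * (starRingEnd ℂ) (sphericalHarmonic l m ω) +
      sphericalHarmonic l m η * (starRingEnd ℂ) (sphericalHarmonic l m η) +
      c * (sphericalHarmonic l m ω * (starRingEnd ℂ) (sphericalHarmonic l m η)) +
      c * (sphericalHarmonic l m η * (starRingEnd ℂ) (sphericalHarmonic l m ω)) := by
    intro m
    rw [← Complex.normSq_eq_norm_sq, ← Complex.mul_conj]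
    simp only [map_add, map_mul, Complex.conj_ofReal]
    have : (c : ℂ) ^ 2 = 1 := by exact_mod_cast hc
    linear_combination (sphericalHarmonic l m η * (starRingEnd ℂ) (sphericalHarmonic l m η)) * this
  rw [Complex.ofReal_sum]
  simp only [h1, Finset.sum_add_distrib, ← Finset.mul_sum]
  change zonalKernel l ω ω + zonalKernel l η η + c * zonalKernel l ω η + c * zonalKernel l η ω = _
  simp only [zonalKernel_eq]
  rw [real_inner_comm ω.1 η.1, real_inner_self_eq_norm_sq, real_inner_self_eq_norm_sq, norm_S2, norm_S2,
    one_pow, legendre_eval_one]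
  push_cast
  ring

/-- For two points with inner product `t`, the sums of squares for `c = 1` and `c = -1` are
nonnegative, so `1 ± P_l(t) ≥ 0`. -/
theorem abs_legendre_le_one (l : ℕ) : ∀ t ∈ Set.Icc (-1 : ℝ) 1, |(legendre l).eval t| ≤ 1 := by
  intro t ht
  have h0 : 0 ≤ 1 - t ^ 2 := by nlinarith [ht.1, ht.2]
  let η : S2 := ⟨!₂[Real.sqrt (1 - t ^ 2), 0, t], by
    rw [mem_sphere_zero_iff_norm, EuclideanSpace.norm_eq, Fin.sum_univ_three]
    simp [Real.sq_sqrt h0]⟩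
  have hη : inner ℝ η.1 northPole.1 = t := by
    rw [inner_northPole]; simp [η]
  have hpos : (0 : ℝ) < 2 * (2 * l + 1) / (4 * Real.pi) := by
    have := Real.pi_pos; positivity
  have h1 := sum_sphericalHarmonic_add_smul_sq l η northPole 1 (by norm_num)
  have h2 := sum_sphericalHarmonic_add_smul_sq l η northPole (-1) (by norm_num)
  rw [hη] at h1 h2
  have h3 : 0 ≤ 2 * (2 * l + 1) / (4 * Real.pi) * (1 + 1 * (legendre l).eval t) := by
    rw [← h1]; exact Finset.sum_nonneg fun _ _ => sq_nonneg _
  have h4 : 0 ≤ 2 * (2 * l + 1) / (4 * Real.pi) * (1 + -1 * (legendre l).eval t) := by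
    rw [← h2]; exact Finset.sum_nonneg fun _ _ => sq_nonneg _
  have h5 := nonneg_of_mul_nonneg_right h3 hpos
  have h6 := nonneg_of_mul_nonneg_right h4 hpos
  rw [abs_le]
  constructor <;> linarith

theorem sum_norm_sphericalHarmonic_sub_sq_le {L l : ℕ} (hl : l < L) (ω η : S2) :
    ∑ m ∈ Finset.Icc (-(l : ℤ)) (l : ℤ), ‖sphericalHarmonic l m ω - sphericalHarmonic l m η‖ ^ 2 ≤
      (L : ℝ) ^ 3 * geodesicDist ω η ^ 2 := by
  have h1 := sum_sphericalHarmonic_add_smul_sq l ω η (-1) (by norm_num)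
  simp only [Complex.ofReal_neg, Complex.ofReal_one, neg_mul, one_mul, ← sub_eq_add_neg] at h1
  rw [h1]
  have hin : inner ℝ ω.1 η.1 ∈ Set.Icc (-1 : ℝ) 1 := by
    have := abs_real_inner_le_norm ω.1 η.1
    rw [norm_S2, norm_S2, one_mul] at this
    exact abs_le.1 this
  have h2 := one_sub_legendre_le (abs_legendre_le_one l) hin
  have h3 : 1 - inner ℝ ω.1 η.1 ≤ geodesicDist ω η ^ 2 / 2 := by
    have := Real.one_sub_sq_div_two_le_cos (x := geodesicDist ω η)
    rw [cos_geodesicDist] at this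
    linarith
  have hL : (l : ℝ) + 1 ≤ L := by exact_mod_cast hl
  have hl0 : (0 : ℝ) ≤ l := Nat.cast_nonneg l
  have hd := sq_nonneg (geodesicDist ω η)
  have hq : (l : ℝ) * (l + 1) + 2 ≤ 3 * L ^ 2 := by nlinarith
  have h4 : 1 - (legendre l).eval (inner ℝ ω.1 η.1) ≤ 3 * L ^ 2 * (geodesicDist ω η ^ 2 / 2) :=
    h2.trans (mul_le_mul hq h3 (by linarith [hin.2]) (by positivity))
  have hpi := Real.pi_gt_three
  have h5 : 2 * (2 * (l : ℝ) + 1) / (4 * Real.pi) ≤ L / 3 := by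
    rw [div_le_div_iff₀ (by positivity) (by norm_num)]
    nlinarith
  have h6 : 0 ≤ 1 - (legendre l).eval (inner ℝ ω.1 η.1) := by
    linarith [(abs_le.1 (abs_legendre_le_one l _ hin)).2]
  calc _ ≤ (L : ℝ) / 3 * (3 * L ^ 2 * (geodesicDist ω η ^ 2 / 2)) :=
        mul_le_mul h5 h4 h6 (by positivity)
    _ = (L : ℝ) ^ 3 * geodesicDist ω η ^ 2 / 2 := by ring
    _ ≤ _ := half_le_self (by positivity)

/-- Cauchy–Schwarz against the coefficients: each of the `L` degrees contributes at most `L³ d²`, so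
the harmonic factor is at most `√(L⁴ d²) = L² d`. -/
theorem norm_finiteSynthesis_sub_le {L : ℕ} {f : S2 → ℂ} (hf : MemLp f 2 surfaceMeasure)
    (ω η : S2) :
    ‖finiteSynthesis L (harmonicCoeff f) ω - finiteSynthesis L (harmonicCoeff f) η‖ ≤
      (L : ℝ) ^ 2 * geodesicDist ω η * l2Norm f := by
  have hd : 0 ≤ geodesicDist ω η := InnerProductGeometry.angle_nonneg _ _
  have hf0 := l2Norm_nonneg f
  refine abs_le_of_sq_le_sq' ?_ (by positivity) |>.2
  have e : ‖finiteSynthesis L (harmonicCoeff f) ω - finiteSynthesis L (harmonicCoeff f) η‖ ≤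
      ∑ p ∈ degIdx L, ‖harmonicCoeff f p.1 p.2‖ *
        ‖sphericalHarmonic p.1 p.2 ω - sphericalHarmonic p.1 p.2 η‖ := by
    simp only [finiteSynthesis, ← Finset.sum_sub_distrib, ← mul_sub]
    refine (norm_sum_le _ _).trans (le_of_eq ?_)
    simp only [norm_mul]
  have h1 := Finset.sum_mul_sq_le_sq_mul_sq (degIdx L) (fun p => ‖harmonicCoeff f p.1 p.2‖)
    (fun p => ‖sphericalHarmonic p.1 p.2 ω - sphericalHarmonic p.1 p.2 η‖)
  have h2 := sum_norm_harmonicCoeff_sq_le hf L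
  have h3 : ∑ p ∈ degIdx L, ‖sphericalHarmonic p.1 p.2 ω - sphericalHarmonic p.1 p.2 η‖ ^ 2 ≤
      (L : ℝ) ^ 4 * geodesicDist ω η ^ 2 := by
    rw [sum_degIdx L (fun l m => ‖sphericalHarmonic l m ω - sphericalHarmonic l m η‖ ^ 2)]
    refine (Finset.sum_le_sum fun l hl =>
      sum_norm_sphericalHarmonic_sub_sq_le (Finset.mem_range.1 hl) ω η).trans (le_of_eq ?_)
    rw [Finset.sum_const, Finset.card_range, nsmul_eq_mul]
    ring
  calc _ ≤ _ := pow_le_pow_left₀ (norm_nonneg _) e 2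
    _ ≤ _ := h1
    _ ≤ l2Norm f ^ 2 * ((L : ℝ) ^ 4 * geodesicDist ω η ^ 2) :=
      mul_le_mul h2 h3 (Finset.sum_nonneg fun _ _ => sq_nonneg _) (sq_nonneg _)
    _ = _ := by ring

theorem surfaceMeasure_univ : surfaceMeasure Set.univ = ENNReal.ofReal (4 * Real.pi) := by
  have h := integral_coord_pow_even 0
  simp only [mul_zero, pow_zero, integral_const, smul_eq_mul, mul_one, CharP.cast_eq_zero,
    zero_add, div_one] at h
  rw [← h, Measure.real, ENNReal.ofReal_toReal (measure_ne_top _ _)]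

/-- The square root of the total mass is `√(4π) ≤ 4`. -/
theorem l2Norm_le_of_bound {f : S2 → ℂ} {C : ℝ} (hC : 0 ≤ C) (h : ∀ ω, ‖f ω‖ ≤ C) :
    l2Norm f ≤ 4 * C := by
  have h1 := eLpNorm_le_of_ae_bound (p := 2) (μ := surfaceMeasure) (Filter.Eventually.of_forall h)
  have h2 := ENNReal.toReal_mono (by
    refine ENNReal.mul_ne_top (ENNReal.rpow_ne_top_of_nonneg (by simp) (measure_ne_top _ _)) ?_
    exact ENNReal.ofReal_ne_top) h1
  refine h2.trans ?_
  have hpi := Real.pi_pos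
  rw [ENNReal.toReal_mul, ENNReal.toReal_ofReal hC, surfaceMeasure_univ, ← ENNReal.toReal_rpow,
    ENNReal.toReal_ofReal (by positivity)]
  refine mul_le_mul_of_nonneg_right ?_ hC
  have h3 : (2 : ENNReal).toReal⁻¹ = 1 / 2 := by norm_num
  rw [h3, ← Real.sqrt_eq_rpow, Real.sqrt_le_left (by norm_num)]
  nlinarith [Real.pi_le_four]

/-! ### Displacement and deformation of bandlimited signals -/

theorem bddAbove_displacement (ζ : S2 ≃ S2) :
    BddAbove (Set.range fun ω => geodesicDist ω (ζ ω)) :=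
  ⟨Real.pi, by rintro _ ⟨ω, rfl⟩; exact InnerProductGeometry.angle_le_pi _ _⟩

theorem geodesicDist_le_maxDisplacement (ζ : S2 ≃ S2) (ω : S2) :
    geodesicDist ω (ζ ω) ≤ maxDisplacement ζ := le_ciSup (bddAbove_displacement ζ) ω

theorem geodesicDist_symm_le_maxDisplacement (ζ : S2 ≃ S2) (ω : S2) :
    geodesicDist ω (ζ.symm ω) ≤ maxDisplacement ζ := by
  have := geodesicDist_le_maxDisplacement ζ (ζ.symm ω)
  rwa [Equiv.apply_symm_apply, geodesicDist, InnerProductGeometry.angle_comm] at this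

theorem maxDisplacement_nonneg (ζ : S2 ≃ S2) : 0 ≤ maxDisplacement ζ :=
  (InnerProductGeometry.angle_nonneg _ _).trans (geodesicDist_le_maxDisplacement ζ northPole)

theorem deform_ae_eq {ζ : S2 ≃ S2} (hζ : IsSphereDiffeo ζ) {f g : S2 → ℂ}
    (h : f =ᵐ[surfaceMeasure] g) : deform ζ f =ᵐ[surfaceMeasure] deform ζ g :=
  (quasiMeasurePreserving_symm_of_isSphereDiffeo hζ).ae_eq_comp h

theorem memLp_deform {ζ : S2 ≃ S2} (hζ : IsSphereDiffeo ζ) {L : ℕ} {f : S2 → ℂ}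
    (hf : MemLp f 2 surfaceMeasure) (hb : IsBandlimited L f) :
    MemLp (deform ζ f) 2 surfaceMeasure := by
  refine MemLp.ae_eq (deform_ae_eq hζ (ae_eq_finiteSynthesis_of_isBandlimited hf hb)).symm ?_
  exact memLp_of_continuous ((continuous_finiteSynthesis _ _).comp hζ.2.continuous)

theorem l2Norm_sub_deform_le {ζ : S2 ≃ S2} (hζ : IsSphereDiffeo ζ) {L : ℕ} {f : S2 → ℂ}
    (hf : MemLp f 2 surfaceMeasure) (hb : IsBandlimited L f) :
    l2Norm (f - deform ζ f) ≤ 4 * ((L : ℝ) ^ 2 * maxDisplacement ζ * l2Norm f) := by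
  have h := ae_eq_finiteSynthesis_of_isBandlimited hf hb
  have hf0 := l2Norm_nonneg f
  have hm := maxDisplacement_nonneg ζ
  rw [l2Norm_congr (h.sub (deform_ae_eq hζ h))]
  refine l2Norm_le_of_bound (by positivity) fun ω => ?_
  refine (norm_finiteSynthesis_sub_le hf ω (ζ.symm ω)).trans ?_
  have := geodesicDist_symm_le_maxDisplacement ζ ω
  gcongr

/-! ### Stability -/

theorem sum_l2Norm_scatteringTransform_sub_isomAct_sq_le {α : ℝ} (hα : 1 < α) {J₀ J : ℕ}
    (hJ : J₀ ≤ J) (D : ℕ) {f : S2 → ℂ} (hf : MemLp f 2 surfaceMeasure)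
    (A : EuclideanSpace ℝ (Fin 3) ≃ₗᵢ[ℝ] EuclideanSpace ℝ (Fin 3)) {δ : ℝ}
    (hδ : ∀ ω, geodesicDist ω (isomAct A ω) ≤ δ) :
    ∑ p ∈ pathFinset J₀ J D, l2Norm (scatteringTransform α J₀ p f -
      scatteringTransform α J₀ p (fun ω => f (isomAct A ω))) ^ 2 ≤
      (α ^ J₀ * δ) ^ 2 * ((D + 1) * l2Norm f ^ 2) := by
  refine le_trans ?_ (mul_le_mul_of_nonneg_left (sum_l2Norm_propagator_sq_le hα hJ D hf)
    (sq_nonneg _))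
  rw [Finset.mul_sum]
  refine Finset.sum_le_sum fun p _ => ?_
  rw [← mul_pow]
  refine pow_le_pow_left₀ (l2Norm_nonneg _) ?_ 2
  have e : scatteringTransform α J₀ p (fun ω => f (isomAct A ω)) =
      fun ω => scatteringTransform α J₀ p f (isomAct A ω) := by
    ext ω; exact scatteringTransform_isomAct hα J₀ p f A ω
  rw [e]
  exact l2Norm_sphConv_sub_isomAct_le hα J₀ (memLp_propagator hα p hf) A hδ

/-- In place of Minkowski's inequality over paths, `(x + y)² ≤ 2 (x² + y²)` is used for each path;
this costs the factor 2. -/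
theorem collectionNorm_sub_le {α : ℝ} (hα : 1 < α) {L J₀ D : ℕ} {f g h : S2 → ℂ}
    (hf : MemLp f 2 surfaceMeasure) (hg : MemLp g 2 surfaceMeasure)
    (hh : MemLp h 2 surfaceMeasure) {a b : ℝ} (ha : 0 ≤ a) (hb : 0 ≤ b)
    (h1 : ∑ p ∈ pathFinset J₀ (maxScale α L) D,
      l2Norm (scatteringTransform α J₀ p f - scatteringTransform α J₀ p g) ^ 2 ≤ a ^ 2)
    (h2 : ∑ p ∈ pathFinset J₀ (maxScale α L) D,
      l2Norm (scatteringTransform α J₀ p g - scatteringTransform α J₀ p h) ^ 2 ≤ b ^ 2) :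
    collectionNorm (scatteringNetwork α L J₀ D f - scatteringNetwork α L J₀ D h) ≤
      2 * (a + b) := by
  rw [collectionNorm, Real.sqrt_le_left (by positivity)]
  have e := sum_pathSet (J₀ := J₀) (J := maxScale α L) (D := D) fun p =>
    l2Norm (scatteringTransform α J₀ p f - scatteringTransform α J₀ p h) ^ 2
  refine (le_of_eq e).trans ?_
  have hm := fun {f : S2 → ℂ} (hf : MemLp f 2 surfaceMeasure) p =>
    memLp_of_continuous (continuous_scatteringTransform hα J₀ p hf)
  have h3 : ∀ p : List ℕ,
      l2Norm (scatteringTransform α J₀ p f - scatteringTransform α J₀ p h) ^ 2 ≤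
      2 * (l2Norm (scatteringTransform α J₀ p f - scatteringTransform α J₀ p g) ^ 2 +
        l2Norm (scatteringTransform α J₀ p g - scatteringTransform α J₀ p h) ^ 2) := by
    intro p
    have ht : l2Norm (scatteringTransform α J₀ p f - scatteringTransform α J₀ p h) ≤
        l2Norm (scatteringTransform α J₀ p f - scatteringTransform α J₀ p g) +
        l2Norm (scatteringTransform α J₀ p g - scatteringTransform α J₀ p h) := by
      have hfg := (hm hf p).sub (hm hg p)
      have hgh := (hm hg p).sub (hm hh p)
      rw [l2Norm_eq_norm ((hm hf p).sub (hm hh p)), l2Norm_eq_norm hfg, l2Norm_eq_norm hgh,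
        MemLp.toLp_sub (hm hf p) (hm hh p), MemLp.toLp_sub (hm hf p) (hm hg p),
        MemLp.toLp_sub (hm hg p) (hm hh p)]
      exact norm_sub_le_norm_sub_add_norm_sub _ _ _
    have := pow_le_pow_left₀ (l2Norm_nonneg _) ht 2
    nlinarith [sq_nonneg (l2Norm (scatteringTransform α J₀ p f - scatteringTransform α J₀ p g) -
      l2Norm (scatteringTransform α J₀ p g - scatteringTransform α J₀ p h))]
  refine (Finset.sum_le_sum fun p _ => h3 p).trans ?_
  rw [← Finset.mul_sum, Finset.sum_add_distrib]
  nlinarith [mul_nonneg ha hb]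

theorem scatteringNetwork_stability :
    ∃ C : ℝ, 0 < C ∧
      ∀ (α : ℝ), 1 < α → ∀ (L J₀ D : ℕ), 1 ≤ L → J₀ ≤ maxScale α L →
      ∀ (ζ ζ₁ ζ₂ : S2 ≃ S2),
        IsSphereDiffeo ζ →
        IsSphereIsometry ζ₁ →
        IsSphereDiffeo ζ₂ →
        (∀ ω, ζ ω = ζ₁ (ζ₂ ω)) →
      ∀ (f : S2 → ℂ),
        MemLp f 2 surfaceMeasure →
        IsBandlimited L f →
        MemLp (deform ζ f) 2 surfaceMeasure ∧
        collectionNorm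
            (scatteringNetwork α L J₀ D f -
              scatteringNetwork α L J₀ D (deform ζ f)) ≤
          C * (L : ℝ) ^ 2 *
            (Real.sqrt L * Real.sqrt (D + 1) * α ^ J₀ * maxDisplacement ζ₁ +
              (L : ℝ) ^ 2 * maxDisplacement ζ₂) *
            l2Norm f := by
  -- `8 = 2 · 4`: the 2 from combining the two pieces in `collectionNorm_sub_le`, the 4 from `√(4π)
  -- ≤ 4`.
  refine ⟨8, by norm_num, ?_⟩
  intro α hα L J₀ D hL hJ ζ ζ₁ ζ₂ hζ hζ₁ hζ₂ hcomp f hf hb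
  refine ⟨memLp_deform hζ hf hb, ?_⟩
  obtain ⟨A, hA⟩ := exists_isomAct_of_isSphereIsometry hζ₁
  have hAs : ∀ ω, ζ₁.symm ω = isomAct A.symm ω := fun ω => by
    rw [Equiv.symm_apply_eq, hA, isomAct_isomAct_symm]
  have hζs : deform ζ f = fun ω => deform ζ₂ f (isomAct A.symm ω) := by
    ext ω
    rw [deform, deform, ← hAs]
    congr 1
    rw [Equiv.symm_apply_eq, hcomp, Equiv.apply_symm_apply, Equiv.apply_symm_apply]
  have hdef := memLp_deform hζ₂ hf hb
  have h1 := sum_l2Norm_scatteringTransform_sub_isomAct_sq_le hα hJ D hf A.symm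
    (fun ω => by rw [← hAs]; exact geodesicDist_symm_le_maxDisplacement ζ₁ ω)
  have h2 := sum_l2Norm_scatteringTransform_sub_sq_le hα hJ D (memLp_comp_isomAct A.symm hf)
    (memLp_comp_isomAct A.symm hdef)
  have h3 : l2Norm ((fun ω => f (isomAct A.symm ω)) - fun ω => deform ζ₂ f (isomAct A.symm ω)) =
      l2Norm (f - deform ζ₂ f) := by
    have e : ((fun ω => f (isomAct A.symm ω)) - fun ω => deform ζ₂ f (isomAct A.symm ω)) =
        fun ω => (f - deform ζ₂ f) (isomAct A.symm ω) := by
      ext ω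
      simp only [Pi.sub_apply]
    rw [e]
    exact l2Norm_comp_isomAct A.symm (f := f - deform ζ₂ f) (hf.sub hdef).aestronglyMeasurable
  have h4 := l2Norm_sub_deform_le hζ₂ hf hb
  have hf0 := l2Norm_nonneg f
  have hm1 := maxDisplacement_nonneg ζ₁
  have hm2 := maxDisplacement_nonneg ζ₂
  have hα0 : 0 < α ^ J₀ := pow_pos (by linarith) _
  rw [h3] at h2
  -- The intermediate signal is `V_ζ₁ f`: the first bound is the isometry piece, the second the
  -- diffeomorphism piece.
  have h5 := collectionNorm_sub_le (L := L) hα hf (memLp_comp_isomAct A.symm hf)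
    (memLp_comp_isomAct A.symm hdef)
    (a := Real.sqrt (D + 1) * α ^ J₀ * maxDisplacement ζ₁ * l2Norm f)
    (b := 4 * ((L : ℝ) ^ 2 * maxDisplacement ζ₂ * l2Norm f)) (by positivity) (by positivity)
    (h1.trans (le_of_eq (by
      have : Real.sqrt ((D : ℝ) + 1) ^ 2 = D + 1 := Real.sq_sqrt (by positivity)
      simp only [mul_pow, this]
      ring)))
    (h2.trans (pow_le_pow_left₀ (l2Norm_nonneg _) h4 2))
  rw [hζs]
  refine h5.trans ?_
  have hL1 : (1 : ℝ) ≤ L := by exact_mod_cast hL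
  have hL2 : (1 : ℝ) ≤ (L : ℝ) ^ 2 := one_le_pow₀ hL1
  have hs : (1 : ℝ) ≤ Real.sqrt L := Real.one_le_sqrt.2 hL1
  have hLs : (1 : ℝ) ≤ (L : ℝ) ^ 2 * Real.sqrt L := one_le_mul_of_one_le_of_one_le hL2 hs
  have k1 : 0 ≤ Real.sqrt (D + 1) * α ^ J₀ * maxDisplacement ζ₁ * l2Norm f := by positivity
  have k2 : 0 ≤ (L : ℝ) ^ 2 * maxDisplacement ζ₂ * l2Norm f := by positivity
  have m1 := mul_le_mul_of_nonneg_right hLs k1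
  have m2 := mul_le_mul_of_nonneg_right hL2 k2
  calc 2 * (Real.sqrt (D + 1) * α ^ J₀ * maxDisplacement ζ₁ * l2Norm f +
        4 * ((L : ℝ) ^ 2 * maxDisplacement ζ₂ * l2Norm f))
      ≤ 8 * ((L : ℝ) ^ 2 * Real.sqrt L *
          (Real.sqrt (D + 1) * α ^ J₀ * maxDisplacement ζ₁ * l2Norm f)) +
        8 * ((L : ℝ) ^ 2 * ((L : ℝ) ^ 2 * maxDisplacement ζ₂ * l2Norm f)) := by linarith
    _ = _ := by ring

end SphereScattering

end

theorem theorem2 :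
    ∃ C : ℝ, 0 < C ∧
      ∀ (α : ℝ), 1 < α → ∀ (L J₀ D : ℕ), 1 ≤ L → J₀ ≤ SphereScattering.maxScale α L →
      ∀ (ζ ζ₁ ζ₂ : SphereScattering.S2 ≃ SphereScattering.S2),
        SphereScattering.IsSphereDiffeo ζ →
        SphereScattering.IsSphereIsometry ζ₁ →
        SphereScattering.IsSphereDiffeo ζ₂ →
        (∀ ω, ζ ω = ζ₁ (ζ₂ ω)) →
      ∀ (f : SphereScattering.S2 → ℂ),
        MeasureTheory.MemLp f 2 SphereScattering.surfaceMeasure →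
        SphereScattering.IsBandlimited L f →
        MeasureTheory.MemLp (SphereScattering.deform ζ f) 2 SphereScattering.surfaceMeasure ∧
        SphereScattering.collectionNorm
            (SphereScattering.scatteringNetwork α L J₀ D f -
              SphereScattering.scatteringNetwork α L J₀ D (SphereScattering.deform ζ f)) ≤
          C * (L : ℝ) ^ 2 *
            (Real.sqrt L * Real.sqrt (D + 1) * α ^ J₀ * SphereScattering.maxDisplacement ζ₁ +
              (L : ℝ) ^ 2 * SphereScattering.maxDisplacement ζ₂) *
            SphereScattering.l2Norm f :=
  SphereScattering.scatteringNetwork_stability
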